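/- Let $\mathbb T=\mathbb R/\mathbb Z$, $\varepsilon>0$ and $q>1$. For $s\in\mathbb R$ let $H^s(\mathbb T)$ be the Sobolev space of periodic distributions with $\|\phi\|_{H^s}=\|(I-\Delta)^{s/2}\phi\|_{L^2}$, and let $W^{t,p}(\mathbb T)=(I-\Delta)^{-t/2}L^p(\mathbb T)$ with the norm $\|(I-\Delta)^{t/2}\cdot\|_{L^p}$. Let $D_q=\frac{d}{dx}+\varepsilon^qP:H^1(\mathbb T)\to L^2(\mathbb T)$ with $Pf=\int_{\mathbb T}f\,dx$, let $L=D_q^{-1}$ on $L^2(\mathbb T)$, and set $C_V=(\frac1{4\varepsilon}I-\varepsilon\Delta)^{-1}$ and $C_U(v)=L\,(\varepsilon^2+v^2)^{-1}L^*$ on $L^2(\mathbb T)$ for $v\in L^2(\mathbb T)$. For real continuous $v$ let $B_v=D_q'(\varepsilon^2+v^2)D_q:H^1(\mathbb T)\to H^{-1}(\mathbb T)$ (on complex-valued distributions). Let $(\Omega_1,\mathbb P_1)$ and $(\Omega_2,\mathbb P_2)$ be probability spaces. Let $V:\Omega_2\to L^2(\mathbb T)$ be a random variable whose law is the Gaussian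 measure with mean $1$ and covariance operator $C_V$, and suppose that for some $t_0<\frac12$ and $1<p_0<\infty$ with $t_0p_0>1$ all values of $V$ lie in $W^{t_0,p_0}(\mathbb T)$ and $V:\Omega_2\to W^{t_0,p_0}(\mathbb T)$ is measurable. Then every $V(\omega_2)$ has a continuous representative (used below in place of $V(\omega_2)$). There is $\delta>0$ such that $$\langle B_vu,u\rangle_{H^{-1}\times H^1}\ge\delta\|u\|_{H^1}^2\qquad\text{for all continuous } v \text{ and all } u\in H^1(\mathbb T),$$ and for every such $\delta$ the following holds with $$\Gamma_v=\frac1{2\pi i}\int_\gamma z^{-1/2}(B_v-z)^{-1}\,dz:H^{-1}(\mathbb T)\to H^{-1}(\mathbb T),\qquad \gamma=\{z\in\mathbb C:\operatorname{dist}(z,\mathbb R_-)=\delta/2\},$$ where $\gamma$ turns around the origin in the positive direction and $z^{-1/2}$ is the principal branch. 1. For every continuous $v$ one has $\Gamma_v\Gamma_v\phi=C_U(v)\phi$ for all $\phi\in L^2(\mathbb T)$. 2. Let $-1<s<-\frac12$. For every $\omega_2\in\Omega_2$ the operator $\Gamma_{V(\omega_2)}$ restricts to a bounded operator from the real space $H^s(\mathbb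 T)$ to the real space $L^2(\mathbb T)$, and $\omega_2\mapsto\Gamma_{V(\omega_2)}\in\mathcal L(H^s(\mathbb T),L^2(\mathbb T))$ is strongly measurable: for every $f\in H^s(\mathbb T)$ the map $\omega_2\mapsto\Gamma_{V(\omega_2)}f\in L^2(\mathbb T)$ is a pointwise limit of simple functions. 3. Let moreover $W:\Omega_1\to H^s(\mathbb T)$ be a centred Gaussian random variable with $\mathbb E\langle W,\phi\rangle_{H^s}\langle W,\psi\rangle_{H^s}=\langle(I-\Delta)^s\phi,\psi\rangle_{H^s}$ for all $\phi,\psi\in H^s(\mathbb T)$. Then $U(\omega_1,\omega_2)=\Gamma_{V(\omega_2)}W(\omega_1)$ is a strongly measurable map $\Omega_1\times\Omega_2\to L^2(\mathbb T)$. For every $\omega_2$ the random variable $U(\cdot,\omega_2)$ is square integrable with mean $0$ and $$\mathbb E_{\mathbb P_1}\big[\langle U(\cdot,\omega_2),\phi\rangle_{L^2}\langle U(\cdot,\omega_2),\psi\rangle_{L^2}\big]=\langle C_U(V(\omega_2))\phi,\psi\rangle_{L^2}\qquad\text{for all }\phi,\psi\in L^2(\mathbb T).$$ Consequently $\mathbb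 E[\langle U,\phi\rangle_{L^2}\langle U,\psi\rangle_{L^2}\mid V]=\langle C_U(V)\phi,\psi\rangle_{L^2}$ almost surely with respect to $\mathbb P_1\otimes\mathbb P_2$. -/

import Mathlib

open MeasureTheory ProbabilityTheory Set
open scoped ENNReal ComplexConjugate

namespace HierPrior

noncomputable section

/-! ### Function spaces on the circle `𝕋 = ℝ/ℤ` (total mass one) -/

/-- The circle `𝕋 = ℝ/ℤ`. -/
abbrev Circ : Type := AddCircle (1 : ℝ)

/-- Lebesgue measure `dx` on `𝕋`; its total mass is `1`. -/
abbrev dx : Measure Circ := AddCircle.haarAddCircle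

/-- Complex `L²(𝕋)`. -/
abbrev L2C : Type := Lp ℂ 2 dx

/-- Real `L²(𝕋)`. -/
abbrev L2R : Type := Lp ℝ 2 dx

instance : MeasurableSpace L2R := borel L2R

instance : BorelSpace L2R := ⟨rfl⟩

/-- `1 + 4π²k²`, the symbol of `I - Δ`. -/
def wt (k : ℤ) : ℝ := 1 + 4 * Real.pi ^ 2 * (k : ℝ) ^ 2

theorem one_le_wt (k : ℤ) : 1 ≤ wt k := by
  unfold wt
  have : 0 ≤ 4 * Real.pi ^ 2 * (k : ℝ) ^ 2 := by positivity
  linarith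

theorem wt_pos (k : ℤ) : 0 < wt k := lt_of_lt_of_le one_pos (one_le_wt k)

/-- `(1 + 4π²k²)^{s/2}`, the symbol of `(I - Δ)^{s/2}`. -/
def wts (s : ℝ) (k : ℤ) : ℝ := wt k ^ (s / 2)

theorem wts_pos (s : ℝ) (k : ℤ) : 0 < wts s k := Real.rpow_pos_of_pos (wt_pos k) _

/-- The space of the sequences `(a k)` of Fourier coefficients, `k ∈ ℤ`, of the periodic
distributions `φ = ∑ a k e^{2πikx}` with `(I - Δ)^{s/2} φ ∈ L²(𝕋)`. -/
def sobolevSubmodule (s : ℝ) : Submodule ℂ (ℤ → ℂ) where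
  carrier := {a | Memℓp (fun k => (wts s k : ℂ) * a k) 2}
  zero_mem' := by
    simp only [Set.mem_ofPred_eq, Pi.zero_apply, mul_zero]
    exact zero_memℓp
  add_mem' := by
    intro a b ha hb
    have h := Memℓp.add ha hb
    refine (congrArg (fun f : ℤ → ℂ => Memℓp f 2) ?_).mp h
    funext k
    simp [mul_add]
  smul_mem' := by
    intro c a ha
    have h := Memℓp.const_smul ha c
    refine (congrArg (fun f : ℤ → ℂ => Memℓp f 2) ?_).mp h
    funext k
    simp only [Pi.smul_apply, smul_eq_mul]
    ring

/-- The complex Sobolev space `H^s(𝕋)`, `s ∈ ℝ`; a periodic distribution is represented by its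
Fourier coefficients. -/
def Hs (s : ℝ) : Type := ↥(sobolevSubmodule s)

/-- The Fourier coefficients of `φ ∈ H^s(𝕋)`. -/
def Hs.coeff {s : ℝ} (φ : Hs s) : ℤ → ℂ := φ.1

instance (s : ℝ) : AddCommGroup (Hs s) := inferInstanceAs (AddCommGroup ↥(sobolevSubmodule s))

instance (s : ℝ) : Module ℂ (Hs s) := inferInstanceAs (Module ℂ ↥(sobolevSubmodule s))

/-- The map `φ ↦ (I - Δ)^{s/2} φ`, from `H^s(𝕋)` onto the Fourier side `ℓ²(ℤ)` of `L²(𝕋)`. -/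
def Hs.bessel (s : ℝ) : Hs s ≃ₗ[ℂ] lp (fun _ : ℤ => ℂ) 2 where
  toFun φ := ⟨fun k => (wts s k : ℂ) * φ.1 k, φ.2⟩
  map_add' φ ψ := by
    ext k
    exact mul_add _ _ _
  map_smul' c φ := by
    ext k
    exact mul_left_comm _ _ _
  invFun b := ⟨fun k => (wts s k : ℂ)⁻¹ * b k, by
    have h := lp.memℓp b
    refine (congrArg (fun f : ℤ → ℂ => Memℓp f 2) ?_).mp h
    funext k
    have : (wts s k : ℂ) ≠ 0 := by exact_mod_cast (wts_pos s k).ne'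
    field_simp⟩
  left_inv φ := by
    apply Subtype.ext
    funext k
    have : (wts s k : ℂ) ≠ 0 := by exact_mod_cast (wts_pos s k).ne'
    exact inv_mul_cancel_left₀ this _
  right_inv b := by
    ext k
    have : (wts s k : ℂ) ≠ 0 := by exact_mod_cast (wts_pos s k).ne'
    exact mul_inv_cancel_left₀ this _

instance (s : ℝ) : NormedAddCommGroup (Hs s) :=
  NormedAddCommGroup.induced (Hs s) (lp (fun _ : ℤ => ℂ) 2) (Hs.bessel s).toLinearMap
    (Hs.bessel s).injective

theorem Hs.norm_def {s : ℝ} (φ : Hs s) : ‖φ‖ = ‖Hs.bessel s φ‖ := rfl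

/-- `⟨φ, ψ⟩_{H^s} = ⟨(I - Δ)^{s/2} φ, (I - Δ)^{s/2} ψ⟩_{L²}`. -/
instance (s : ℝ) : InnerProductSpace ℂ (Hs s) where
  norm_smul_le c φ := by
    rw [Hs.norm_def, Hs.norm_def, map_smul]
    exact norm_smul_le _ _
  inner φ ψ := inner ℂ (Hs.bessel s φ) (Hs.bessel s ψ)
  norm_sq_eq_re_inner φ := by
    rw [Hs.norm_def]
    exact norm_sq_eq_re_inner _
  conj_inner_symm φ ψ := inner_conj_symm _ _
  add_left φ ψ χ := by
    rw [map_add]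
    exact inner_add_left _ _ _
  smul_left φ ψ c := by
    rw [map_smul]
    exact inner_smul_left _ _ _

instance (s : ℝ) : InnerProductSpace ℝ (Hs s) := InnerProductSpace.complexToReal

instance (s : ℝ) : MeasurableSpace (Hs s) := borel (Hs s)

instance (s : ℝ) : BorelSpace (Hs s) := ⟨rfl⟩

/-- `(I - Δ)^{s/2}` as an isometric isomorphism. -/
def Hs.besselIso (s : ℝ) : Hs s ≃ₗᵢ[ℂ] lp (fun _ : ℤ => ℂ) 2 where
  toLinearEquiv := Hs.bessel s
  norm_map' _ := rfl

instance (s : ℝ) : CompleteSpace (Hs s) :=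
  (Hs.besselIso s).toIsometryEquiv.completeSpace

/-- The real Sobolev space `H^s(𝕋)`: the real-valued distributions `φ`, that is, those whose
Fourier coefficients satisfy `a (-k) = conj (a k)`. On it the inner product (over `ℝ`) of the
complex space is `∫ (I - Δ)^{s/2} φ · (I - Δ)^{s/2} ψ dx`. -/
def RHs (s : ℝ) : Submodule ℝ (Hs s) where
  carrier := {φ | ∀ k : ℤ, φ.coeff (-k) = conj (φ.coeff k)}
  zero_mem' := by
    intro k
    exact (map_zero (starRingEnd ℂ)).symm
  add_mem' := by
    intro φ ψ hφ hψ k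
    have h : (φ + ψ).coeff = φ.coeff + ψ.coeff := rfl
    rw [h, Pi.add_apply, Pi.add_apply, map_add, hφ k, hψ k]
  smul_mem' := by
    intro c φ hφ k
    have h : (c • φ).coeff = (c : ℂ) • φ.coeff := rfl
    rw [h, Pi.smul_apply, Pi.smul_apply, hφ k]
    simp

theorem fourierMul_bound (m : ℤ → ℂ) (r s C : ℝ) (h : ∀ k, ‖m k‖ * wts s k ≤ C * wts r k)
    (φ : Hs r) (k : ℤ) :
    ‖(wts s k : ℂ) * (m k * φ.coeff k)‖ ≤ ‖((C : ℂ) • Hs.bessel r φ) k‖ := by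
  have h1 : ‖(wts s k : ℂ) * (m k * φ.coeff k)‖ = (‖m k‖ * wts s k) * ‖φ.coeff k‖ := by
    rw [norm_mul, norm_mul, Complex.norm_real, Real.norm_of_nonneg (wts_pos s k).le]
    ring
  have h2 : ‖((C : ℂ) • Hs.bessel r φ) k‖ = (|C| * wts r k) * ‖φ.coeff k‖ := by
    have h3 : ((C : ℂ) • Hs.bessel r φ) k = (C : ℂ) * ((wts r k : ℂ) * φ.coeff k) := rfl
    rw [h3, norm_mul, norm_mul, Complex.norm_real, Complex.norm_real,
      Real.norm_of_nonneg (wts_pos r k).le, Real.norm_eq_abs]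
    ring
  rw [h1, h2]
  refine mul_le_mul_of_nonneg_right ((h k).trans ?_) (norm_nonneg _)
  exact mul_le_mul_of_nonneg_right (le_abs_self C) (wts_pos r k).le

theorem fourierMul_mem (m : ℤ → ℂ) (r s C : ℝ) (h : ∀ k, ‖m k‖ * wts s k ≤ C * wts r k)
    (φ : Hs r) : (fun k => m k * φ.coeff k) ∈ sobolevSubmodule s :=
  (lp.memℓp ((C : ℂ) • Hs.bessel r φ)).mono' (fourierMul_bound m r s C h φ)

/-- The Fourier multiplier `∑ a k e^{2πikx} ↦ ∑ m k * a k e^{2πikx}` from `H^r(𝕋)` to `H^s(𝕋)`, for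
a symbol `m` of order at most `r - s`. -/
def fourierMul (m : ℤ → ℂ) (r s C : ℝ) (h : ∀ k, ‖m k‖ * wts s k ≤ C * wts r k) :
    Hs r →L[ℂ] Hs s :=
  LinearMap.mkContinuous
    { toFun := fun φ => (⟨fun k => m k * φ.coeff k, fourierMul_mem m r s C h φ⟩ :
        ↥(sobolevSubmodule s))
      map_add' := fun φ ψ => Subtype.ext (funext fun k => mul_add _ _ _)
      map_smul' := fun c φ => Subtype.ext (funext fun k => mul_left_comm _ _ _) }
    ‖(C : ℂ)‖ (by
      intro φ
      rw [Hs.norm_def, Hs.norm_def, ← norm_smul]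
      exact lp.norm_mono (by norm_num) (fourierMul_bound m r s C h φ))

theorem fourierMul_coeff (m : ℤ → ℂ) (r s C : ℝ) (h : ∀ k, ‖m k‖ * wts s k ≤ C * wts r k)
    (φ : Hs r) (k : ℤ) : (fourierMul m r s C h φ).coeff k = m k * φ.coeff k := rfl

/-- The inclusion `H^r(𝕋) ⊆ H^s(𝕋)` for `s ≤ r`. -/
def incl (r s : ℝ) (h : s ≤ r) : Hs r →L[ℂ] Hs s :=
  fourierMul (fun _ => 1) r s 1 (by
    intro k
    simp only [norm_one, one_mul]
    exact Real.rpow_le_rpow_of_exponent_le (one_le_wt k) (by linarith))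

/-- The identification of `L²(𝕋)` with `H^0(𝕋)` by means of the Fourier series. -/
def l2H0 : L2C ≃ₗᵢ[ℂ] Hs 0 := (fourierBasis (T := 1)).repr.trans (Hs.besselIso 0).symm

/-- Real-valued functions as complex-valued functions. -/
def ofRealL2 : L2R →L[ℝ] L2C := Complex.ofRealCLM.compLpL 2 dx

/-- The real part of a function. -/
def reL2 : L2C →L[ℝ] L2R := Complex.reCLM.compLpL 2 dx

/-- A complex-linear operator on `L²(𝕋)` that maps real-valued functions to real-valued functions,
as an operator on the real space. -/
def realOp (T : L2C →L[ℂ] L2C) : L2R →L[ℝ] L2R := reL2 ∘L T.restrictScalars ℝ ∘L ofRealL2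

/-- A real-valued `L²` function as an element of `H^{-1}(𝕋)`. -/
def toHm1 : L2R →L[ℝ] Hs (-1) :=
  ((incl 0 (-1) (by norm_num)) ∘L (l2H0 : L2C →L[ℂ] Hs 0)).restrictScalars ℝ ∘L ofRealL2

/-- Multiplication by a bounded function on `L²(𝕋; 𝕜)`. -/
def mulL2 {𝕜 : Type} [RCLike 𝕜] (m : Lp 𝕜 ∞ dx) : Lp 𝕜 2 dx →L[𝕜] Lp 𝕜 2 dx :=
  (ContinuousLinearMap.mul 𝕜 𝕜).holderL dx ∞ 2 2 m

/-! ### The operators -/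

/-- The symbol `2πik + ε^q δ_{k0}` of the perturbed derivation `D + ε^q P`, `P f = ∫ f dx`. -/
def dqSymbol (ε q : ℝ) (k : ℤ) : ℂ :=
  2 * Real.pi * Complex.I * k + if k = 0 then ((ε ^ q : ℝ) : ℂ) else 0

theorem norm_dqSymbol_le (ε q : ℝ) (k : ℤ) : ‖dqSymbol ε q k‖ ≤ (1 + |ε ^ q|) * wts 1 k := by
  have h1 : 1 ≤ wts 1 k := Real.one_le_rpow (one_le_wt k) (by norm_num)
  have h2 : 2 * Real.pi * |(k : ℝ)| ≤ wts 1 k := by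
    unfold wts
    rw [← Real.sqrt_eq_rpow]
    apply Real.le_sqrt_of_sq_le
    unfold wt
    rw [mul_pow, mul_pow, sq_abs]
    linarith
  have h3 : ‖(2 * Real.pi * Complex.I * k : ℂ)‖ = 2 * Real.pi * |(k : ℝ)| := by
    simp [abs_of_pos Real.pi_pos]
  have h4 : ‖(if k = 0 then ((ε ^ q : ℝ) : ℂ) else 0)‖ ≤ |ε ^ q| := by
    split_ifs
    · rw [Complex.norm_real, Real.norm_eq_abs]
    · simp
  calc ‖dqSymbol ε q k‖ ≤ 2 * Real.pi * |(k : ℝ)| + |ε ^ q| := by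
        unfold dqSymbol
        refine (norm_add_le _ _).trans ?_
        rw [h3]
        gcongr
    _ ≤ wts 1 k + |ε ^ q| * wts 1 k := by
        gcongr
        exact le_mul_of_one_le_right (abs_nonneg _) h1
    _ = _ := by ring

/-- `D_q = D + ε^q P : H¹(𝕋) → L²(𝕋)`. -/
def Dq (ε q : ℝ) : Hs 1 →L[ℂ] L2C :=
  (l2H0.symm : Hs 0 →L[ℂ] L2C) ∘L fourierMul (dqSymbol ε q) 1 0 (1 + |ε ^ q|) (by
    intro k
    have : wts 0 k = 1 := by simp [wts]
    rw [this, mul_one]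
    exact norm_dqSymbol_le ε q k)

/-- The adjoint `D_q' : L²(𝕋) → H^{-1}(𝕋)` of `D_q`; its symbol is the conjugate one. -/
def DqAdj (ε q : ℝ) : L2C →L[ℂ] Hs (-1) :=
  fourierMul (fun k => conj (dqSymbol ε q k)) 0 (-1) (1 + |ε ^ q|) (by
    intro k
    have h0 : wts 0 k = 1 := by simp [wts]
    have h1 : wts 1 k * wts (-1) k = 1 := by
      unfold wts
      rw [← Real.rpow_add (wt_pos k)]
      norm_num
    rw [RCLike.norm_conj, h0, mul_one]
    calc ‖dqSymbol ε q k‖ * wts (-1) k ≤ ((1 + |ε ^ q|) * wts 1 k) * wts (-1) k := by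
          gcongr
          · exact (wts_pos (-1) k).le
          · exact norm_dqSymbol_le ε q k
      _ = 1 + |ε ^ q| := by rw [mul_assoc, h1, mul_one]) ∘L (l2H0 : L2C →L[ℂ] Hs 0)

/-- The bounded continuous function `ε² + v²`. -/
def coef (ε : ℝ) (v : C(Circ, ℝ)) : C(Circ, ℂ) :=
  ⟨fun x => ((ε ^ 2 + v x ^ 2 : ℝ) : ℂ), by fun_prop⟩

/-- `B_v = D_q' (ε² + v²) D_q : H¹(𝕋) → H^{-1}(𝕋)`. -/
def Bop (ε q : ℝ) (v : C(Circ, ℝ)) : Hs 1 →L[ℂ] Hs (-1) :=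
  DqAdj ε q ∘L mulL2 (ContinuousMap.toLp ∞ dx ℂ (coef ε v)) ∘L Dq ε q

/-- The pairing `⟨f, ū⟩` of `f ∈ H^{-1}(𝕋)` with the conjugate of `u ∈ H¹(𝕋)`. -/
def pairing (f : Hs (-1)) (u : Hs 1) : ℂ := ∑' k : ℤ, f.coeff k * conj (u.coeff k)

/-- `δ` is a lower bound in `⟨B_v u, u⟩ ≥ δ ‖u‖²_{H¹}`, uniformly in `v`. -/
def IsCoercivityConst (ε q δ : ℝ) : Prop :=
  ∀ (v : C(Circ, ℝ)) (u : Hs 1), δ * ‖u‖ ^ 2 ≤ (pairing (Bop ε q v u) u).re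

/-- The resolvent `(B_v - z)⁻¹ : H^{-1}(𝕋) → H¹(𝕋) ⊆ H^{-1}(𝕋)`. -/
def resolv (ε q : ℝ) (v : C(Circ, ℝ)) (z : ℂ) : Hs (-1) →L[ℂ] Hs (-1) :=
  incl 1 (-1) (by norm_num) ∘L (Bop ε q v - z • incl 1 (-1) (by norm_num)).inverse

/-- The integrand `z^{-1/2} (B_v - z)⁻¹`, with the principal branch of the power. -/
def dtIntegrand (ε q : ℝ) (v : C(Circ, ℝ)) (z : ℂ) : Hs (-1) →L[ℂ] Hs (-1) :=
  z ^ (-(1 / 2) : ℂ) • resolv ε q v z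

/-- The Dunford–Taylor integral `Γ_v = (2πi)⁻¹ ∫_γ z^{-1/2} (B_v - z)⁻¹ dz` on `H^{-1}(𝕋)`, where
`γ = {z : dist(z, ℝ₋) = δ/2}` is run through counterclockwise around the origin: first the half-line
`x - iδ/2`, `x` from `-∞` to `0`, then the half-circle `(δ/2) e^{iθ}`, `-π/2 ≤ θ ≤ π/2`, then the
half-line `x + iδ/2`, `x` from `0` to `-∞`. -/
def Gam (ε q δ : ℝ) (v : C(Circ, ℝ)) : Hs (-1) →L[ℂ] Hs (-1) :=
  (2 * Real.pi * Complex.I : ℂ)⁻¹ •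
    ((∫ x in Iic (0 : ℝ), dtIntegrand ε q v (x - (δ / 2 : ℝ) * Complex.I))
      + (∫ θ in (-(Real.pi / 2))..(Real.pi / 2),
          (Complex.I * ((δ / 2 : ℝ) * Complex.exp (θ * Complex.I))) •
            dtIntegrand ε q v ((δ / 2 : ℝ) * Complex.exp (θ * Complex.I)))
      - ∫ x in Iic (0 : ℝ), dtIntegrand ε q v (x + (δ / 2 : ℝ) * Complex.I))

/-- `L = D_q⁻¹` on real `L²(𝕋)`. -/
def Lop (ε q : ℝ) : L2R →L[ℝ] L2R :=
  realOp ((l2H0.symm : Hs 0 →L[ℂ] L2C) ∘L incl 1 0 (by norm_num) ∘L (Dq ε q).inverse)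

/-- The bounded function `(ε² + v²)⁻¹` for `v ∈ L²(𝕋)`, `ε > 0`. -/
def lamFun (ε : ℝ) (hε : 0 < ε) (v : L2R) : Lp ℝ ∞ dx :=
  MemLp.toLp (fun x => (ε ^ 2 + v x ^ 2)⁻¹) (memLp_top_of_bound
    (((Lp.aestronglyMeasurable v).aemeasurable.pow_const 2).const_add
      (ε ^ 2)).inv.aestronglyMeasurable (ε ^ 2)⁻¹ (Filter.Eventually.of_forall fun x => by
        have h : 0 < ε ^ 2 := by positivity
        rw [Real.norm_of_nonneg (by positivity)]
        gcongr
        nlinarith [sq_nonneg (v x)]))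

/-- `C_U(v) = L Λ(v) L*` on real `L²(𝕋)`, where `Λ(v)` is multiplication by `(ε² + v²)⁻¹`. -/
def covU (ε q : ℝ) (hε : 0 < ε) (v : L2R) : L2R →L[ℝ] L2R :=
  Lop ε q ∘L mulL2 (lamFun ε hε v) ∘L ContinuousLinearMap.adjoint (Lop ε q)

/-- `(4ε)⁻¹ I - ε Δ : H²(𝕋) → L²(𝕋)`. -/
def precV (ε : ℝ) : Hs 2 →L[ℂ] L2C :=
  (l2H0.symm : Hs 0 →L[ℂ] L2C) ∘L
    fourierMul (fun k => (((4 * ε)⁻¹ + ε * (4 * Real.pi ^ 2 * (k : ℝ) ^ 2) : ℝ) : ℂ)) 2 0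
      (|(4 * ε)⁻¹| + |ε|) (by
        intro k
        have h0 : wts 0 k = 1 := by simp [wts]
        have h2 : wts 2 k = 1 + 4 * Real.pi ^ 2 * (k : ℝ) ^ 2 := by simp [wts, wt]
        have hk : 0 ≤ 4 * Real.pi ^ 2 * (k : ℝ) ^ 2 := by positivity
        rw [h0, h2, mul_one, Complex.norm_real, Real.norm_eq_abs]
        refine (abs_add_le _ _).trans ?_
        rw [abs_mul, abs_of_nonneg hk]
        nlinarith [abs_nonneg (4 * ε)⁻¹, abs_nonneg ε, mul_nonneg (abs_nonneg (4 * ε)⁻¹) hk])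

/-- `C_V = ((4ε)⁻¹ I - ε Δ)⁻¹` on real `L²(𝕋)`. -/
def covV (ε : ℝ) : L2R →L[ℝ] L2R :=
  realOp ((l2H0.symm : Hs 0 →L[ℂ] L2C) ∘L incl 2 0 (by norm_num) ∘L (precV ε).inverse)

/-! ### The random variables -/

/-- The constant function `1` in `L²(𝕋)`. -/
def oneL2 : L2R := ContinuousMap.toLp 2 dx ℝ 1

/-- `V` is an `L²(𝕋)`-valued random variable whose law is the Gaussian measure with mean `1` and
covariance operator `C_V`. -/
structure IsPriorV (ε : ℝ) {Ω : Type*} [MeasurableSpace Ω] (P : Measure Ω) (V : Ω → L2R) :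
    Prop where
  measurable : Measurable V
  gaussian : HasGaussianLaw V P
  mean : ∫ ω, V ω ∂P = oneL2
  cov : ∀ φ ψ : L2R, ∫ ω, inner ℝ (V ω - oneL2) φ * inner ℝ (V ω - oneL2) ψ ∂P =
    inner ℝ (covV ε φ) ψ

/-- `(I - Δ)^{t/2} v = g` in the sense of periodic distributions. The Sobolev space `W^{t,p}(𝕋)`
consists of the `v` for which there is such a `g` in `L^p(𝕋)`, with `‖v‖_{W^{t,p}} = ‖g‖_{L^p}`. -/
def IsBesselDeriv (t : ℝ) (v g : Circ → ℝ) : Prop :=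
  ∀ k : ℤ, (wts t k : ℂ) * fourierCoeff (fun x => (v x : ℂ)) k =
    fourierCoeff (fun x => (g x : ℂ)) k

/-- All values of `V` lie in `W^{t,p}(𝕋)`, and `V` is measurable as a map into `W^{t,p}(𝕋)`, the
latter being isometric to `L^p(𝕋)` under `(I - Δ)^{t/2}`. -/
def IsSobolevValued (t : ℝ) (p : ℝ≥0∞) [Fact (1 ≤ p)] {Ω : Type*} [MeasurableSpace Ω] (V : Ω → L2R) : Prop :=
  ∃ g : Ω → Lp ℝ p dx, StronglyMeasurable g ∧ ∀ ω, IsBesselDeriv t (V ω) (g ω)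

open Classical in
/-- The continuous function in the class of `v`, if there is one (it is unique then). -/
def contRep (v : L2R) : C(Circ, ℝ) :=
  if h : ∃ f : C(Circ, ℝ), (f : Circ → ℝ) =ᵐ[dx] v then h.choose else 0

/-- `(I - Δ)^s` on `H^s(𝕋)`, `s ≤ 0`. -/
def covW (s : ℝ) (hs : s ≤ 0) : Hs s →L[ℂ] Hs s :=
  fourierMul (fun k => ((wt k ^ s : ℝ) : ℂ)) s s 1 (by
    intro k
    have h : wt k ^ s ≤ 1 := Real.rpow_le_one_of_one_le_of_nonpos (one_le_wt k) hs
    rw [Complex.norm_real, Real.norm_of_nonneg (Real.rpow_nonneg (wt_pos k).le s)]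
    gcongr
    exact (wts_pos s k).le)

/-- `W` is a centred Gaussian random variable in the real space `H^s(𝕋)` with covariance operator
`(I - Δ)^s`, that is, white noise. -/
structure IsWhiteNoise (s : ℝ) (hs : s ≤ 0) {Ω : Type*} [MeasurableSpace Ω] (P : Measure Ω)
    (W : Ω → RHs s) : Prop where
  measurable : Measurable W
  gaussian : HasGaussianLaw W P
  mean : ∫ ω, W ω ∂P = 0
  cov : ∀ φ ψ : RHs s, ∫ ω, inner ℝ (W ω) φ * inner ℝ (W ω) ψ ∂P =
    inner ℝ (covW s hs (φ : Hs s)) (ψ : Hs s)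

end

end HierPrior

namespace HierPrior

noncomputable section

/-! ### Fourier multipliers -/

/-! Put `S = D_q' √(ε² + v²) : L² → H^{-1}` and `T = √(ε² + v²) D_q : H¹ → L²`. Both are
isomorphisms, since the symbol of `D_q` never vanishes and grows like `|k|`, and `B_v = S T`. Let `K
= D_q⁻¹ (ε² + v²)^{-1/2}` on `L²`. Then `K T` is the inclusion `H¹ ⊆ L²` and `S K*` is the inclusion
`L² ⊆ H^{-1}`, so `B_v - z = S (1 - z K*K) T`. Hence `z^{-1/2} (B_v - z)⁻¹` is the conjugate by `S`
of `z^{-1/2} a (1 - z a)⁻¹` with `a = K*K ≥ 0` (`dtIntegrand_eq`). Coercivity says exactly that `‖a‖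
≤ 1/δ`, which keeps the contour of radius `δ/2` away from the singularities.

For a number `τ ≥ 0` in place of `a` the contour integral is `√τ`, by explicit antiderivatives
(`keyholeIntegral_scalarIntegrand`). The continuous functional calculus carries this to `a`, so `Γ_v
= S √(K*K) S⁻¹` (`Gam_eq`). As `K*` intertwines `K*K` and `KK*`, it intertwines their roots, and on
`L²` the operator `Γ_v` is `R = √(KK*)` (`Gam_l2Hm1`). Its square is `KK* = L (ε² + v²)⁻¹ L*`, which
is `C_U(v)`.

Since `‖R f‖ = ‖K* f‖` and `K*` contains `(D_q')⁻¹`, the norm of `R f` is bounded by the `H^{-1}`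
norm of `f`, uniformly in `v`. By density `R` extends to `H^{-1} → L²`, and the extension is `Γ_v`.
It preserves real distributions, because the conjugate of `R` is again a positive root of `KK*`.

For measurability, `v ↦ Γ_v f` is continuous from `C(𝕋)` to `H^{-1}`. The continuous injections
`C(𝕋) → L²` and `L² → H^{-1}` between Polish spaces are measurable embeddings, so `V ↦ Γ_V f` is
measurable into `L²`. Continuity in `f` gives joint measurability.

If `A` is the restriction of `Γ_v` to real `H^s`, then `(I - Δ)^s A* = R` on real `L²`
(`smoothing_adjoint_realRoot`), so the covariance of `A W` is `R² = C_U(v)`. Fubini's theorem gives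
the conditional statement.

That the values of `V` have continuous representatives is the Sobolev embedding for `t₀ p₀ > 1`. It
follows from writing `(I - Δ)^{-t/2}` as an integral over the heat semigroup and from the `L^p →
C(𝕋)` bound for the heat kernel. -/

theorem Hs.ext_coeff {s : ℝ} {φ ψ : Hs s} (h : ∀ k, φ.coeff k = ψ.coeff k) : φ = ψ :=
  Subtype.ext (funext h)

theorem wts_zero (k : ℤ) : wts 0 k = 1 := by simp [wts]

theorem wts_neg_index (s : ℝ) (k : ℤ) : wts s (-k) = wts s k := by simp [wts, wt]

theorem wts_mul_wts_neg (s : ℝ) (k : ℤ) : wts s k * wts (-s) k = 1 := by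
  unfold wts
  rw [← Real.rpow_add (wt_pos k)]
  simp [neg_div]

theorem Hs.bessel_apply {s : ℝ} (φ : Hs s) (k : ℤ) :
    Hs.bessel s φ k = (wts s k : ℂ) * φ.coeff k := rfl

theorem incl_coeff (r s : ℝ) (h : s ≤ r) (φ : Hs r) (k : ℤ) :
    (incl r s h φ).coeff k = φ.coeff k := by
  unfold incl
  rw [fourierMul_coeff, one_mul]

theorem l2H0_coeff (f : L2C) (k : ℤ) : (l2H0 f).coeff k = fourierBasis.repr f k := by
  have h : Hs.bessel 0 (l2H0 f) = fourierBasis.repr f :=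
    (Hs.besselIso 0).apply_symm_apply _
  rw [← h, Hs.bessel_apply, wts_zero]
  simp

theorem repr_l2H0_symm (φ : Hs 0) (k : ℤ) :
    fourierBasis.repr (l2H0.symm φ) k = φ.coeff k := by
  rw [← l2H0_coeff, l2H0.apply_symm_apply]

theorem L2C.ext_repr {f g : L2C} (h : ∀ k, fourierBasis.repr f k = fourierBasis.repr g k) :
    f = g :=
  fourierBasis.repr.injective (lp.ext (funext h))

theorem inner_eq_tsum_repr (f g : L2C) :
    inner ℂ f g = ∑' k : ℤ, conj (fourierBasis.repr f k) * fourierBasis.repr g k := by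
  rw [← fourierBasis.repr.inner_map_map, lp.inner_eq_tsum]
  refine tsum_congr fun k => ?_
  rw [RCLike.inner_apply, mul_comm]

theorem norm_incl_le (r s : ℝ) (h : s ≤ r) (φ : Hs r) : ‖incl r s h φ‖ ≤ ‖φ‖ := by
  rw [Hs.norm_def, Hs.norm_def]
  refine lp.norm_mono (by norm_num) fun k => ?_
  rw [Hs.bessel_apply, Hs.bessel_apply, incl_coeff, norm_mul, norm_mul, Complex.norm_real,
    Complex.norm_real, Real.norm_of_nonneg (wts_pos _ k).le, Real.norm_of_nonneg (wts_pos _ k).le]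
  gcongr
  exact Real.rpow_le_rpow_of_exponent_le (one_le_wt k) (by linarith)

/-! ### Complex conjugation -/

/-- Complex conjugation on `L²(𝕋)`. -/
def conjL2 : L2C →L[ℝ] L2C := (Complex.conjCLE : ℂ →L[ℝ] ℂ).compLpL 2 dx

theorem coeFn_conjL2 (f : L2C) : conjL2 f =ᵐ[dx] fun x => conj (f x) :=
  ContinuousLinearMap.coeFn_compLpL _ f

theorem coeFn_ofRealL2 (f : L2R) : ofRealL2 f =ᵐ[dx] fun x => ((f x : ℝ) : ℂ) :=
  ContinuousLinearMap.coeFn_compLpL _ f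

theorem coeFn_reL2 (f : L2C) : reL2 f =ᵐ[dx] fun x => (f x).re :=
  ContinuousLinearMap.coeFn_compLpL _ f

theorem conjL2_conjL2 (f : L2C) : conjL2 (conjL2 f) = f := by
  apply Lp.ext
  filter_upwards [coeFn_conjL2 (conjL2 f), coeFn_conjL2 f] with x h1 h2
  rw [h1, h2, Complex.conj_conj]

theorem conjL2_ofRealL2 (f : L2R) : conjL2 (ofRealL2 f) = ofRealL2 f := by
  apply Lp.ext
  filter_upwards [coeFn_conjL2 (ofRealL2 f), coeFn_ofRealL2 f] with x h1 h2
  rw [h1, h2, Complex.conj_ofReal]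

theorem reL2_ofRealL2 (f : L2R) : reL2 (ofRealL2 f) = f := by
  apply Lp.ext
  filter_upwards [coeFn_reL2 (ofRealL2 f), coeFn_ofRealL2 f] with x h1 h2
  rw [h1, h2, Complex.ofReal_re]

theorem ofRealL2_reL2 {f : L2C} (h : conjL2 f = f) : ofRealL2 (reL2 f) = f := by
  apply Lp.ext
  have h0 := coeFn_conjL2 f
  rw [h] at h0
  filter_upwards [coeFn_ofRealL2 (reL2 f), coeFn_reL2 f, h0] with x h1 h2 h3
  rw [h1, h2]
  exact Complex.conj_eq_iff_re.mp h3.symm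

theorem inner_conjL2 (f g : L2C) : inner ℂ (conjL2 f) (conjL2 g) = conj (inner ℂ f g) := by
  rw [L2.inner_def, L2.inner_def, ← integral_conj]
  refine integral_congr_ae ?_
  filter_upwards [coeFn_conjL2 f, coeFn_conjL2 g] with x h1 h2
  simp [h1, h2]

theorem inner_ofRealL2 (f g : L2R) :
    inner ℂ (ofRealL2 f) (ofRealL2 g) = ((inner ℝ f g : ℝ) : ℂ) := by
  rw [L2.inner_def, L2.inner_def, ← integral_complex_ofReal]
  refine integral_congr_ae ?_
  filter_upwards [coeFn_ofRealL2 f, coeFn_ofRealL2 g] with x h1 h2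
  simp [h1, h2]

theorem inner_reL2 (f : L2C) (g : L2R) :
    inner ℝ (reL2 f) g = (inner ℂ f (ofRealL2 g)).re := by
  rw [L2.inner_def, L2.inner_def]
  rw [← RCLike.re_eq_complex_re, ← integral_re (L2.integrable_inner f (ofRealL2 g))]
  refine integral_congr_ae ?_
  filter_upwards [coeFn_reL2 f, coeFn_ofRealL2 g] with x h1 h2
  simp [h1, h2]

theorem norm_ofRealL2 (f : L2R) : ‖ofRealL2 f‖ = ‖f‖ := by
  rw [Lp.norm_def, Lp.norm_def]
  congr 1
  refine eLpNorm_congr_norm_ae ?_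
  filter_upwards [coeFn_ofRealL2 f] with x h
  rw [h, Complex.norm_real]

theorem repr_conjL2 (f : L2C) (k : ℤ) :
    fourierBasis.repr (conjL2 f) k = conj (fourierBasis.repr f (-k)) := by
  rw [fourierBasis_repr, fourierBasis_repr, fourierCoeff, fourierCoeff, ← integral_conj]
  refine integral_congr_ae ?_
  filter_upwards [coeFn_conjL2 f] with x h
  rw [h, smul_eq_mul, smul_eq_mul, map_mul, ← fourier_neg, neg_neg]

/-- Complex conjugation on `H^s(𝕋)`. -/
def conjHs (s : ℝ) : Hs s →L[ℝ] Hs s :=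
  (((fourierBasis (T := 1)).repr.trans (Hs.besselIso s).symm :
      L2C ≃ₗᵢ[ℂ] Hs s) : L2C →L[ℂ] Hs s).restrictScalars ℝ ∘L conjL2 ∘L
    ((((fourierBasis (T := 1)).repr.trans (Hs.besselIso s).symm).symm :
      Hs s ≃ₗᵢ[ℂ] L2C) : Hs s →L[ℂ] L2C).restrictScalars ℝ

theorem conjHs_coeff {s : ℝ} (φ : Hs s) (k : ℤ) :
    (conjHs s φ).coeff k = conj (φ.coeff (-k)) := by
  have h1 : conjHs s φ = (Hs.besselIso s).symm (fourierBasis.repr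
    (conjL2 (fourierBasis.repr.symm (Hs.besselIso s φ)))) := rfl
  have h2 : Hs.besselIso s (conjHs s φ) = fourierBasis.repr
    (conjL2 (fourierBasis.repr.symm (Hs.besselIso s φ))) := by
      rw [h1, LinearIsometryEquiv.apply_symm_apply]
  have h3 : (wts s k : ℂ) * (conjHs s φ).coeff k = conj ((wts s (-k) : ℂ) * φ.coeff (-k)) := by
    rw [← Hs.bessel_apply, ← Hs.bessel_apply]
    change Hs.besselIso s (conjHs s φ) k = conj (Hs.besselIso s φ (-k))
    rw [h2, repr_conjL2, LinearIsometryEquiv.apply_symm_apply]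
  rw [wts_neg_index, map_mul, Complex.conj_ofReal] at h3
  exact mul_left_cancel₀ (by exact_mod_cast (wts_pos s k).ne') h3

/-- Recasts the symmetry of the coefficients as a fixed-point equation for a continuous map. In this
form it passes through operators that commute with conjugation and gives closedness. -/
theorem mem_RHs_iff {s : ℝ} (φ : Hs s) : φ ∈ RHs s ↔ conjHs s φ = φ := by
  constructor
  · intro h
    refine Hs.ext_coeff fun k => ?_
    rw [conjHs_coeff, h k, Complex.conj_conj]
  · intro h k
    rw [← h, conjHs_coeff, neg_neg, h]

theorem incl_conjHs (r s : ℝ) (h : s ≤ r) (φ : Hs r) :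
    incl r s h (conjHs r φ) = conjHs s (incl r s h φ) :=
  Hs.ext_coeff fun k => by simp only [incl_coeff, conjHs_coeff]

/-! ### Multiplication operators -/

/-- Multiplication by a continuous function on `L²(𝕋)`. -/
def mulC (g : C(Circ, ℂ)) : L2C →L[ℂ] L2C := mulL2 (ContinuousMap.toLp ∞ dx ℂ g)

theorem coeFn_mulL2 {𝕜 : Type} [RCLike 𝕜] (m : Lp 𝕜 ∞ dx) (f : Lp 𝕜 2 dx) :
    mulL2 m f =ᵐ[dx] fun x => m x * f x :=
  ContinuousLinearMap.coeFn_holder (ContinuousLinearMap.mul 𝕜 𝕜) m f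

theorem coeFn_mulC (g : C(Circ, ℂ)) (f : L2C) : mulC g f =ᵐ[dx] fun x => g x * f x := by
  filter_upwards [coeFn_mulL2 (ContinuousMap.toLp ∞ dx ℂ g) f,
    ContinuousMap.coeFn_toLp (p := ∞) (𝕜 := ℂ) dx g] with x h1 h2
  rw [mulC, h1, h2]

theorem mulC_mulC (g h : C(Circ, ℂ)) (f : L2C) : mulC g (mulC h f) = mulC (g * h) f := by
  apply Lp.ext
  filter_upwards [coeFn_mulC g (mulC h f), coeFn_mulC h f, coeFn_mulC (g * h) f] with x h1 h2 h3
  rw [h1, h2, h3, ContinuousMap.mul_apply, mul_assoc]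

theorem mulC_one (f : L2C) : mulC 1 f = f := by
  apply Lp.ext
  filter_upwards [coeFn_mulC 1 f] with x h1
  rw [h1, ContinuousMap.one_apply, one_mul]

theorem inner_mulC_left (g : C(Circ, ℂ)) (f h : L2C) :
    inner ℂ (mulC g f) h = inner ℂ f (mulC (star g) h) := by
  rw [L2.inner_def, L2.inner_def]
  refine integral_congr_ae ?_
  filter_upwards [coeFn_mulC g f, coeFn_mulC (star g) h] with x h1 h2
  simp [h1, h2]
  ring

theorem adjoint_mulC (g : C(Circ, ℂ)) :
    ContinuousLinearMap.adjoint (mulC g) = mulC (star g) := by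
  symm
  rw [ContinuousLinearMap.eq_adjoint_iff]
  intro f h
  rw [inner_mulC_left, star_star]

theorem mulC_conjL2 (g : C(Circ, ℂ)) (f : L2C) :
    mulC g (conjL2 f) = conjL2 (mulC (star g) f) := by
  apply Lp.ext
  filter_upwards [coeFn_mulC g (conjL2 f), coeFn_conjL2 f, coeFn_conjL2 (mulC (star g) f),
    coeFn_mulC (star g) f] with x h1 h2 h3 h4
  rw [h1, h2, h3, h4]
  simp

theorem continuous_mulC : Continuous mulC :=
  ((ContinuousLinearMap.mul ℂ ℂ).holderL dx ∞ 2 2).continuous.comp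
    (ContinuousMap.toLp ∞ dx ℂ).continuous

/-! ### The perturbed derivation and its inverse -/

/-- The derivative alone has symbol zero at `k = 0`, and there the term `ε^q P` supplies the lower
bound. Elsewhere `2π|k|` is comparable with `√(1 + 4π²k²)`. -/
theorem exists_le_norm_dqSymbol {ε : ℝ} (hε : 0 < ε) (q : ℝ) :
    ∃ c : ℝ, 0 < c ∧ ∀ k, c * wts 1 k ≤ ‖dqSymbol ε q k‖ := by
  have hq : 0 < ε ^ q := Real.rpow_pos_of_pos hε q
  refine ⟨min (1 / 2) (ε ^ q), lt_min (by norm_num) hq, fun k => ?_⟩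
  rcases eq_or_ne k 0 with rfl | hk
  · have h1 : wts 1 0 = 1 := by simp [wts, wt]
    have h2 : ‖dqSymbol ε q 0‖ = ε ^ q := by
      simp [dqSymbol, abs_of_pos hq]
    rw [h1, h2, mul_one]
    exact min_le_right _ _
  · have h3 : ‖dqSymbol ε q k‖ = 2 * Real.pi * |(k : ℝ)| := by
      simp [dqSymbol, hk, abs_of_pos Real.pi_pos]
    have hk1 : (1 : ℝ) ≤ |(k : ℝ)| := by
      exact_mod_cast Int.one_le_abs hk
    have h4 : wts 1 k ≤ 2 * (2 * Real.pi * |(k : ℝ)|) := by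
      unfold wts
      rw [← Real.sqrt_eq_rpow]
      apply Real.sqrt_le_iff.mpr
      refine ⟨by positivity, ?_⟩
      unfold wt
      have h5 : (k : ℝ) ^ 2 = |(k : ℝ)| ^ 2 := (sq_abs _).symm
      rw [h5]
      -- The constant `1/2` requires `1 + 4π²k² ≤ 16π²k²`, for which `π|k| ≥ 1` is ample.
      have h6 : (1 : ℝ) ≤ Real.pi * |(k : ℝ)| := by
        nlinarith [Real.pi_gt_three]
      nlinarith
    rw [h3]
    calc min (1 / 2) (ε ^ q) * wts 1 k ≤ 1 / 2 * wts 1 k := by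
          gcongr
          · exact (wts_pos 1 k).le
          · exact min_le_left _ _
      _ ≤ _ := by linarith

theorem dqSymbol_ne_zero {ε : ℝ} (hε : 0 < ε) (q : ℝ) (k : ℤ) : dqSymbol ε q k ≠ 0 := by
  obtain ⟨c, hc, h⟩ := exists_le_norm_dqSymbol hε q
  rw [← norm_pos_iff]
  exact lt_of_lt_of_le (mul_pos hc (wts_pos 1 k)) (h k)

theorem dqSymbol_neg (ε q : ℝ) (k : ℤ) : dqSymbol ε q (-k) = conj (dqSymbol ε q k) := by
  unfold dqSymbol
  by_cases hk : k = 0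
  · simp [hk]
  · simp [hk, Complex.conj_ofNat]

theorem exists_norm_inv_dqSymbol_le {ε : ℝ} (hε : 0 < ε) (q : ℝ) :
    ∃ C : ℝ, ∀ k, ‖(dqSymbol ε q k)⁻¹‖ * wts 1 k ≤ C := by
  obtain ⟨c, hc, h⟩ := exists_le_norm_dqSymbol hε q
  refine ⟨c⁻¹, fun k => ?_⟩
  have h0 : 0 < ‖dqSymbol ε q k‖ := norm_pos_iff.mpr (dqSymbol_ne_zero hε q k)
  rw [norm_inv, inv_mul_le_iff₀ h0, ← div_eq_mul_inv, le_div_iff₀ hc, mul_comm]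
  exact h k

theorem Dq_repr (ε q : ℝ) (u : Hs 1) (k : ℤ) :
    fourierBasis.repr (Dq ε q u) k = dqSymbol ε q k * u.coeff k :=
  repr_l2H0_symm _ k

theorem DqAdj_coeff (ε q : ℝ) (f : L2C) (k : ℤ) :
    (DqAdj ε q f).coeff k = conj (dqSymbol ε q k) * fourierBasis.repr f k := by
  rw [← l2H0_coeff]
  rfl

/-- The inverse of `D_q`. -/
def DqInv {ε : ℝ} (hε : 0 < ε) (q : ℝ) : L2C →L[ℂ] Hs 1 :=
  fourierMul (fun k => (dqSymbol ε q k)⁻¹) 0 1 (exists_norm_inv_dqSymbol_le hε q).choose (by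
    intro k
    rw [wts_zero, mul_one]
    exact (exists_norm_inv_dqSymbol_le hε q).choose_spec k) ∘L (l2H0 : L2C →L[ℂ] Hs 0)

/-- The inverse of `D_q'`. -/
def DqAdjInv {ε : ℝ} (hε : 0 < ε) (q : ℝ) : Hs (-1) →L[ℂ] L2C :=
  (l2H0.symm : Hs 0 →L[ℂ] L2C) ∘L
    fourierMul (fun k => (conj (dqSymbol ε q k))⁻¹) (-1) 0
      (exists_norm_inv_dqSymbol_le hε q).choose (by
    intro k
    have h := (exists_norm_inv_dqSymbol_le hε q).choose_spec k
    rw [wts_zero, mul_one, ← map_inv₀, RCLike.norm_conj]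
    calc ‖(dqSymbol ε q k)⁻¹‖ = ‖(dqSymbol ε q k)⁻¹‖ * wts 1 k * wts (-1) k := by
          rw [mul_assoc, wts_mul_wts_neg, mul_one]
      _ ≤ _ := by
          gcongr
          exact (wts_pos _ k).le)

theorem DqInv_coeff {ε : ℝ} (hε : 0 < ε) (q : ℝ) (f : L2C) (k : ℤ) :
    (DqInv hε q f).coeff k = (dqSymbol ε q k)⁻¹ * fourierBasis.repr f k := by
  rw [← l2H0_coeff]
  rfl

theorem DqAdjInv_repr {ε : ℝ} (hε : 0 < ε) (q : ℝ) (f : Hs (-1)) (k : ℤ) :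
    fourierBasis.repr (DqAdjInv hε q f) k = (conj (dqSymbol ε q k))⁻¹ * f.coeff k :=
  repr_l2H0_symm _ k

theorem conj_dqSymbol_ne_zero {ε : ℝ} (hε : 0 < ε) (q : ℝ) (k : ℤ) :
    conj (dqSymbol ε q k) ≠ 0 :=
  (map_ne_zero _).mpr (dqSymbol_ne_zero hε q k)

theorem Dq_DqInv {ε : ℝ} (hε : 0 < ε) (q : ℝ) (f : L2C) : Dq ε q (DqInv hε q f) = f :=
  L2C.ext_repr fun k => by
    rw [Dq_repr, DqInv_coeff, mul_inv_cancel_left₀ (dqSymbol_ne_zero hε q k)]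

theorem DqInv_Dq {ε : ℝ} (hε : 0 < ε) (q : ℝ) (u : Hs 1) : DqInv hε q (Dq ε q u) = u :=
  Hs.ext_coeff fun k => by
    rw [DqInv_coeff, Dq_repr, inv_mul_cancel_left₀ (dqSymbol_ne_zero hε q k)]

theorem DqAdj_DqAdjInv {ε : ℝ} (hε : 0 < ε) (q : ℝ) (f : Hs (-1)) :
    DqAdj ε q (DqAdjInv hε q f) = f :=
  Hs.ext_coeff fun k => by
    rw [DqAdj_coeff, DqAdjInv_repr, mul_inv_cancel_left₀ (conj_dqSymbol_ne_zero hε q k)]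

theorem DqAdjInv_DqAdj {ε : ℝ} (hε : 0 < ε) (q : ℝ) (f : L2C) :
    DqAdjInv hε q (DqAdj ε q f) = f :=
  L2C.ext_repr fun k => by
    rw [DqAdjInv_repr, DqAdj_coeff, inv_mul_cancel_left₀ (conj_dqSymbol_ne_zero hε q k)]

/-- `ContinuousLinearMap.inverse` has the default value zero on maps that are not invertible, so an
explicit two-sided inverse is needed to give it its meaning. -/
theorem Dq_inverse {ε : ℝ} (hε : 0 < ε) (q : ℝ) : (Dq ε q).inverse = DqInv hε q :=
  ContinuousLinearMap.inverse_eq (ContinuousLinearMap.ext (Dq_DqInv hε q))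
    (ContinuousLinearMap.ext (DqInv_Dq hε q))

/-- `L² ⊆ H^{-1}`. -/
def l2Hm1 : L2C →L[ℂ] Hs (-1) := incl 0 (-1) (by norm_num) ∘L (l2H0 : L2C →L[ℂ] Hs 0)

/-- `H¹ ⊆ L²`. -/
def h1L2 : Hs 1 →L[ℂ] L2C := (l2H0.symm : Hs 0 →L[ℂ] L2C) ∘L incl 1 0 (by norm_num)

theorem l2Hm1_coeff (f : L2C) (k : ℤ) : (l2Hm1 f).coeff k = fourierBasis.repr f k := by
  rw [← l2H0_coeff]
  exact incl_coeff 0 (-1) (by norm_num) _ k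

theorem h1L2_repr (u : Hs 1) (k : ℤ) : fourierBasis.repr (h1L2 u) k = u.coeff k :=
  (repr_l2H0_symm _ k).trans (incl_coeff _ _ _ _ _)

theorem l2Hm1_h1L2 (u : Hs 1) : l2Hm1 (h1L2 u) = incl 1 (-1) (by norm_num) u :=
  Hs.ext_coeff fun k => by rw [l2Hm1_coeff, h1L2_repr, incl_coeff]

theorem l2Hm1_ofRealL2 (f : L2R) : l2Hm1 (ofRealL2 f) = toHm1 f := rfl

theorem l2Hm1_injective : Function.Injective l2Hm1 := fun f g h =>
  L2C.ext_repr fun k => by rw [← l2Hm1_coeff, h, l2Hm1_coeff]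

theorem toHm1_injective : Function.Injective toHm1 := fun f g h => by
  rw [← l2Hm1_ofRealL2, ← l2Hm1_ofRealL2] at h
  rw [← reL2_ofRealL2 f, l2Hm1_injective h, reL2_ofRealL2]

theorem norm_h1L2_le (u : Hs 1) : ‖h1L2 u‖ ≤ ‖u‖ := by
  have : ‖h1L2 u‖ = ‖incl 1 0 (by norm_num) u‖ := l2H0.symm.norm_map _
  rw [this]
  exact norm_incl_le _ _ _ _

theorem l2Hm1_conjL2 (f : L2C) : l2Hm1 (conjL2 f) = conjHs (-1) (l2Hm1 f) :=
  Hs.ext_coeff fun k => by rw [conjHs_coeff, l2Hm1_coeff, l2Hm1_coeff, repr_conjL2]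

/-- `D_q⁻¹` on complex `L²(𝕋)`. -/
def Lc {ε : ℝ} (hε : 0 < ε) (q : ℝ) : L2C →L[ℂ] L2C := h1L2 ∘L DqInv hε q

/-- `(D_q')⁻¹` on complex `L²(𝕋)`. -/
def LcAdj {ε : ℝ} (hε : 0 < ε) (q : ℝ) : L2C →L[ℂ] L2C := DqAdjInv hε q ∘L l2Hm1

theorem Lc_repr {ε : ℝ} (hε : 0 < ε) (q : ℝ) (f : L2C) (k : ℤ) :
    fourierBasis.repr (Lc hε q f) k = (dqSymbol ε q k)⁻¹ * fourierBasis.repr f k :=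
  (h1L2_repr _ k).trans (DqInv_coeff hε q f k)

theorem LcAdj_repr {ε : ℝ} (hε : 0 < ε) (q : ℝ) (f : L2C) (k : ℤ) :
    fourierBasis.repr (LcAdj hε q f) k = (conj (dqSymbol ε q k))⁻¹ * fourierBasis.repr f k := by
  rw [← l2Hm1_coeff f]
  exact DqAdjInv_repr hε q _ k

theorem inner_Lc_left {ε : ℝ} (hε : 0 < ε) (q : ℝ) (f g : L2C) :
    inner ℂ (Lc hε q f) g = inner ℂ f (LcAdj hε q g) := by
  rw [inner_eq_tsum_repr, inner_eq_tsum_repr]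
  refine tsum_congr fun k => ?_
  rw [Lc_repr, LcAdj_repr, map_mul, map_inv₀]
  ring

theorem adjoint_Lc {ε : ℝ} (hε : 0 < ε) (q : ℝ) :
    ContinuousLinearMap.adjoint (Lc hε q) = LcAdj hε q := by
  have h : Lc hε q = ContinuousLinearMap.adjoint (LcAdj hε q) :=
    (ContinuousLinearMap.eq_adjoint_iff _ _).mpr (inner_Lc_left hε q)
  rw [h, ContinuousLinearMap.adjoint_adjoint]

theorem Lc_conjL2 {ε : ℝ} (hε : 0 < ε) (q : ℝ) (f : L2C) :
    Lc hε q (conjL2 f) = conjL2 (Lc hε q f) :=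
  L2C.ext_repr fun k => by
    rw [Lc_repr, repr_conjL2, repr_conjL2, Lc_repr, map_mul, map_inv₀, dqSymbol_neg,
      Complex.conj_conj]

theorem LcAdj_conjL2 {ε : ℝ} (hε : 0 < ε) (q : ℝ) (f : L2C) :
    LcAdj hε q (conjL2 f) = conjL2 (LcAdj hε q f) :=
  L2C.ext_repr fun k => by
    rw [LcAdj_repr, repr_conjL2, repr_conjL2, LcAdj_repr, map_mul, map_inv₀, Complex.conj_conj,
      dqSymbol_neg]

/-- The trigonometric polynomials lie in the range. They are dense in `H^{-1}`, because they are
dense in `L²` and the Bessel isometry maps exponentials to multiples of exponentials. -/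
theorem denseRange_l2Hm1 : DenseRange l2Hm1 := by
  have h1 : DenseRange (((fourierBasis (T := 1)).repr.trans (Hs.besselIso (-1)).symm :
      L2C ≃ₗᵢ[ℂ] Hs (-1)) : L2C → Hs (-1)) := (LinearIsometryEquiv.surjective _).denseRange
  have h2 : Dense (Submodule.span ℂ (range (@fourierLp 1 _ 2 _)) : Set L2C) := by
    rw [Submodule.dense_iff_topologicalClosure_eq_top]
    exact span_fourierLp_closure_eq_top (by norm_num)
  have h3 := h1.dense_image (LinearIsometryEquiv.continuous _) h2
  refine h3.mono ?_
  rintro _ ⟨f, hf, rfl⟩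
  induction hf using Submodule.span_induction with
  | mem x hx =>
    obtain ⟨n, rfl⟩ := hx
    -- The isometry from `L²` onto `H^{-1}` divides the `n`-th coefficient by its weight, whence
    -- this scalar.
    refine ⟨((wts (-1) n : ℂ)⁻¹ • fourierLp 2 n), Hs.ext_coeff fun k => ?_⟩
    have h4 : Hs.bessel (-1) ((Hs.besselIso (-1)).symm (fourierBasis.repr (fourierLp (T := 1) 2 n))) =
        fourierBasis.repr (fourierLp 2 n) := (Hs.besselIso (-1)).apply_symm_apply _
    have h5 := Hs.bessel_apply
      ((Hs.besselIso (-1)).symm (fourierBasis.repr (fourierLp (T := 1) 2 n))) k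
    rw [h4] at h5
    have h6 : (wts (-1) k : ℂ) ≠ 0 := by exact_mod_cast (wts_pos (-1) k).ne'
    rw [l2Hm1_coeff, map_smul]
    change (wts (-1) n : ℂ)⁻¹ * _ = Hs.coeff ((Hs.besselIso (-1)).symm (fourierBasis.repr
      (fourierLp (T := 1) 2 n))) k
    refine mul_left_cancel₀ h6 ?_
    rw [← h5, ← coe_fourierBasis, HilbertBasis.repr_self, lp.single_apply]
    by_cases hk : k = n
    · subst hk
      simp [h6]
    · simp [Pi.single_eq_of_ne hk]
  | zero => exact ⟨0, by simp⟩
  | add x y _ _ hx hy =>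
    obtain ⟨a, ha⟩ := hx
    obtain ⟨b, hb⟩ := hy
    exact ⟨a + b, by rw [map_add, map_add, ha, hb]⟩
  | smul c x _ hx =>
    obtain ⟨a, ha⟩ := hx
    exact ⟨c • a, by rw [map_smul, map_smul, ha]⟩

/-! ### The keyhole contour -/

/-- `(2πi)⁻¹ ∫_γ f(z) dz`, where `γ = {z : dist(z, ℝ₋) = r}` turns counterclockwise around `0`. -/
def keyholeIntegral {E : Type*} [NormedAddCommGroup E] [NormedSpace ℂ E] (r : ℝ) (f : ℂ → E) :
    E :=
  (2 * Real.pi * Complex.I : ℂ)⁻¹ •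
    ((∫ x in Iic (0 : ℝ), f (x - r * Complex.I))
      + (∫ θ in (-(Real.pi / 2))..(Real.pi / 2),
          (Complex.I * (r * Complex.exp (θ * Complex.I))) • f (r * Complex.exp (θ * Complex.I)))
      - ∫ x in Iic (0 : ℝ), f (x + r * Complex.I))

/-- Integrability along the contour `γ = {z : dist(z, ℝ₋) = r}`. -/
structure KeyholeIntegrable {E : Type*} [NormedAddCommGroup E] [NormedSpace ℂ E] (r : ℝ)
    (f : ℂ → E) : Prop where
  lower : IntegrableOn (fun x : ℝ => f (x - r * Complex.I)) (Iic 0)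
  arc : IntervalIntegrable (fun θ : ℝ => (Complex.I * (r * Complex.exp (θ * Complex.I))) •
    f (r * Complex.exp (θ * Complex.I))) volume (-(Real.pi / 2)) (Real.pi / 2)
  upper : IntegrableOn (fun x : ℝ => f (x + r * Complex.I)) (Iic 0)

/-- The points of the contour `γ = {z : dist(z, ℝ₋) = r}`. -/
def keyhole (r : ℝ) : Set ℂ :=
  {z | (z.re ≤ 0 ∧ |z.im| = r) ∨ (0 ≤ z.re ∧ ‖z‖ = r)}

theorem lower_mem_keyhole {r : ℝ} (hr : 0 < r) {x : ℝ} (hx : x ≤ 0) :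
    (x - r * Complex.I : ℂ) ∈ keyhole r := by
  left
  simp [hx, abs_of_pos hr]

theorem upper_mem_keyhole {r : ℝ} (hr : 0 < r) {x : ℝ} (hx : x ≤ 0) :
    (x + r * Complex.I : ℂ) ∈ keyhole r := by
  left
  simp [hx, abs_of_pos hr]

theorem arc_mem_keyhole {r : ℝ} (hr : 0 < r) {θ : ℝ}
    (hθ : θ ∈ Icc (-(Real.pi / 2)) (Real.pi / 2)) :
    (r * Complex.exp (θ * Complex.I) : ℂ) ∈ keyhole r := by
  right
  constructor
  · rw [Complex.re_ofReal_mul, Complex.exp_ofReal_mul_I_re]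
    exact mul_nonneg hr.le (Real.cos_nonneg_of_mem_Icc hθ)
  · rw [norm_mul, Complex.norm_exp_ofReal_mul_I, mul_one, Complex.norm_real,
      Real.norm_of_nonneg hr.le]

theorem keyhole_subset_slitPlane {r : ℝ} (hr : 0 < r) : keyhole r ⊆ Complex.slitPlane := by
  rintro z (⟨_, h⟩ | ⟨h, h'⟩)
  · right
    intro h0
    rw [h0, abs_zero] at h
    exact hr.ne h
  · rcases h.lt_or_eq with h1 | h1
    · exact Or.inl h1
    · right
      intro h0
      have : z = 0 := Complex.ext h1.symm h0
      rw [this, norm_zero] at h'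
      exact hr.ne h'

section

variable {E F : Type*} [NormedAddCommGroup E] [NormedSpace ℂ E] [NormedAddCommGroup F]
  [NormedSpace ℂ F]

theorem keyholeIntegral_congr {r : ℝ} (hr : 0 < r) {f g : ℂ → E}
    (h : ∀ z ∈ keyhole r, f z = g z) : keyholeIntegral r f = keyholeIntegral r g := by
  unfold keyholeIntegral
  congr 1
  congr 1
  · congr 1
    · exact setIntegral_congr_fun measurableSet_Iic fun x hx => h _ (lower_mem_keyhole hr hx)
    · refine intervalIntegral.integral_congr fun θ hθ => ?_
      rw [uIcc_of_le (by linarith [Real.pi_pos])] at hθ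
      simp only [h _ (arc_mem_keyhole hr hθ)]
  · exact setIntegral_congr_fun measurableSet_Iic fun x hx => h _ (upper_mem_keyhole hr hx)

theorem KeyholeIntegrable.congr {r : ℝ} (hr : 0 < r) {f g : ℂ → E}
    (hf : KeyholeIntegrable r f) (h : ∀ z ∈ keyhole r, f z = g z) : KeyholeIntegrable r g where
  lower := hf.lower.congr_fun (fun x hx => h _ (lower_mem_keyhole hr hx)) measurableSet_Iic
  arc := by
    refine hf.arc.congr fun θ hθ => ?_
    rw [uIoc_of_le (by linarith [Real.pi_pos])] at hθ
    simp only [h _ (arc_mem_keyhole hr (Ioc_subset_Icc_self hθ))]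
  upper := hf.upper.congr_fun (fun x hx => h _ (upper_mem_keyhole hr hx)) measurableSet_Iic

theorem KeyholeIntegrable.clm_comp {r : ℝ} {f : ℂ → E} (hf : KeyholeIntegrable r f)
    (T : E →L[ℂ] F) : KeyholeIntegrable r fun z => T (f z) where
  lower := T.integrable_comp hf.lower
  arc := by
    have h := hf.arc
    rw [intervalIntegrable_iff] at h ⊢
    refine (T.integrable_comp h).congr (Filter.Eventually.of_forall fun θ => ?_)
    simp only [map_smul]
  upper := T.integrable_comp hf.upper

/-- Used with point evaluations, the functional calculus, multiplications and the conjugation by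
`S`. This is how one scalar computation reaches `Γ_v`. -/
theorem keyholeIntegral_clm_comp [CompleteSpace E] [CompleteSpace F] {r : ℝ} {f : ℂ → E}
    (hf : KeyholeIntegrable r f) (T : E →L[ℂ] F) :
    keyholeIntegral r (fun z => T (f z)) = T (keyholeIntegral r f) := by
  unfold keyholeIntegral
  simp only [map_smul, map_add, map_sub]
  rw [← T.integral_comp_comm hf.lower, ← T.integral_comp_comm hf.upper,
    ← T.intervalIntegral_comp_comm hf.arc]
  simp only [map_smul]

end

/-! ### The scalar integral -/

/-- The integrand `z^{-1/2} τ / (1 - z τ)`. -/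
def scalarIntegrand (τ : ℝ) (z : ℂ) : ℂ := z ^ (-(1 / 2) : ℂ) * (τ / (1 - z * τ))

/-- On the half-lines the real part of `1 - zτ` is already `1 + τ|Re z|`; on the arc `|zτ| ≤ 1/2`.
-/
theorem half_le_norm_one_sub {r τ : ℝ} (hτ : 0 ≤ τ) (hτr : τ * r ≤ 1 / 2)
    {z : ℂ} (hz : z ∈ keyhole r) : (1 / 2 : ℝ) + τ * (max 0 (-z.re)) ≤ ‖1 - z * τ‖ := by
  rcases hz with ⟨h, _⟩ | ⟨h, h'⟩
  · refine le_trans ?_ (Complex.re_le_norm _)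
    rw [max_eq_right (by linarith), Complex.sub_re, Complex.one_re, Complex.re_mul_ofReal]
    linarith
  · rw [max_eq_left (by linarith)]
    have h1 := norm_sub_norm_le 1 (z * τ)
    rw [norm_mul, h', norm_one, Complex.norm_real, Real.norm_of_nonneg hτ] at h1
    linarith

theorem one_sub_mul_ne_zero {r τ : ℝ} (hτ : 0 ≤ τ) (hτr : τ * r ≤ 1 / 2)
    {z : ℂ} (hz : z ∈ keyhole r) : (1 - z * τ : ℂ) ≠ 0 := by
  rw [← norm_pos_iff]
  have h1 := half_le_norm_one_sub hτ hτr hz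
  have h2 : 0 ≤ τ * max 0 (-z.re) := mul_nonneg hτ (le_max_left _ _)
  linarith

theorem norm_cpow_neg_half (z : ℂ) : ‖z ^ (-(1 / 2) : ℂ)‖ = ‖z‖ ^ (-(1 / 2) : ℝ) := by
  have h : (-(1 / 2) : ℂ) = ((-(1 / 2) : ℝ) : ℂ) := by push_cast; ring
  rw [h, Complex.norm_cpow_real]

theorem half_add_le_norm_of_mem_keyhole {r : ℝ} (hr : 0 < r) {z : ℂ} (hz : z ∈ keyhole r) :
    (r + max 0 (-z.re)) / 2 ≤ ‖z‖ := by
  rcases hz with ⟨h, h'⟩ | ⟨h, h'⟩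
  · rw [max_eq_right (by linarith)]
    have h1 := Complex.abs_re_le_norm z
    have h2 := Complex.abs_im_le_norm z
    rw [abs_of_nonpos h] at h1
    linarith
  · rw [max_eq_left (by linarith), h']
    linarith

/-- The factor `τ / |1 - zτ|` is at most `1 / (r + |Re z|)` on the half-lines and `1 / r` on the
arc, and `|z|^{-1/2}` supplies the remaining half power. The bound does not depend on `τ`, so it
also bounds the supremum over a spectrum. -/
theorem norm_scalarIntegrand_le {r τ : ℝ} (hr : 0 < r) (hτ : 0 ≤ τ) (hτr : τ * r ≤ 1 / 2)
    {z : ℂ} (hz : z ∈ keyhole r) :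
    ‖scalarIntegrand τ z‖ ≤ (1 / 2 : ℝ) ^ (-(1 / 2) : ℝ) * (r + max 0 (-z.re)) ^ (-(3 / 2) : ℝ) := by
  have hm : 0 ≤ max 0 (-z.re) := le_max_left _ _
  have hs : 0 < r + max 0 (-z.re) := by linarith
  have h1 : ‖z‖ ^ (-(1 / 2) : ℝ) ≤ ((1 / 2) * (r + max 0 (-z.re))) ^ (-(1 / 2) : ℝ) := by
    refine Real.rpow_le_rpow_of_nonpos (by positivity) ?_ (by norm_num)
    linarith [half_add_le_norm_of_mem_keyhole hr hz]
  have h2 : τ / ‖1 - z * τ‖ ≤ (r + max 0 (-z.re)) ^ (-1 : ℝ) := by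
    have h3 := half_le_norm_one_sub hτ hτr hz
    have h4 : 0 ≤ τ * max 0 (-z.re) := mul_nonneg hτ hm
    rw [Real.rpow_neg_one, div_le_iff₀ (by linarith), inv_mul_eq_div, le_div_iff₀ hs]
    -- This is `τ (r + m) ≤ 1/2 + τ m` with `m = max 0 (-Re z)`, from `τ r ≤ 1/2`.
    nlinarith
  rw [scalarIntegrand, norm_mul, norm_div, norm_cpow_neg_half, Complex.norm_real,
    Real.norm_of_nonneg hτ]
  calc ‖z‖ ^ (-(1 / 2) : ℝ) * (τ / ‖1 - z * τ‖)
      ≤ ((1 / 2) * (r + max 0 (-z.re))) ^ (-(1 / 2) : ℝ) * (r + max 0 (-z.re)) ^ (-1 : ℝ) := by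
        gcongr
    _ = _ := by
        rw [Real.mul_rpow (by norm_num) hs.le, mul_assoc, ← Real.rpow_add hs]
        norm_num

theorem integrableOn_Iic_sub_rpow {r : ℝ} (hr : 0 < r) (C : ℝ) :
    IntegrableOn (fun x : ℝ => C * (r + max 0 (-x)) ^ (-(3 / 2) : ℝ)) (Iic 0) := by
  have h0 : IntegrableOn (fun x : ℝ => (x + r) ^ (-(3 / 2) : ℝ)) (Ioi (-0)) := by
    rw [neg_zero]
    exact integrableOn_add_rpow_Ioi_of_lt (by norm_num) (by linarith)
  have h : IntegrableOn (fun x : ℝ => (-x + r) ^ (-(3 / 2) : ℝ)) (Iio 0) := h0.comp_neg_Iio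
  rw [← integrableOn_Iic_iff_integrableOn_Iio] at h
  have h' : IntegrableOn (fun x : ℝ => C * (-x + r) ^ (-(3 / 2) : ℝ)) (Iic 0) := h.const_mul C
  refine h'.congr_fun (fun x hx => ?_) measurableSet_Iic
  have hx' : x ≤ 0 := hx
  simp only [max_eq_right (neg_nonneg.mpr hx')]
  rw [add_comm]

theorem continuousAt_scalarIntegrand_uncurry {r : ℝ} (hr : 0 < r) :
    ContinuousOn (fun p : ℂ × ℝ => scalarIntegrand p.2 p.1)
      (keyhole r ×ˢ {τ | 0 ≤ τ ∧ τ * r ≤ 1 / 2}) := by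
  intro p hp
  apply ContinuousAt.continuousWithinAt
  have h1 : (1 - p.1 * p.2 : ℂ) ≠ 0 := one_sub_mul_ne_zero hp.2.1 hp.2.2 hp.1
  unfold scalarIntegrand
  refine ContinuousAt.mul ?_ ?_
  · exact (continuousAt_id.cpow continuousAt_const
      (keyhole_subset_slitPlane hr hp.1)).comp (f := Prod.fst) continuousAt_fst
  · refine ContinuousAt.div (by fun_prop) (by fun_prop) h1

theorem continuousOn_scalarIntegrand {r τ : ℝ} (hr : 0 < r) (hτ : 0 ≤ τ) (hτr : τ * r ≤ 1 / 2) :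
    ContinuousOn (scalarIntegrand τ) (keyhole r) := by
  have h : ContinuousOn (fun z : ℂ => (z, τ)) (keyhole r) := by fun_prop
  exact (continuousAt_scalarIntegrand_uncurry hr).comp h fun z hz => ⟨hz, hτ, hτr⟩

/-- The exponent `3/2` exceeds `1`, which suffices on the half-lines; on the compact arc continuity
is enough. -/
theorem keyholeIntegrable_of_bound {E : Type*} [NormedAddCommGroup E] [NormedSpace ℂ E]
    {f : ℂ → E} {r C : ℝ} (hr : 0 < r)
    (hf : ContinuousOn f (keyhole r))
    (hC : ∀ z ∈ keyhole r, ‖f z‖ ≤ C * (r + max 0 (-z.re)) ^ (-(3 / 2) : ℝ)) :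
    KeyholeIntegrable r f where
  lower := by
    have hc : ContinuousOn (fun x : ℝ => f (x - r * Complex.I)) (Iic 0) :=
      hf.comp (by fun_prop) fun x hx => lower_mem_keyhole hr hx
    refine Integrable.mono' (integrableOn_Iic_sub_rpow hr C)
      (hc.aestronglyMeasurable measurableSet_Iic) ?_
    refine ae_restrict_of_forall_mem measurableSet_Iic fun x hx => ?_
    simpa using hC _ (lower_mem_keyhole hr hx)
  arc := by
    apply ContinuousOn.intervalIntegrable
    rw [uIcc_of_le (by linarith [Real.pi_pos])]
    have hc' : Continuous fun θ : ℝ => Complex.I * (r * Complex.exp (θ * Complex.I) : ℂ) := by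
      fun_prop
    refine hc'.continuousOn.smul ?_
    have hc : Continuous fun θ : ℝ => (r * Complex.exp (θ * Complex.I) : ℂ) := by fun_prop
    exact hf.comp hc.continuousOn fun θ hθ => arc_mem_keyhole hr hθ
  upper := by
    have hc : ContinuousOn (fun x : ℝ => f (x + r * Complex.I)) (Iic 0) :=
      hf.comp (by fun_prop) fun x hx => upper_mem_keyhole hr hx
    refine Integrable.mono' (integrableOn_Iic_sub_rpow hr C)
      (hc.aestronglyMeasurable measurableSet_Iic) ?_
    refine ae_restrict_of_forall_mem measurableSet_Iic fun x hx => ?_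
    simpa using hC _ (upper_mem_keyhole hr hx)

theorem keyholeIntegrable_scalarIntegrand {r τ : ℝ} (hr : 0 < r) (hτ : 0 ≤ τ)
    (hτr : τ * r ≤ 1 / 2) : KeyholeIntegrable r (scalarIntegrand τ) :=
  keyholeIntegrable_of_bound hr (continuousOn_scalarIntegrand hr hτ hτr)
    fun _ hz => norm_scalarIntegrand_le hr hτ hτr hz

/-! ### Branches of the logarithm and antiderivatives along the contour. -/

theorem log_one_add_mul {w : ℂ} {c : ℝ} (hw : 0 < w.re) (hc : 0 < c) :
    Complex.log (1 + c * w) = Complex.log w + Complex.log (c + w⁻¹) := by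
  have hw0 : w ≠ 0 := fun h => by simp [h] at hw
  have h1 : 0 < (c + w⁻¹ : ℂ).re := by
    rw [Complex.add_re, Complex.ofReal_re, Complex.inv_re]
    have : 0 < Complex.normSq w := Complex.normSq_pos.mpr hw0
    positivity
  have h2 : (1 + c * w : ℂ) = w * (c + w⁻¹) := by field_simp; ring
  rw [h2, Complex.log_mul_eq_add_log_iff hw0 (fun h => by simp [h] at h1)]
  -- Both factors lie in the open right half-plane, so their arguments add up inside `(-π, π)` and
  -- no multiple of `2πi` appears.
  have h3 := abs_lt.mp (Complex.abs_arg_lt_pi_div_two_iff.mpr (Or.inl hw))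
  have h4 := abs_lt.mp (Complex.abs_arg_lt_pi_div_two_iff.mpr (Or.inl h1))
  constructor <;> linarith [h3.1, h3.2, h4.1, h4.2]

/-- Since `1 - cw = (-w)(c - w⁻¹)` and `log (-w) = log w - πi` above the real axis, the two
antiderivatives differ by a constant. This jump at the junctions of arc and half-lines is the source
of the whole value of the integral. -/
theorem log_jump_of_im_pos {w : ℂ} {c : ℝ} (hw : 0 < w.re) (hw' : 0 < w.im) (hc : 0 < c) :
    (Complex.log (1 + c * w) - Complex.log (1 - c * w)) -
      (Complex.log (c + w⁻¹) - Complex.log (c - w⁻¹)) = Real.pi * Complex.I := by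
  have hw0 : w ≠ 0 := fun h => by simp [h] at hw
  have h1 : 0 < (c - w⁻¹ : ℂ).im := by
    rw [Complex.sub_im, Complex.ofReal_im, Complex.inv_im]
    have : 0 < Complex.normSq w := Complex.normSq_pos.mpr hw0
    have : 0 < w.im / Complex.normSq w := by positivity
    rw [neg_div]
    linarith
  have h2 : (1 - c * w : ℂ) = (-w) * (c - w⁻¹) := by field_simp; ring
  have h3 := abs_lt.mp (Complex.abs_arg_lt_pi_div_two_iff.mpr (Or.inl hw))
  have h4 : 0 ≤ (c - w⁻¹ : ℂ).arg := Complex.arg_nonneg_iff.mpr h1.le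
  have h5 := Complex.arg_le_pi (c - w⁻¹ : ℂ)
  have h6 : 0 < w.arg := by
    refine lt_of_le_of_ne (Complex.arg_nonneg_iff.mpr hw'.le) fun h => ?_
    exact hw'.ne (Complex.arg_eq_zero_iff.mp h.symm).2.symm
  have h7 := Complex.arg_neg_eq_arg_sub_pi_of_im_pos hw'
  have h8 : Complex.log (1 - c * w) = Complex.log (-w) + Complex.log (c - w⁻¹) := by
    rw [h2, Complex.log_mul_eq_add_log_iff (neg_ne_zero.mpr hw0) (fun h => by simp [h] at h1), h7]
    constructor <;> linarith [h3.1, h3.2]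
  have h9 : Complex.log (-w) = Complex.log w - Real.pi * Complex.I := by
    rw [Complex.log, Complex.log, h7, norm_neg]
    push_cast
    ring
  rw [log_one_add_mul hw hc, h8, h9]
  ring

theorem log_jump_of_im_neg {w : ℂ} {c : ℝ} (hw : 0 < w.re) (hw' : w.im < 0) (hc : 0 < c) :
    (Complex.log (1 + c * w) - Complex.log (1 - c * w)) -
      (Complex.log (c + w⁻¹) - Complex.log (c - w⁻¹)) = -(Real.pi * Complex.I) := by
  have hw0 : w ≠ 0 := fun h => by simp [h] at hw
  have h1 : (c - w⁻¹ : ℂ).im < 0 := by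
    rw [Complex.sub_im, Complex.ofReal_im, Complex.inv_im]
    have : 0 < Complex.normSq w := Complex.normSq_pos.mpr hw0
    have : 0 < -w.im / Complex.normSq w := div_pos (by linarith) this
    linarith
  have h2 : (1 - c * w : ℂ) = (-w) * (c - w⁻¹) := by field_simp; ring
  have h3 := abs_lt.mp (Complex.abs_arg_lt_pi_div_two_iff.mpr (Or.inl hw))
  have h4 : (c - w⁻¹ : ℂ).arg < 0 := Complex.arg_neg_iff.mpr h1
  have h5 := Complex.neg_pi_lt_arg (c - w⁻¹ : ℂ)
  have h6 : w.arg < 0 := Complex.arg_neg_iff.mpr hw'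
  have h7 := Complex.arg_neg_eq_arg_add_pi_of_im_neg hw'
  have h8 : Complex.log (1 - c * w) = Complex.log (-w) + Complex.log (c - w⁻¹) := by
    rw [h2, Complex.log_mul_eq_add_log_iff (neg_ne_zero.mpr hw0) (fun h => by simp [h] at h1), h7]
    constructor <;> linarith [h3.1, h3.2]
  have h9 : Complex.log (-w) = Complex.log w + Real.pi * Complex.I := by
    rw [Complex.log, Complex.log, h7, norm_neg]
    push_cast
    ring
  rw [log_one_add_mul hw hc, h8, h9]
  ring

/-- An antiderivative of `scalarIntegrand (c ^ 2)` near the arc. -/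
def arcPrimitive (c : ℝ) (z : ℂ) : ℂ :=
  c * (Complex.log (1 + c * z ^ (1 / 2 : ℂ)) - Complex.log (1 - c * z ^ (1 / 2 : ℂ)))

/-- An antiderivative of `scalarIntegrand (c ^ 2)` off the real line. -/
def rayPrimitive (c : ℝ) (z : ℂ) : ℂ :=
  c * (Complex.log (c + (z ^ (1 / 2 : ℂ))⁻¹) - Complex.log (c - (z ^ (1 / 2 : ℂ))⁻¹))

theorem sq_cpow_half (z : ℂ) : (z ^ (1 / 2 : ℂ)) ^ 2 = z := by
  rw [one_div]
  exact Complex.cpow_nat_inv_pow z (n := 2) two_ne_zero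

theorem inv_cpow_half {z : ℂ} : (z ^ (1 / 2 : ℂ))⁻¹ = z ^ (-(1 / 2) : ℂ) :=
  (Complex.cpow_neg _ _).symm

theorem hasDerivAt_cpow_half {z : ℂ} (hz : z ∈ Complex.slitPlane) :
    HasDerivAt (fun z : ℂ => z ^ (1 / 2 : ℂ)) ((1 / 2) * (z ^ (1 / 2 : ℂ))⁻¹) z := by
  have h : HasDerivAt (fun z : ℂ => z ^ (1 / 2 : ℂ)) ((1 / 2) * z ^ ((1 / 2 : ℂ) - 1) * 1) z :=
    (hasDerivAt_id z).cpow_const (c := (1 / 2 : ℂ)) hz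
  refine h.congr_deriv ?_
  rw [inv_cpow_half, mul_one]
  norm_num

/-- The principal root halves the argument, which off the cut lies strictly between `-π` and `π`. -/
theorem re_cpow_half_pos {z : ℂ} (hz : z ∈ Complex.slitPlane) : 0 < (z ^ (1 / 2 : ℂ)).re := by
  rw [Complex.cpow_def_of_ne_zero (Complex.slitPlane_ne_zero hz), Complex.exp_re]
  refine mul_pos (Real.exp_pos _) (Real.cos_pos_of_mem_Ioo ?_)
  have h1 : (Complex.log z * (1 / 2)).im = z.arg / 2 := by
    rw [Complex.mul_im, Complex.log_im]
    norm_num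
    ring
  have h2 := Complex.neg_pi_lt_arg z
  have h3 := lt_of_le_of_ne (Complex.arg_le_pi z) (Complex.mem_slitPlane_iff_arg.mp hz).1
  rw [h1]
  constructor <;> linarith

theorem im_eq_two_mul_cpow_half (z : ℂ) :
    z.im = 2 * (z ^ (1 / 2 : ℂ)).re * (z ^ (1 / 2 : ℂ)).im := by
  conv_lhs => rw [← sq_cpow_half z, pow_two, Complex.mul_im]
  ring

/-- With `w = √z` the integrand is `c² / (w (1 - c²w²))`, decomposed into partial fractions in `w`.
The bound on `cw` keeps `1 ± cw` in the right half-plane. -/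
theorem hasDerivAt_arcPrimitive {c : ℝ} {z : ℂ} (hz : z ∈ Complex.slitPlane)
    (h : ‖(c : ℂ) * z ^ (1 / 2 : ℂ)‖ < 1) :
    HasDerivAt (arcPrimitive c) (scalarIntegrand (c ^ 2) z) z := by
  set w := z ^ (1 / 2 : ℂ) with hw
  have hz0 : z ≠ 0 := Complex.slitPlane_ne_zero hz
  have hw0 : w ≠ 0 := fun h0 => hz0 (by rw [← sq_cpow_half z, ← hw, h0]; simp)
  have hd : HasDerivAt (fun z : ℂ => z ^ (1 / 2 : ℂ)) ((1 / 2) * w⁻¹) z := by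
    exact hasDerivAt_cpow_half hz
  have hre := abs_lt.mp (lt_of_le_of_lt (Complex.abs_re_le_norm _) h)
  have h1 : (1 + c * w : ℂ) ∈ Complex.slitPlane := by
    left
    rw [Complex.add_re, Complex.one_re]
    linarith [hre.1]
  have h2 : (1 - c * w : ℂ) ∈ Complex.slitPlane := by
    left
    rw [Complex.sub_re, Complex.one_re]
    linarith [hre.2]
  have h3 := (((hd.const_mul (c : ℂ)).const_add 1).clog h1).sub
    (((hd.const_mul (c : ℂ)).const_sub 1).clog h2)
  have h4 := h3.const_mul (c : ℂ)
  refine h4.congr_deriv ?_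
  have h1' := Complex.slitPlane_ne_zero h1
  have h2' := Complex.slitPlane_ne_zero h2
  have h5 : (1 - z * ((c ^ 2 : ℝ) : ℂ)) = (1 + c * w) * (1 - c * w) := by
    rw [← sq_cpow_half z, ← hw]
    push_cast
    ring
  rw [scalarIntegrand, h5, ← inv_cpow_half, ← hw]
  push_cast
  field_simp
  ring

theorem im_cpow_half_ne_zero {z : ℂ} (hz : z.im ≠ 0) : (z ^ (1 / 2 : ℂ)).im ≠ 0 := by
  intro h
  apply hz
  have h1 := congrArg Complex.im (sq_cpow_half z)
  rw [pow_two, Complex.mul_im, h] at h1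
  rw [← h1]
  ring

/-- Off the real line `w⁻¹` is not real, so `c ± w⁻¹` avoid the cut however large `z` is. Unlike
`arcPrimitive` this antiderivative can therefore be followed out to infinity. -/
theorem hasDerivAt_rayPrimitive {c : ℝ} {z : ℂ} (hz : z.im ≠ 0) :
    HasDerivAt (rayPrimitive c) (scalarIntegrand (c ^ 2) z) z := by
  set w := z ^ (1 / 2 : ℂ) with hw
  have hz' : z ∈ Complex.slitPlane := Or.inr hz
  have hz0 : z ≠ 0 := Complex.slitPlane_ne_zero hz'
  have hw0 : w ≠ 0 := fun h0 => hz0 (by rw [← sq_cpow_half z, ← hw, h0]; simp)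
  have hd : HasDerivAt (fun z : ℂ => z ^ (1 / 2 : ℂ)) ((1 / 2) * w⁻¹) z := by
    exact hasDerivAt_cpow_half hz'
  have him : w⁻¹.im ≠ 0 := by
    rw [Complex.inv_im]
    exact div_ne_zero (neg_ne_zero.mpr (im_cpow_half_ne_zero hz)) (Complex.normSq_pos.mpr hw0).ne'
  have h1 : (c + w⁻¹ : ℂ) ∈ Complex.slitPlane := by
    right
    rwa [Complex.add_im, Complex.ofReal_im, zero_add]
  have h2 : (c - w⁻¹ : ℂ) ∈ Complex.slitPlane := by
    right
    rw [Complex.sub_im, Complex.ofReal_im, zero_sub]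
    exact neg_ne_zero.mpr him
  have hi : HasDerivAt (fun z : ℂ => (z ^ (1 / 2 : ℂ))⁻¹) (-((1 / 2) * w⁻¹) / w ^ 2) z :=
    hd.inv hw0
  have h3 : HasDerivAt (fun z : ℂ => Complex.log (c + (z ^ (1 / 2 : ℂ))⁻¹) -
      Complex.log (c - (z ^ (1 / 2 : ℂ))⁻¹)) ((-((1 / 2) * w⁻¹) / w ^ 2) / (c + w⁻¹) -
        (-(-((1 / 2) * w⁻¹) / w ^ 2)) / (c - w⁻¹)) z :=
    ((hi.const_add (c : ℂ)).clog h1).sub ((hi.const_sub (c : ℂ)).clog h2)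
  have h4 := h3.const_mul (c : ℂ)
  refine h4.congr_deriv ?_
  have h1' := Complex.slitPlane_ne_zero h1
  have h2' := Complex.slitPlane_ne_zero h2
  have h5 : (1 - z * ((c ^ 2 : ℝ) : ℂ)) = -((c + w⁻¹) * (c - w⁻¹)) * w ^ 2 := by
    rw [← sq_cpow_half z, ← hw]
    push_cast
    field_simp
    ring
  rw [scalarIntegrand, h5, ← inv_cpow_half, ← hw]
  push_cast
  generalize hx : w⁻¹ = x at *
  have hx0 : x ≠ 0 := by rw [← hx]; exact inv_ne_zero hw0
  have hwx : w = x⁻¹ := by rw [← hx, inv_inv]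
  rw [hwx]
  field_simp
  ring

/-- Both logarithms tend to `log c`, because `z^{-1/2}` tends to zero. -/
theorem tendsto_rayPrimitive {c : ℝ} (hc : 0 < c) {ι : Type*} {l : Filter ι} {z : ι → ℂ}
    (hz : Filter.Tendsto (fun i => ‖z i‖) l Filter.atTop) :
    Filter.Tendsto (fun i => rayPrimitive c (z i)) l (nhds 0) := by
  have h1 : Filter.Tendsto (fun i => ((z i) ^ (1 / 2 : ℂ))⁻¹) l (nhds 0) := by
    rw [tendsto_zero_iff_norm_tendsto_zero]
    simp only [inv_cpow_half, norm_cpow_neg_half]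
    exact (tendsto_rpow_neg_atTop (by norm_num : (0 : ℝ) < 1 / 2)).comp hz
  have hc' : (c : ℂ) ∈ Complex.slitPlane := Or.inl hc
  have h2 : Filter.Tendsto (fun i => Complex.log (c + ((z i) ^ (1 / 2 : ℂ))⁻¹)) l
      (nhds (Complex.log c)) := by
    refine Filter.Tendsto.clog ?_ hc'
    simpa using h1.const_add (c : ℂ)
  have h3 : Filter.Tendsto (fun i => Complex.log (c - ((z i) ^ (1 / 2 : ℂ))⁻¹)) l
      (nhds (Complex.log c)) := by
    refine Filter.Tendsto.clog ?_ hc'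
    simpa using h1.const_sub (c : ℂ)
  simpa [rayPrimitive] using (h2.sub h3).const_mul (c : ℂ)

theorem integral_ray_scalarIntegrand {r c b : ℝ} (hr : 0 < r) (hc : 0 < c) (hb : |b| = r)
    (hcr : c ^ 2 * r ≤ 1 / 2) :
    ∫ x in Iic (0 : ℝ), scalarIntegrand (c ^ 2) (x + b * Complex.I) =
      rayPrimitive c (b * Complex.I) := by
  have hb0 : b ≠ 0 := fun h => by rw [h, abs_zero] at hb; exact hr.ne hb
  have him : ∀ x : ℝ, (x + b * Complex.I : ℂ).im ≠ 0 := fun x => by simpa using hb0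
  have hder : ∀ x : ℝ, HasDerivAt (fun x : ℝ => rayPrimitive c (x + b * Complex.I))
      (scalarIntegrand (c ^ 2) (x + b * Complex.I)) x := fun x => by
    have h1 : HasDerivAt (fun x : ℝ => (x + b * Complex.I : ℂ)) 1 x :=
      (Complex.ofRealCLM.hasDerivAt (x := x)).add_const _
    have h2 := (hasDerivAt_rayPrimitive (c := c) (him x)).comp x h1
    rw [mul_one] at h2
    exact h2
  have hint : IntegrableOn (fun x : ℝ => scalarIntegrand (c ^ 2) (x + b * Complex.I)) (Iic 0) := by
    have h := keyholeIntegrable_scalarIntegrand hr (sq_nonneg c) hcr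
    rcases abs_choice b with h0 | h0
    · rw [hb] at h0
      rw [← h0]
      exact h.upper
    · rw [hb] at h0
      have h1 : b = -r := by linarith
      have h2 := h.lower
      rw [h1]
      refine h2.congr_fun (fun x _ => ?_) measurableSet_Iic
      push_cast
      ring_nf
  rw [integral_Iic_of_hasDerivAt_of_tendsto (m := 0) (hder 0).continuousAt.continuousWithinAt
    (fun x _ => hder x) hint]
  · simp
  · refine tendsto_rayPrimitive hc ?_
    refine Filter.tendsto_atTop_mono (fun x => ?_) Filter.tendsto_neg_atBot_atTop
    have := Complex.abs_re_le_norm (x + b * Complex.I : ℂ)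
    have h1 : (x + b * Complex.I : ℂ).re = x := by simp
    rw [h1] at this
    exact (neg_le_abs x).trans this

theorem integral_arc_scalarIntegrand {r c : ℝ} (hr : 0 < r) (hcr : c ^ 2 * r ≤ 1 / 2) :
    ∫ θ in (-(Real.pi / 2))..(Real.pi / 2), (Complex.I * (r * Complex.exp (θ * Complex.I))) •
        scalarIntegrand (c ^ 2) (r * Complex.exp (θ * Complex.I)) =
      arcPrimitive c (r * Complex.I) - arcPrimitive c (-(r * Complex.I)) := by
  have hle : -(Real.pi / 2) ≤ Real.pi / 2 := by linarith [Real.pi_pos]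
  have h := (keyholeIntegrable_scalarIntegrand hr (sq_nonneg c) hcr).arc
  rw [intervalIntegral.integral_eq_sub_of_hasDerivAt
    (f := fun θ : ℝ => arcPrimitive c (r * Complex.exp (θ * Complex.I))) ?_ h]
  · congr 2
    · push_cast
      rw [Complex.exp_pi_div_two_mul_I]
    · push_cast
      rw [neg_mul, Complex.exp_neg, Complex.exp_pi_div_two_mul_I]
      simp
  · intro θ hθ
    rw [uIcc_of_le hle] at hθ
    have hz := arc_mem_keyhole hr hθ
    have hn : ‖(r * Complex.exp (θ * Complex.I) : ℂ)‖ = r := by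
      rw [norm_mul, Complex.norm_exp_ofReal_mul_I, mul_one, Complex.norm_real,
        Real.norm_of_nonneg hr.le]
    have h1 : HasDerivAt (fun θ : ℝ => (r * Complex.exp (θ * Complex.I) : ℂ))
        (Complex.I * (r * Complex.exp (θ * Complex.I))) θ := by
      have h2 : HasDerivAt (fun θ : ℝ => (θ * Complex.I : ℂ)) (1 * Complex.I) θ :=
        (Complex.ofRealCLM.hasDerivAt (x := θ)).mul_const _
      refine (h2.cexp.const_mul (r : ℂ)).congr_deriv ?_
      ring
    have h3 : ‖(c : ℂ) * (r * Complex.exp (θ * Complex.I) : ℂ) ^ (1 / 2 : ℂ)‖ < 1 := by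
      -- The square of this norm is `c² r`, at most `1/2`.
      have h4 : ‖(c : ℂ) * (r * Complex.exp (θ * Complex.I) : ℂ) ^ (1 / 2 : ℂ)‖ ^ 2 < 1 := by
        rw [← norm_pow, mul_pow, sq_cpow_half, norm_mul, hn, norm_pow, Complex.norm_real,
          Real.norm_eq_abs, sq_abs]
        linarith
      exact (pow_lt_one_iff_of_nonneg (norm_nonneg _) two_ne_zero).mp h4
    have h5 := (hasDerivAt_arcPrimitive (keyhole_subset_slitPlane hr hz) h3).comp θ h1
    refine h5.congr_deriv ?_
    rw [smul_eq_mul, mul_comm]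

theorem keyholeIntegral_scalarIntegrand {r τ : ℝ} (hr : 0 < r) (hτ : 0 ≤ τ)
    (hτr : τ * r ≤ 1 / 2) : keyholeIntegral r (scalarIntegrand τ) = (Real.sqrt τ : ℂ) := by
  -- The logarithms require `c = √τ > 0`; for `τ = 0` the integrand vanishes.
  rcases hτ.eq_or_lt with rfl | hτ0
  · have : scalarIntegrand 0 = fun _ => 0 := by
      funext z
      simp [scalarIntegrand]
    simp [keyholeIntegral, this]
  obtain ⟨c, hc, rfl⟩ : ∃ c : ℝ, 0 < c ∧ τ = c ^ 2 :=
    ⟨Real.sqrt τ, Real.sqrt_pos.mpr hτ0, (Real.sq_sqrt hτ).symm⟩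
  have h1 := integral_ray_scalarIntegrand (b := r) hr hc (abs_of_pos hr) hτr
  have h2 := integral_ray_scalarIntegrand (b := -r) hr hc (by rw [abs_neg, abs_of_pos hr]) hτr
  have h2' : ∫ x in Iic (0 : ℝ), scalarIntegrand (c ^ 2) (x - r * Complex.I) =
      rayPrimitive c (-(r * Complex.I)) := by
    rw [← neg_mul, ← Complex.ofReal_neg, ← h2]
    refine setIntegral_congr_fun measurableSet_Iic fun x _ => ?_
    simp only [Complex.ofReal_neg, neg_mul, sub_eq_add_neg]
  have j1 : arcPrimitive c (r * Complex.I) - rayPrimitive c (r * Complex.I) =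
      c * (Real.pi * Complex.I) := by
    have hz : (r * Complex.I : ℂ).im = r := by simp
    have hre := re_cpow_half_pos (Or.inr (by rw [hz]; exact hr.ne') : (r * Complex.I : ℂ) ∈ _)
    have him : 0 < ((r * Complex.I : ℂ) ^ (1 / 2 : ℂ)).im := by
      have h := im_eq_two_mul_cpow_half (r * Complex.I : ℂ)
      rw [hz] at h
      exact pos_of_mul_pos_right (h ▸ hr) (by positivity)
    rw [arcPrimitive, rayPrimitive, ← mul_sub, log_jump_of_im_pos hre him hc]
  have j2 : arcPrimitive c (-(r * Complex.I)) - rayPrimitive c (-(r * Complex.I)) =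
      -(c * (Real.pi * Complex.I)) := by
    have hz : (-(r * Complex.I) : ℂ).im = -r := by simp
    have hre := re_cpow_half_pos
      (Or.inr (by rw [hz]; exact (neg_lt_zero.mpr hr).ne) : (-(r * Complex.I) : ℂ) ∈ _)
    have him : ((-(r * Complex.I) : ℂ) ^ (1 / 2 : ℂ)).im < 0 := by
      have h := im_eq_two_mul_cpow_half (-(r * Complex.I) : ℂ)
      rw [hz] at h
      exact neg_of_mul_neg_right (h ▸ neg_lt_zero.mpr hr) (by positivity)
    rw [arcPrimitive, rayPrimitive, ← mul_sub, log_jump_of_im_neg hre him hc, mul_neg]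
  rw [keyholeIntegral, h1, h2', integral_arc_scalarIntegrand hr hτr, Real.sqrt_sq hc.le, smul_eq_mul,
    inv_mul_eq_iff_eq_mul₀ Complex.two_pi_I_ne_zero]
  -- The boundary terms pair up at `ir` and `-ir`, and the two jumps `±cπi` enter with opposite
  -- signs, giving `2πi c`.
  linear_combination j1 - j2

/-! ### The square root of a positive element as a keyhole integral -/

/-- The integrand `z^{-1/2} a (1 - z a)⁻¹`. -/
def opIntegrand {A : Type*} [Ring A] [Algebra ℂ A] (a : A) (z : ℂ) : A :=
  z ^ (-(1 / 2) : ℂ) • (a * Ring.inverse (1 - z • a))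

/-- The unit hypothesis matters: `Ring.inverse` is zero on non-units, and a homomorphism may send a
non-unit to a unit. -/
theorem map_opIntegrand {A B : Type*} [Ring A] [Algebra ℂ A] [Ring B] [Algebra ℂ B]
    (T : A →ₐ[ℂ] B) {a : A} {z : ℂ} (h : IsUnit (1 - z • a)) :
    T (opIntegrand a z) = opIntegrand (T a) z := by
  obtain ⟨u, hu⟩ := h
  have h1 : 1 - z • T a = (Units.map (T : A →* B) u : Bˣ) := by
    rw [Units.coe_map, hu]
    simp
  rw [opIntegrand, opIntegrand, h1, Ring.inverse_unit, ← hu, Ring.inverse_unit, map_smul, map_mul,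
    ← map_inv, Units.coe_map]
  rfl

theorem continuousOn_opIntegrand {A : Type*} [NormedRing A] [NormedAlgebra ℂ A]
    [CompleteSpace A] {a : A} {r : ℝ} (hr : 0 < r)
    (h : ∀ z ∈ keyhole r, IsUnit (1 - z • a)) : ContinuousOn (opIntegrand a) (keyhole r) := by
  intro z hz
  apply ContinuousAt.continuousWithinAt
  obtain ⟨u, hu⟩ := h z hz
  have h1 : ContinuousAt (fun z : ℂ => Ring.inverse (1 - z • a)) z := by
    have h2 := NormedRing.inverse_continuousAt u
    rw [hu] at h2
    exact ContinuousAt.comp (f := fun z : ℂ => 1 - z • a) h2 (by fun_prop)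
  exact ContinuousAt.smul (continuousAt_id.cpow continuousAt_const
    (keyhole_subset_slitPlane hr hz)) (continuousAt_const.mul h1)

theorem opIntegrand_mul_of_semiconj {A : Type*} [Ring A] [Algebra ℂ A]
    {a b k : A} {z : ℂ} (h : a * k = k * b)
    (ha : IsUnit (1 - z • a)) (hb : IsUnit (1 - z • b)) :
    opIntegrand a z * k = k * opIntegrand b z := by
  have c2 : (1 - z • a) * k = k * (1 - z • b) := by
    rw [sub_mul, mul_sub, one_mul, mul_one, smul_mul_assoc, mul_smul_comm, h]
  have c3 : Ring.inverse (1 - z • a) * k = k * Ring.inverse (1 - z • b) := by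
    calc _ = Ring.inverse (1 - z • a) * (k * ((1 - z • b) * Ring.inverse (1 - z • b))) := by
          rw [Ring.mul_inverse_cancel _ hb, mul_one]
      _ = (Ring.inverse (1 - z • a) * ((1 - z • a) * k)) * Ring.inverse (1 - z • b) := by
          rw [c2]
          simp only [mul_assoc]
      _ = _ := by
          rw [← mul_assoc (Ring.inverse _), Ring.inverse_mul_cancel _ ha, one_mul]
  rw [opIntegrand, opIntegrand, smul_mul_assoc, mul_smul_comm, mul_assoc, c3, ← mul_assoc, h,
    mul_assoc]

section

variable {A : Type*} [CStarAlgebra A] [PartialOrder A] [StarOrderedRing A]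

open scoped ComplexOrder in
theorem spectrum_of_nonneg {a : A} (ha : 0 ≤ a) {w : ℂ} (hw : w ∈ spectrum ℂ a) :
    0 ≤ w.re ∧ w.re ≤ ‖a‖ ∧ (w.re : ℂ) = w := by
  have h1 : 0 ≤ w := StarOrderedRing.nonneg_iff_spectrum_nonneg (R := ℂ) a |>.mp ha w hw
  have h2 := Complex.nonneg_iff.mp h1
  refine ⟨h2.1, ?_, Complex.ext (by simp) (by simp [← h2.2])⟩
  -- In the zero algebra the spectrum is empty, so that case contradicts `hw`; otherwise spectral
  -- values are bounded by the norm.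
  have : Nontrivial A := by
    by_contra h
    rw [not_nontrivial_iff_subsingleton] at h
    have := spectrum.of_subsingleton (R := ℂ) a
    rw [this] at hw
    exact hw
  exact (Complex.re_le_norm w).trans (spectrum.norm_le_norm_of_mem hw)

/-- The positive square root of a positive element. -/
def posSqrt (a : A) : A := CFC.sqrt a

theorem posSqrt_mul_self {a : A} (ha : 0 ≤ a) : posSqrt a * posSqrt a = a :=
  CFC.sqrt_mul_sqrt_self a ha

theorem posSqrt_nonneg (a : A) : 0 ≤ posSqrt a := CFC.sqrt_nonneg a

theorem posSqrt_unique {a b : A} (h : b * b = a) (hb : 0 ≤ b) : posSqrt a = b :=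
  CFC.sqrt_unique h hb

theorem continuousOn_posSqrt : ContinuousOn (posSqrt : A → A) {a | 0 ≤ a} :=
  CFC.continuousOn_sqrt

/-- The identity function on the spectrum. -/
def spectrumId (a : A) : C(spectrum ℂ a, ℂ) := ⟨fun w => w, continuous_subtype_val⟩

theorem isUnit_one_sub_smul_spectrumId {a : A} (ha : 0 ≤ a) {r : ℝ} (hr : 0 < r)
    (har : ‖a‖ * r ≤ 1 / 2) {z : ℂ} (hz : z ∈ keyhole r) :
    IsUnit (1 - z • spectrumId a) := by
  rw [ContinuousMap.isUnit_iff_forall_ne_zero]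
  intro w
  obtain ⟨h1, h2, h3⟩ := spectrum_of_nonneg ha w.2
  have h4 := one_sub_mul_ne_zero h1 ((mul_le_mul_of_nonneg_right h2 hr.le).trans har) hz
  rw [h3] at h4
  simpa [spectrumId] using h4

theorem opIntegrand_spectrumId_apply {a : A} (ha : 0 ≤ a) {r : ℝ} (hr : 0 < r)
    (har : ‖a‖ * r ≤ 1 / 2) {z : ℂ} (hz : z ∈ keyhole r) (w : spectrum ℂ a) :
    opIntegrand (spectrumId a) z w = scalarIntegrand (w : ℂ).re z := by
  have h := map_opIntegrand (ContinuousMap.evalAlgHom ℂ ℂ w)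
    (isUnit_one_sub_smul_spectrumId ha hr har hz)
  have h1 : ContinuousMap.evalAlgHom ℂ ℂ w (opIntegrand (spectrumId a) z) =
    opIntegrand (spectrumId a) z w := rfl
  have h2 : ContinuousMap.evalAlgHom ℂ ℂ w (spectrumId a) = (w : ℂ) := rfl
  rw [← h1, h, h2, opIntegrand, scalarIntegrand, (spectrum_of_nonneg ha w.2).2.2, smul_eq_mul,
    smul_eq_mul, Ring.inverse_eq_inv', div_eq_mul_inv (w : ℂ)]

/-- In `C(σ(a))` the norm is the supremum over the spectrum, so the scalar bound, uniform in `τ ∈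
[0, ‖a‖]`, applies unchanged. -/
theorem keyholeIntegrable_opIntegrand_spectrumId {a : A} (ha : 0 ≤ a) {r : ℝ} (hr : 0 < r)
    (har : ‖a‖ * r ≤ 1 / 2) : KeyholeIntegrable r (opIntegrand (spectrumId a)) := by
  refine keyholeIntegrable_of_bound (C := (1 / 2 : ℝ) ^ (-(1 / 2) : ℝ)) hr
    (continuousOn_opIntegrand hr fun z hz => isUnit_one_sub_smul_spectrumId ha hr har hz) ?_
  intro z hz
  rw [ContinuousMap.norm_le]
  · intro w
    obtain ⟨h1, h2, h3⟩ := spectrum_of_nonneg ha w.2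
    rw [opIntegrand_spectrumId_apply ha hr har hz]
    exact norm_scalarIntegrand_le hr h1 ((mul_le_mul_of_nonneg_right h2 hr.le).trans har) hz
  · have : 0 ≤ max 0 (-z.re) := le_max_left _ _
    positivity

theorem keyholeIntegral_opIntegrand_spectrumId {a : A} (ha : 0 ≤ a) {r : ℝ} (hr : 0 < r)
    (har : ‖a‖ * r ≤ 1 / 2) (w : spectrum ℂ a) :
    keyholeIntegral r (opIntegrand (spectrumId a)) w = (Real.sqrt (w : ℂ).re : ℂ) := by
  have h := keyholeIntegral_clm_comp (keyholeIntegrable_opIntegrand_spectrumId ha hr har)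
    (ContinuousMap.evalCLM ℂ w)
  have h1 : ContinuousMap.evalCLM ℂ w (keyholeIntegral r (opIntegrand (spectrumId a))) =
    keyholeIntegral r (opIntegrand (spectrumId a)) w := rfl
  obtain ⟨h2, h3, h4⟩ := spectrum_of_nonneg ha w.2
  rw [← h1, ← h, ← keyholeIntegral_scalarIntegrand hr h2
    ((mul_le_mul_of_nonneg_right h3 hr.le).trans har)]
  exact keyholeIntegral_congr hr fun z hz => opIntegrand_spectrumId_apply ha hr har hz w

theorem isUnit_one_sub_smul {a : A} (ha : 0 ≤ a) {r : ℝ} (hr : 0 < r)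
    (har : ‖a‖ * r ≤ 1 / 2) {z : ℂ} (hz : z ∈ keyhole r) : IsUnit (1 - z • a) := by
  have hn : IsStarNormal a := (IsSelfAdjoint.of_nonneg ha).isStarNormal
  have h := (isUnit_one_sub_smul_spectrumId ha hr har hz).map (cfcHom (R := ℂ) hn)
  have h1 : cfcHom (R := ℂ) hn (spectrumId a) = a := cfcHom_id hn
  rwa [map_sub, map_one, map_smul, h1] at h

theorem cfcHom_opIntegrand {a : A} (ha : 0 ≤ a) (hn : IsStarNormal a) {r : ℝ} (hr : 0 < r)
    (har : ‖a‖ * r ≤ 1 / 2) {z : ℂ} (hz : z ∈ keyhole r) :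
    cfcHom (R := ℂ) hn (opIntegrand (spectrumId a) z) = opIntegrand a z := by
  have h1 : cfcHom (R := ℂ) hn (spectrumId a) = a := cfcHom_id hn
  have h := map_opIntegrand ((cfcHom (R := ℂ) hn : C(spectrum ℂ a, ℂ) →⋆ₐ[ℂ] A) :
    C(spectrum ℂ a, ℂ) →ₐ[ℂ] A) (isUnit_one_sub_smul_spectrumId ha hr har hz)
  change cfcHom (R := ℂ) hn (opIntegrand (spectrumId a) z) =
    opIntegrand (cfcHom (R := ℂ) hn (spectrumId a)) z at h
  rwa [h1] at h

theorem keyholeIntegrable_opIntegrand {a : A} (ha : 0 ≤ a) {r : ℝ} (hr : 0 < r)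
    (har : ‖a‖ * r ≤ 1 / 2) : KeyholeIntegrable r (opIntegrand a) := by
  have hn : IsStarNormal a := (IsSelfAdjoint.of_nonneg ha).isStarNormal
  exact ((keyholeIntegrable_opIntegrand_spectrumId ha hr har).clm_comp
    (cfcL (R := ℂ) hn)).congr hr fun z hz => cfcHom_opIntegrand ha hn hr har hz

open scoped ComplexOrder in
-- The integral is taken in `C(σ(a))`, where evaluation at points gives `w ↦ √w`. The functional
-- calculus maps this function to a nonnegative element with square `a`, and such an element is
-- unique.
theorem keyholeIntegral_opIntegrand {a : A} (ha : 0 ≤ a) {r : ℝ} (hr : 0 < r)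
    (har : ‖a‖ * r ≤ 1 / 2) : keyholeIntegral r (opIntegrand a) = posSqrt a := by
  have hn : IsStarNormal a := (IsSelfAdjoint.of_nonneg ha).isStarNormal
  set g := keyholeIntegral r (opIntegrand (spectrumId a)) with hg
  have h1 : keyholeIntegral r (opIntegrand a) = cfcHom (R := ℂ) hn g := by
    have h := keyholeIntegral_clm_comp (keyholeIntegrable_opIntegrand_spectrumId ha hr har)
      (cfcL (R := ℂ) hn)
    rw [← hg] at h
    change _ = cfcL (R := ℂ) hn g
    rw [← h]
    exact keyholeIntegral_congr hr fun z hz => (cfcHom_opIntegrand ha hn hr har hz).symm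
  rw [h1]
  symm
  refine posSqrt_unique ?_ ?_
  · rw [← map_mul]
    have h2 : g * g = spectrumId a := by
      ext w
      obtain ⟨h3, h4, h5⟩ := spectrum_of_nonneg ha w.2
      rw [ContinuousMap.mul_apply, hg, keyholeIntegral_opIntegrand_spectrumId ha hr har,
        ← Complex.ofReal_mul, Real.mul_self_sqrt h3, h5]
      rfl
    rw [h2]
    exact cfcHom_id hn
  · rw [cfcHom_nonneg_iff]
    intro w
    change 0 ≤ g w
    rw [hg, keyholeIntegral_opIntegrand_spectrumId ha hr har]
    exact Complex.zero_le_real.mpr (Real.sqrt_nonneg _)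

/-- An intertwiner of `a` and `b` intertwines their resolvents, hence the integrands, hence the
integrals that represent the roots. -/
theorem posSqrt_mul_of_semiconj {a b k : A} (ha : 0 ≤ a) (hb : 0 ≤ b) {r : ℝ} (hr : 0 < r)
    (har : ‖a‖ * r ≤ 1 / 2) (hbr : ‖b‖ * r ≤ 1 / 2) (h : a * k = k * b) :
    posSqrt a * k = k * posSqrt b := by
  have h1 := keyholeIntegral_clm_comp (keyholeIntegrable_opIntegrand ha hr har)
    ((ContinuousLinearMap.mul ℂ A).flip k)
  have h2 := keyholeIntegral_clm_comp (keyholeIntegrable_opIntegrand hb hr hbr)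
    (ContinuousLinearMap.mul ℂ A k)
  rw [keyholeIntegral_opIntegrand ha hr har] at h1
  rw [keyholeIntegral_opIntegrand hb hr hbr] at h2
  simp only [ContinuousLinearMap.flip_apply, ContinuousLinearMap.mul_apply'] at h1 h2
  rw [← h1, ← h2]
  exact keyholeIntegral_congr hr fun z hz => opIntegrand_mul_of_semiconj h
    (isUnit_one_sub_smul ha hr har hz) (isUnit_one_sub_smul hb hr hbr hz)

end

/-! ### Factorization of `B_v` -/

theorem norm_mulC_le {g : C(Circ, ℂ)} {C : ℝ} (hg : ∀ x, ‖g x‖ ≤ C) (f : L2C) :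
    ‖mulC g f‖ ≤ C * ‖f‖ := by
  refine Lp.norm_le_mul_norm_of_ae_le_mul ?_
  filter_upwards [coeFn_mulC g f] with x h
  rw [h, norm_mul]
  exact mul_le_mul_of_nonneg_right (hg x) (norm_nonneg _)

/-- The function `√(ε² + v²)`. -/
def rootCoef (ε : ℝ) (v : C(Circ, ℝ)) : C(Circ, ℂ) :=
  (⟨fun t : ℝ => ((Real.sqrt (ε ^ 2 + t ^ 2) : ℝ) : ℂ), by fun_prop⟩ : C(ℝ, ℂ)).comp v

/-- The function `1 / √(ε² + v²)`. -/
def rootCoefInv {ε : ℝ} (hε : 0 < ε) (v : C(Circ, ℝ)) : C(Circ, ℂ) :=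
  (⟨fun t : ℝ => (((Real.sqrt (ε ^ 2 + t ^ 2))⁻¹ : ℝ) : ℂ), by
    have h : ∀ t : ℝ, Real.sqrt (ε ^ 2 + t ^ 2) ≠ 0 := fun t =>
      (Real.sqrt_pos.mpr (by positivity)).ne'
    fun_prop (disch := exact h _)⟩ : C(ℝ, ℂ)).comp v

theorem rootCoef_apply (ε : ℝ) (v : C(Circ, ℝ)) (x : Circ) :
    rootCoef ε v x = ((Real.sqrt (ε ^ 2 + v x ^ 2) : ℝ) : ℂ) := rfl

theorem rootCoefInv_apply {ε : ℝ} (hε : 0 < ε) (v : C(Circ, ℝ)) (x : Circ) :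
    rootCoefInv hε v x = (((Real.sqrt (ε ^ 2 + v x ^ 2))⁻¹ : ℝ) : ℂ) := rfl

theorem continuous_rootCoef (ε : ℝ) : Continuous (rootCoef ε) :=
  ContinuousMap.continuous_postcomp _

theorem continuous_rootCoefInv {ε : ℝ} (hε : 0 < ε) : Continuous (rootCoefInv hε) :=
  ContinuousMap.continuous_postcomp _

theorem star_rootCoef (ε : ℝ) (v : C(Circ, ℝ)) : star (rootCoef ε v) = rootCoef ε v := by
  ext x
  rw [ContinuousMap.star_apply, rootCoef_apply]
  exact Complex.conj_ofReal _

theorem star_rootCoefInv {ε : ℝ} (hε : 0 < ε) (v : C(Circ, ℝ)) :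
    star (rootCoefInv hε v) = rootCoefInv hε v := by
  ext x
  rw [ContinuousMap.star_apply, rootCoefInv_apply]
  exact Complex.conj_ofReal _

theorem rootCoef_mul_self (ε : ℝ) (v : C(Circ, ℝ)) : rootCoef ε v * rootCoef ε v = coef ε v := by
  ext x
  rw [ContinuousMap.mul_apply, rootCoef_apply, ← Complex.ofReal_mul,
    Real.mul_self_sqrt (by positivity)]
  rfl

theorem rootCoef_mul_inv {ε : ℝ} (hε : 0 < ε) (v : C(Circ, ℝ)) :
    rootCoef ε v * rootCoefInv hε v = 1 := by
  ext x
  have h : Real.sqrt (ε ^ 2 + v x ^ 2) ≠ 0 := (Real.sqrt_pos.mpr (by positivity)).ne'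
  rw [ContinuousMap.mul_apply, rootCoef_apply, rootCoefInv_apply, ← Complex.ofReal_mul,
    mul_inv_cancel₀ h]
  simp

theorem norm_rootCoefInv_le {ε : ℝ} (hε : 0 < ε) (v : C(Circ, ℝ)) (x : Circ) :
    ‖rootCoefInv hε v x‖ ≤ ε⁻¹ := by
  rw [rootCoefInv_apply, Complex.norm_real, Real.norm_of_nonneg (by positivity)]
  gcongr
  exact Real.le_sqrt_of_sq_le (by nlinarith [sq_nonneg (v x)])

theorem mulC_root_inv {ε : ℝ} (hε : 0 < ε) (v : C(Circ, ℝ)) (f : L2C) :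
    mulC (rootCoef ε v) (mulC (rootCoefInv hε v) f) = f := by
  rw [mulC_mulC, rootCoef_mul_inv, mulC_one]

theorem mulC_inv_root {ε : ℝ} (hε : 0 < ε) (v : C(Circ, ℝ)) (f : L2C) :
    mulC (rootCoefInv hε v) (mulC (rootCoef ε v) f) = f := by
  rw [mulC_mulC, mul_comm, rootCoef_mul_inv, mulC_one]

/-- `√(ε² + v²) D_q`. -/
def factorR (ε q : ℝ) (v : C(Circ, ℝ)) : Hs 1 →L[ℂ] L2C := mulC (rootCoef ε v) ∘L Dq ε q

/-- The inverse of `√(ε² + v²) D_q`. -/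
def factorRInv {ε : ℝ} (hε : 0 < ε) (q : ℝ) (v : C(Circ, ℝ)) : L2C →L[ℂ] Hs 1 :=
  DqInv hε q ∘L mulC (rootCoefInv hε v)

/-- `D_q' √(ε² + v²)`. -/
def factorL (ε q : ℝ) (v : C(Circ, ℝ)) : L2C →L[ℂ] Hs (-1) := DqAdj ε q ∘L mulC (rootCoef ε v)

/-- The inverse of `D_q' √(ε² + v²)`. -/
def factorLInv {ε : ℝ} (hε : 0 < ε) (q : ℝ) (v : C(Circ, ℝ)) : Hs (-1) →L[ℂ] L2C :=
  mulC (rootCoefInv hε v) ∘L DqAdjInv hε q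

theorem Bop_eq (ε q : ℝ) (v : C(Circ, ℝ)) : Bop ε q v = factorL ε q v ∘L factorR ε q v := by
  ext1 u
  change DqAdj ε q (mulC (coef ε v) (Dq ε q u)) =
    DqAdj ε q (mulC (rootCoef ε v) (mulC (rootCoef ε v) (Dq ε q u)))
  rw [mulC_mulC, rootCoef_mul_self]

theorem factorR_factorRInv {ε : ℝ} (hε : 0 < ε) (q : ℝ) (v : C(Circ, ℝ)) (f : L2C) :
    factorR ε q v (factorRInv hε q v f) = f := by
  change mulC (rootCoef ε v) (Dq ε q (DqInv hε q (mulC (rootCoefInv hε v) f))) = f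
  rw [Dq_DqInv, mulC_root_inv]

theorem factorRInv_factorR {ε : ℝ} (hε : 0 < ε) (q : ℝ) (v : C(Circ, ℝ)) (u : Hs 1) :
    factorRInv hε q v (factorR ε q v u) = u := by
  change DqInv hε q (mulC (rootCoefInv hε v) (mulC (rootCoef ε v) (Dq ε q u))) = u
  rw [mulC_inv_root, DqInv_Dq]

theorem factorL_factorLInv {ε : ℝ} (hε : 0 < ε) (q : ℝ) (v : C(Circ, ℝ)) (f : Hs (-1)) :
    factorL ε q v (factorLInv hε q v f) = f := by
  change DqAdj ε q (mulC (rootCoef ε v) (mulC (rootCoefInv hε v) (DqAdjInv hε q f))) = f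
  rw [mulC_root_inv, DqAdj_DqAdjInv]

theorem factorLInv_factorL {ε : ℝ} (hε : 0 < ε) (q : ℝ) (v : C(Circ, ℝ)) (f : L2C) :
    factorLInv hε q v (factorL ε q v f) = f := by
  change mulC (rootCoefInv hε v) (DqAdjInv hε q (DqAdj ε q (mulC (rootCoef ε v) f))) = f
  rw [DqAdjInv_DqAdj, mulC_inv_root]

/-- `D_q⁻¹ (ε² + v²)^{-1/2}` on `L²(𝕋)`. -/
def halfInv {ε : ℝ} (hε : 0 < ε) (q : ℝ) (v : C(Circ, ℝ)) : L2C →L[ℂ] L2C :=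
  Lc hε q ∘L mulC (rootCoefInv hε v)

/-- `(ε² + v²)^{-1/2} (D_q')⁻¹` on `L²(𝕋)`. -/
def halfInvAdj {ε : ℝ} (hε : 0 < ε) (q : ℝ) (v : C(Circ, ℝ)) : L2C →L[ℂ] L2C :=
  mulC (rootCoefInv hε v) ∘L LcAdj hε q

theorem adjoint_halfInv {ε : ℝ} (hε : 0 < ε) (q : ℝ) (v : C(Circ, ℝ)) :
    ContinuousLinearMap.adjoint (halfInv hε q v) = halfInvAdj hε q v := by
  rw [halfInv, ContinuousLinearMap.adjoint_comp, adjoint_Lc, adjoint_mulC, star_rootCoefInv]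
  rfl

theorem adjoint_halfInvAdj {ε : ℝ} (hε : 0 < ε) (q : ℝ) (v : C(Circ, ℝ)) :
    ContinuousLinearMap.adjoint (halfInvAdj hε q v) = halfInv hε q v := by
  rw [← adjoint_halfInv, ContinuousLinearMap.adjoint_adjoint]

theorem factorL_halfInvAdj {ε : ℝ} (hε : 0 < ε) (q : ℝ) (v : C(Circ, ℝ)) (f : L2C) :
    factorL ε q v (halfInvAdj hε q v f) = l2Hm1 f := factorL_factorLInv hε q v (l2Hm1 f)

theorem halfInvAdj_eq {ε : ℝ} (hε : 0 < ε) (q : ℝ) (v : C(Circ, ℝ)) (f : L2C) :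
    halfInvAdj hε q v f = factorLInv hε q v (l2Hm1 f) := rfl

theorem halfInv_eq {ε : ℝ} (hε : 0 < ε) (q : ℝ) (v : C(Circ, ℝ)) (f : L2C) :
    halfInv hε q v f = h1L2 (factorRInv hε q v f) := rfl

/-- The operator on `L²(𝕋)` that is similar to `B_v⁻¹` on `H^{-1}(𝕋)`. -/
def simInv {ε : ℝ} (hε : 0 < ε) (q : ℝ) (v : C(Circ, ℝ)) : L2C →L[ℂ] L2C :=
  halfInvAdj hε q v ∘L halfInv hε q v

/-- The restriction of `B_v⁻¹` to `L²(𝕋)`. -/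
def resInv {ε : ℝ} (hε : 0 < ε) (q : ℝ) (v : C(Circ, ℝ)) : L2C →L[ℂ] L2C :=
  halfInv hε q v ∘L halfInvAdj hε q v

theorem simInv_nonneg {ε : ℝ} (hε : 0 < ε) (q : ℝ) (v : C(Circ, ℝ)) : 0 ≤ simInv hε q v := by
  rw [simInv, ← adjoint_halfInv]
  exact star_mul_self_nonneg (halfInv hε q v)

theorem resInv_nonneg {ε : ℝ} (hε : 0 < ε) (q : ℝ) (v : C(Circ, ℝ)) : 0 ≤ resInv hε q v := by
  rw [resInv, ← adjoint_halfInv]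
  exact mul_star_self_nonneg (halfInv hε q v)

/-! ### Coercivity -/

theorem pairing_DqAdj (ε q : ℝ) (f : L2C) (u : Hs 1) :
    pairing (DqAdj ε q f) u = inner ℂ (Dq ε q u) f := by
  rw [pairing, inner_eq_tsum_repr]
  refine tsum_congr fun k => ?_
  rw [DqAdj_coeff, Dq_repr, map_mul]
  ring

/-- Turns coercivity of `B_v` into a lower bound for the norm of the factor `√(ε² + v²) D_q`. -/
theorem pairing_Bop (ε q : ℝ) (v : C(Circ, ℝ)) (u : Hs 1) :
    pairing (Bop ε q v u) u = ((‖factorR ε q v u‖ ^ 2 : ℝ) : ℂ) := by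
  have h : Bop ε q v u = DqAdj ε q (mulC (rootCoef ε v) (factorR ε q v u)) := by
    rw [Bop_eq]
    rfl
  rw [h, pairing_DqAdj, ← star_rootCoef, ← inner_mulC_left]
  change inner ℂ (factorR ε q v u) (factorR ε q v u) = _
  rw [inner_self_eq_norm_sq_to_K]
  simp

theorem norm_le_norm_Dq {ε c : ℝ} (q : ℝ) (hc : 0 < c)
    (h : ∀ k, c * wts 1 k ≤ ‖dqSymbol ε q k‖) (u : Hs 1) : c * ‖u‖ ≤ ‖Dq ε q u‖ := by
  have h1 : c * ‖u‖ = ‖(c : ℂ) • Hs.bessel 1 u‖ := by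
    rw [norm_smul, Complex.norm_real, Real.norm_of_nonneg hc.le, Hs.norm_def]
  rw [h1, ← (fourierBasis (T := 1)).repr.norm_map]
  refine lp.norm_mono (by norm_num) fun k => ?_
  rw [Dq_repr]
  have h2 : ((c : ℂ) • Hs.bessel 1 u) k = (c : ℂ) * ((wts 1 k : ℂ) * u.coeff k) := rfl
  rw [h2, norm_mul, norm_mul, norm_mul, Complex.norm_real, Complex.norm_real,
    Real.norm_of_nonneg hc.le, Real.norm_of_nonneg (wts_pos 1 k).le, ← mul_assoc]
  gcongr
  exact h k

theorem exists_isCoercivityConst {ε : ℝ} (hε : 0 < ε) (q : ℝ) :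
    ∃ δ : ℝ, 0 < δ ∧ IsCoercivityConst ε q δ := by
  obtain ⟨c, hc, h⟩ := exists_le_norm_dqSymbol hε q
  -- Here `ε` bounds `√(ε² + v²)` from below for every `v`, and `c` is the lower bound for the
  -- symbol of `D_q`.
  refine ⟨(ε * c) ^ 2, by positivity, fun v u => ?_⟩
  rw [pairing_Bop, Complex.ofReal_re, ← mul_pow]
  refine pow_le_pow_left₀ (by positivity) ?_ 2
  have h1 : ‖Dq ε q u‖ ≤ ε⁻¹ * ‖factorR ε q v u‖ := by
    conv_lhs => rw [← mulC_inv_root hε v (Dq ε q u)]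
    exact norm_mulC_le (norm_rootCoefInv_le hε v) _
  have h2 := (norm_le_norm_Dq q hc h u).trans h1
  rw [inv_mul_eq_div, le_div_iff₀ hε] at h2
  linarith

/-- Coercivity at `u = T⁻¹ f`, with `T = √(ε² + v²) D_q`, reads `δ ‖T⁻¹ f‖² ≤ ‖f‖²` in the norm of
`H¹`, which dominates that of `L²`. -/
theorem norm_halfInv_sq_le {ε δ : ℝ} (hε : 0 < ε) (q : ℝ) (hδ : 0 < δ)
    (h : IsCoercivityConst ε q δ) (v : C(Circ, ℝ)) :
    ‖halfInv hε q v‖ * ‖halfInv hε q v‖ ≤ δ⁻¹ := by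
  have h1 : ‖halfInv hε q v‖ ≤ Real.sqrt δ⁻¹ := by
    refine ContinuousLinearMap.opNorm_le_bound _ (Real.sqrt_nonneg _) fun f => ?_
    have h2 := h v (factorRInv hε q v f)
    rw [pairing_Bop, Complex.ofReal_re, factorR_factorRInv] at h2
    rw [halfInv_eq]
    refine (norm_h1L2_le _).trans ?_
    refine abs_le_of_sq_le_sq' ?_ (by positivity) |>.2
    rw [mul_pow, Real.sq_sqrt (by positivity), inv_mul_eq_div, le_div_iff₀ hδ]
    linarith
  calc _ ≤ Real.sqrt δ⁻¹ * Real.sqrt δ⁻¹ := by gcongr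
    _ = δ⁻¹ := Real.mul_self_sqrt (by positivity)

theorem norm_simInv_le {ε δ : ℝ} (hε : 0 < ε) (q : ℝ) (hδ : 0 < δ)
    (h : IsCoercivityConst ε q δ) (v : C(Circ, ℝ)) : ‖simInv hε q v‖ * (δ / 2) ≤ 1 / 2 := by
  have h1 : ‖simInv hε q v‖ ≤ δ⁻¹ := by
    rw [simInv, ← adjoint_halfInv, ContinuousLinearMap.norm_adjoint_comp_self]
    exact norm_halfInv_sq_le hε q hδ h v
  calc _ ≤ δ⁻¹ * (δ / 2) := by gcongr
    _ = 1 / 2 := by field_simp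

theorem norm_resInv_le {ε δ : ℝ} (hε : 0 < ε) (q : ℝ) (hδ : 0 < δ)
    (h : IsCoercivityConst ε q δ) (v : C(Circ, ℝ)) : ‖resInv hε q v‖ * (δ / 2) ≤ 1 / 2 := by
  have h1 : ‖resInv hε q v‖ ≤ δ⁻¹ := by
    rw [resInv, ← adjoint_halfInvAdj, ContinuousLinearMap.norm_adjoint_comp_self,
      ← adjoint_halfInv, LinearIsometryEquiv.norm_map]
    exact norm_halfInv_sq_le hε q hδ h v
  calc _ ≤ δ⁻¹ * (δ / 2) := by gcongr
    _ = 1 / 2 := by field_simp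

/-! ### The Dunford–Taylor integral -/

theorem Gam_eq_keyholeIntegral (ε q δ : ℝ) (v : C(Circ, ℝ)) :
    Gam ε q δ v = keyholeIntegral (δ / 2) (dtIntegrand ε q v) := rfl

/-- `X ↦ D_q' √(ε² + v²) X (D_q' √(ε² + v²))⁻¹`. -/
def conjugation {ε : ℝ} (hε : 0 < ε) (q : ℝ) (v : C(Circ, ℝ)) :
    (L2C →L[ℂ] L2C) →L[ℂ] (Hs (-1) →L[ℂ] Hs (-1)) :=
  ContinuousLinearMap.compL ℂ (Hs (-1)) L2C (Hs (-1)) (factorL ε q v) ∘L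
    (ContinuousLinearMap.compL ℂ (Hs (-1)) L2C L2C).flip (factorLInv hε q v)

theorem conjugation_apply {ε : ℝ} (hε : 0 < ε) (q : ℝ) (v : C(Circ, ℝ)) (X : L2C →L[ℂ] L2C)
    (f : Hs (-1)) :
    conjugation hε q v X f = factorL ε q v (X (factorLInv hε q v f)) := rfl

/-- The inclusion `H¹ ⊆ H^{-1}` itself factors as `S (K*K) T`, since `K T` and `S K*` are
inclusions. So `z` can be subtracted between the two factors. -/
theorem Bop_sub_smul_incl {ε : ℝ} (hε : 0 < ε) (q : ℝ) (v : C(Circ, ℝ)) (z : ℂ) (u : Hs 1) :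
    (Bop ε q v - z • incl 1 (-1) (by norm_num)) u =
      factorL ε q v ((1 - z • simInv hε q v) (factorR ε q v u)) := by
  have h : simInv hε q v (factorR ε q v u) = halfInvAdj hε q v (h1L2 u) := by
    change halfInvAdj hε q v (halfInv hε q v (factorR ε q v u)) = _
    rw [halfInv_eq, factorRInv_factorR]
  simp only [sub_apply, smul_apply, one_apply_eq_self, map_sub, map_smul]
  rw [h, factorL_halfInvAdj, l2Hm1_h1L2, Bop_eq]
  rfl

theorem dtIntegrand_eq {ε : ℝ} (hε : 0 < ε) (q : ℝ) (v : C(Circ, ℝ)) {z : ℂ}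
    (hz : IsUnit (1 - z • simInv hε q v)) :
    dtIntegrand ε q v z = conjugation hε q v (opIntegrand (simInv hε q v) z) := by
  set R := Ring.inverse (1 - z • simInv hε q v) with hR
  have h1 : ∀ f, (1 - z • simInv hε q v) (R f) = f := fun f => by
    have := Ring.mul_inverse_cancel _ hz
    exact congrArg (fun T : L2C →L[ℂ] L2C => T f) this
  have h2 : ∀ f, R ((1 - z • simInv hε q v) f) = f := fun f => by
    have := Ring.inverse_mul_cancel _ hz
    exact congrArg (fun T : L2C →L[ℂ] L2C => T f) this
  have h3 : (Bop ε q v - z • incl 1 (-1) (by norm_num)).inverse =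
      factorRInv hε q v ∘L R ∘L factorLInv hε q v := by
    refine ContinuousLinearMap.inverse_eq ?_ ?_
    · ext1 f
      rw [ContinuousLinearMap.comp_apply, Bop_sub_smul_incl hε]
      change factorL ε q v ((1 - z • simInv hε q v) (factorR ε q v (factorRInv hε q v
        (R (factorLInv hε q v f))))) = f
      rw [factorR_factorRInv, h1, factorL_factorLInv]
    · ext1 u
      rw [ContinuousLinearMap.comp_apply, Bop_sub_smul_incl hε]
      change factorRInv hε q v (R (factorLInv hε q v (factorL ε q v
        ((1 - z • simInv hε q v) (factorR ε q v u))))) = u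
      rw [factorLInv_factorL, h2, factorRInv_factorR]
  rw [dtIntegrand, resolv, h3, opIntegrand, map_smul]
  congr 1
  ext1 f
  rw [conjugation_apply]
  -- Following `T⁻¹` by the inclusion into `H^{-1}` gives `S K*K`; this supplies the factor `a` in
  -- `a (1 - z a)⁻¹`.
  change incl 1 (-1) (by norm_num) (factorRInv hε q v (R (factorLInv hε q v f))) =
    factorL ε q v (halfInvAdj hε q v (halfInv hε q v (R (factorLInv hε q v f))))
  rw [factorL_halfInvAdj, halfInv_eq, l2Hm1_h1L2]

theorem Gam_eq {ε δ : ℝ} (hε : 0 < ε) (q : ℝ) (hδ : 0 < δ) (h : IsCoercivityConst ε q δ)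
    (v : C(Circ, ℝ)) : Gam ε q δ v = conjugation hε q v (posSqrt (simInv hε q v)) := by
  have hr : 0 < δ / 2 := by positivity
  have ha := simInv_nonneg hε q v
  have hn := norm_simInv_le hε q hδ h v
  rw [Gam_eq_keyholeIntegral, ← keyholeIntegral_opIntegrand ha hr hn,
    ← keyholeIntegral_clm_comp (keyholeIntegrable_opIntegrand ha hr hn)]
  exact keyholeIntegral_congr hr fun z hz =>
    dtIntegrand_eq hε q v (isUnit_one_sub_smul ha hr hn hz)

theorem simInv_mul_halfInvAdj {ε : ℝ} (hε : 0 < ε) (q : ℝ) (v : C(Circ, ℝ)) :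
    simInv hε q v * halfInvAdj hε q v = halfInvAdj hε q v * resInv hε q v := by
  ext1 f
  rw [mul_apply_eq_comp, mul_apply_eq_comp, simInv, resInv,
    ContinuousLinearMap.comp_apply, ContinuousLinearMap.comp_apply]

theorem posSqrt_mul_halfInvAdj {ε δ : ℝ} (hε : 0 < ε) (q : ℝ) (hδ : 0 < δ)
    (h : IsCoercivityConst ε q δ) (v : C(Circ, ℝ)) :
    posSqrt (simInv hε q v) * halfInvAdj hε q v =
      halfInvAdj hε q v * posSqrt (resInv hε q v) :=
  posSqrt_mul_of_semiconj (simInv_nonneg hε q v) (resInv_nonneg hε q v) (half_pos hδ)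
    (norm_simInv_le hε q hδ h v) (norm_resInv_le hε q hδ h v) (simInv_mul_halfInvAdj hε q v)

theorem posSqrt_simInv_halfInvAdj {ε δ : ℝ} (hε : 0 < ε) (q : ℝ) (hδ : 0 < δ)
    (h : IsCoercivityConst ε q δ) (v : C(Circ, ℝ)) (f : L2C) :
    posSqrt (simInv hε q v) (halfInvAdj hε q v f) =
      halfInvAdj hε q v (posSqrt (resInv hε q v) f) := by
  have hs := DFunLike.congr_fun (posSqrt_mul_halfInvAdj hε q hδ h v) f
  rwa [mul_apply_eq_comp, mul_apply_eq_comp] at hs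

/-- On `L²` the inclusion is `S K*`, so `S √(K*K) S⁻¹` becomes `S √(K*K) K* = S K* √(KK*)`, the
inclusion after `√(KK*)`. -/
theorem Gam_l2Hm1 {ε δ : ℝ} (hε : 0 < ε) (q : ℝ) (hδ : 0 < δ) (h : IsCoercivityConst ε q δ)
    (v : C(Circ, ℝ)) (f : L2C) : Gam ε q δ v (l2Hm1 f) = l2Hm1 (posSqrt (resInv hε q v) f) := by
  rw [Gam_eq hε q hδ h v, conjugation_apply, ← halfInvAdj_eq, ← factorL_halfInvAdj hε q v]
  rw [posSqrt_simInv_halfInvAdj hε q hδ h v]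

/-! ### Invariance under complex conjugation -/

theorem conjL2_smul (c : ℂ) (f : L2C) : conjL2 (c • f) = conj c • conjL2 f := by
  apply Lp.ext
  filter_upwards [coeFn_conjL2 (c • f), Lp.coeFn_smul c f, Lp.coeFn_smul (conj c) (conjL2 f),
    coeFn_conjL2 f] with x h1 h2 h3 h4
  rw [h1, h2, h3, Pi.smul_apply, Pi.smul_apply, h4, smul_eq_mul, smul_eq_mul, map_mul]

/-- The operator `f ↦ conj (T (conj f))`. -/
def conjOp (T : L2C →L[ℂ] L2C) : L2C →L[ℂ] L2C where
  toFun f := conjL2 (T (conjL2 f))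
  map_add' f g := by simp only [map_add]
  map_smul' c f := by
    rw [conjL2_smul, map_smul, conjL2_smul, Complex.conj_conj, RingHom.id_apply]
  cont := conjL2.continuous.comp (T.continuous.comp conjL2.continuous)

theorem conjOp_apply (T : L2C →L[ℂ] L2C) (f : L2C) : conjOp T f = conjL2 (T (conjL2 f)) := rfl

theorem conjOp_mul (S T : L2C →L[ℂ] L2C) : conjOp S * conjOp T = conjOp (S * T) := by
  ext1 f
  rw [mul_apply_eq_comp, conjOp_apply, conjOp_apply, conjOp_apply, conjL2_conjL2,
    mul_apply_eq_comp]

theorem conjOp_nonneg {T : L2C →L[ℂ] L2C} (hT : 0 ≤ T) : 0 ≤ conjOp T := by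
  rw [ContinuousLinearMap.nonneg_iff_isPositive] at hT ⊢
  have key : ∀ f g, inner ℂ (conjOp T f) g = conj (inner ℂ (T (conjL2 f)) (conjL2 g)) := by
    intro f g
    rw [conjOp_apply, ← inner_conjL2, conjL2_conjL2]
  rw [ContinuousLinearMap.isPositive_iff_complex] at hT ⊢
  intro f
  obtain ⟨h1, h2⟩ := hT (conjL2 f)
  constructor
  · rw [key, ← h1]
    simp
  · rw [key]
    rw [RCLike.conj_re]
    exact h2

/-- Conjugating the root gives another positive square root of the same operator, so uniqueness
applies. -/
theorem posSqrt_conjL2 {T : L2C →L[ℂ] L2C} (hT : 0 ≤ T)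
    (h : ∀ f, T (conjL2 f) = conjL2 (T f)) (f : L2C) :
    posSqrt T (conjL2 f) = conjL2 (posSqrt T f) := by
  have h1 : conjOp T = T := by
    ext1 g
    rw [conjOp_apply, h, conjL2_conjL2]
  have h2 : posSqrt T = conjOp (posSqrt T) := by
    refine posSqrt_unique ?_ (conjOp_nonneg (posSqrt_nonneg T))
    rw [conjOp_mul, posSqrt_mul_self hT, h1]
  conv_lhs => rw [h2]
  rw [conjOp_apply, conjL2_conjL2]

theorem ofRealL2_realOp {T : L2C →L[ℂ] L2C} (h : ∀ f, T (conjL2 f) = conjL2 (T f)) (f : L2R) :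
    ofRealL2 (realOp T f) = T (ofRealL2 f) := by
  change ofRealL2 (reL2 (T (ofRealL2 f))) = _
  refine ofRealL2_reL2 ?_
  rw [← h, conjL2_ofRealL2]

theorem adjoint_realOp {S T : L2C →L[ℂ] L2C} (hS : ∀ f, S (conjL2 f) = conjL2 (S f))
    (hT : ∀ f, T (conjL2 f) = conjL2 (T f)) (h : ∀ f g, inner ℂ (T f) g = inner ℂ f (S g)) :
    ContinuousLinearMap.adjoint (realOp T) = realOp S := by
  symm
  rw [ContinuousLinearMap.eq_adjoint_iff]
  intro f g
  apply Complex.ofReal_injective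
  rw [← inner_ofRealL2, ← inner_ofRealL2, ofRealL2_realOp hS, ofRealL2_realOp hT,
    ← inner_conj_symm, ← h, inner_conj_symm]

/-! ### The square root of `B_v⁻¹` on `L²(𝕋)` and its extension to `H^{-1}(𝕋)` -/

/-- `B_v^{-1/2}` on `L²(𝕋)`. -/
def rootInv {ε : ℝ} (hε : 0 < ε) (q : ℝ) (v : C(Circ, ℝ)) : L2C →L[ℂ] L2C :=
  posSqrt (resInv hε q v)

section

variable {ε : ℝ} (hε : 0 < ε) (q : ℝ) (v : C(Circ, ℝ))

theorem mulC_rootCoefInv_conjL2 (f : L2C) :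
    mulC (rootCoefInv hε v) (conjL2 f) = conjL2 (mulC (rootCoefInv hε v) f) := by
  rw [mulC_conjL2, star_rootCoefInv]

theorem resInv_apply (f : L2C) : resInv hε q v f =
    Lc hε q (mulC (rootCoefInv hε v) (mulC (rootCoefInv hε v) (LcAdj hε q f))) := rfl

theorem resInv_conjL2 (f : L2C) : resInv hε q v (conjL2 f) = conjL2 (resInv hε q v f) := by
  rw [resInv_apply, resInv_apply, LcAdj_conjL2, mulC_rootCoefInv_conjL2, mulC_rootCoefInv_conjL2,
    Lc_conjL2]

theorem rootInv_conjL2 (f : L2C) : rootInv hε q v (conjL2 f) = conjL2 (rootInv hε q v f) :=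
  posSqrt_conjL2 (resInv_nonneg hε q v) (resInv_conjL2 hε q v) f

theorem rootInv_rootInv (f : L2C) : rootInv hε q v (rootInv hε q v f) = resInv hε q v f := by
  have h := posSqrt_mul_self (resInv_nonneg hε q v)
  exact DFunLike.congr_fun h f

theorem inner_rootInv_left (f g : L2C) :
    inner ℂ (rootInv hε q v f) g = inner ℂ f (rootInv hε q v g) := by
  have h : 0 ≤ rootInv hε q v := posSqrt_nonneg _
  rw [ContinuousLinearMap.nonneg_iff_isPositive] at h
  exact h.isSelfAdjoint.isSymmetric f g

/-- Both squares equal `⟨KK* f, f⟩`. The right side needs only the `H^{-1}` norm of `f`, which is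
what lets the root be extended to `H^{-1}`. -/
theorem norm_rootInv (f : L2C) : ‖rootInv hε q v f‖ = ‖halfInvAdj hε q v f‖ := by
  have h1 : inner ℂ (rootInv hε q v f) (rootInv hε q v f) =
      inner ℂ (halfInvAdj hε q v f) (halfInvAdj hε q v f) := by
    rw [inner_rootInv_left, rootInv_rootInv, ← adjoint_halfInv,
      ContinuousLinearMap.adjoint_inner_left, ← ContinuousLinearMap.comp_apply, adjoint_halfInv]
    rfl
  rw [inner_self_eq_norm_sq_to_K, inner_self_eq_norm_sq_to_K] at h1
  have h2 : ‖rootInv hε q v f‖ ^ 2 = ‖halfInvAdj hε q v f‖ ^ 2 := by exact_mod_cast h1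
  exact (pow_left_inj₀ (norm_nonneg _) (norm_nonneg _) two_ne_zero).mp h2

theorem norm_factorLInv_le (f : Hs (-1)) :
    ‖factorLInv hε q v f‖ ≤ (ε⁻¹ * ‖DqAdjInv hε q‖) * ‖f‖ := by
  refine (norm_mulC_le (norm_rootCoefInv_le hε v) _).trans ?_
  rw [mul_assoc]
  gcongr
  exact ContinuousLinearMap.le_opNorm _ _

theorem norm_rootInv_le (f : L2C) :
    ‖rootInv hε q v f‖ ≤ (ε⁻¹ * ‖DqAdjInv hε q‖) * ‖l2Hm1 f‖ := by
  rw [norm_rootInv, halfInvAdj_eq]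
  exact norm_factorLInv_le hε q v _

/-- `B_v^{-1/2} : H^{-1}(𝕋) → L²(𝕋)`. -/
def rootExt : Hs (-1) →L[ℂ] L2C := (rootInv hε q v).toLinearMap.extendOfNorm l2Hm1.toLinearMap

/-- The extension by density agrees with the given operator because the range is dense and the
estimate in the `H^{-1}` norm holds. -/
theorem rootExt_l2Hm1 (f : L2C) : rootExt hε q v (l2Hm1 f) = rootInv hε q v f := by
  exact LinearMap.extendOfNorm_eq denseRange_l2Hm1 ⟨_, norm_rootInv_le hε q v⟩ f

theorem norm_rootExt_le (f : Hs (-1)) :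
    ‖rootExt hε q v f‖ ≤ (ε⁻¹ * ‖DqAdjInv hε q‖) * ‖f‖ :=
  LinearMap.norm_extendOfNorm_apply_le denseRange_l2Hm1 _ (norm_rootInv_le hε q v) f

theorem rootExt_conjHs (f : Hs (-1)) :
    rootExt hε q v (conjHs (-1) f) = conjL2 (rootExt hε q v f) := by
  refine denseRange_l2Hm1.induction_on (p := fun f => rootExt hε q v (conjHs (-1) f) =
    conjL2 (rootExt hε q v f)) f (isClosed_eq (by fun_prop) (by fun_prop)) fun g => ?_
  rw [← l2Hm1_conjL2, rootExt_l2Hm1, rootExt_l2Hm1, rootInv_conjL2]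

/-- Both sides are continuous in `f` and agree on the dense image of `L²`. So `Γ_v` takes its values
in `L²` on all of `H^{-1}`. -/
theorem l2Hm1_rootExt {δ : ℝ} (hδ : 0 < δ) (h : IsCoercivityConst ε q δ) (f : Hs (-1)) :
    l2Hm1 (rootExt hε q v f) = Gam ε q δ v f := by
  refine denseRange_l2Hm1.induction_on (p := fun f => l2Hm1 (rootExt hε q v f) =
    Gam ε q δ v f) f (isClosed_eq (by fun_prop) (by fun_prop)) fun g => ?_
  rw [rootExt_l2Hm1, Gam_l2Hm1 hε q hδ h]
  rfl

/-! ### The covariance operator `C_U(v)` -/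

theorem Lop_eq : Lop ε q = realOp (Lc hε q) := by
  rw [Lop, Dq_inverse hε, Lc, h1L2, ContinuousLinearMap.comp_assoc]

theorem ofRealL2_mulL2_lamFun (f : L2R) :
    ofRealL2 (mulL2 (lamFun ε hε (ContinuousMap.toLp 2 dx ℝ v)) f) =
      mulC (rootCoefInv hε v) (mulC (rootCoefInv hε v) (ofRealL2 f)) := by
  rw [mulC_mulC]
  apply Lp.ext
  have h5 : lamFun ε hε (ContinuousMap.toLp 2 dx ℝ v) =ᵐ[dx]
      fun x => (ε ^ 2 + (ContinuousMap.toLp 2 dx ℝ v : L2R) x ^ 2)⁻¹ := MemLp.coeFn_toLp _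
  filter_upwards [coeFn_ofRealL2 (mulL2 (lamFun ε hε (ContinuousMap.toLp 2 dx ℝ v)) f),
    coeFn_mulL2 (lamFun ε hε (ContinuousMap.toLp 2 dx ℝ v)) f,
    coeFn_mulC (rootCoefInv hε v * rootCoefInv hε v) (ofRealL2 f), coeFn_ofRealL2 f, h5,
    ContinuousMap.coeFn_toLp (p := 2) (𝕜 := ℝ) dx v] with x h1 h2 h3 h4 h5 h6
  rw [h1, h2, h3, h4, h5, h6, ContinuousMap.mul_apply, rootCoefInv_apply, ← Complex.ofReal_mul,
    ← mul_inv, Real.mul_self_sqrt (by positivity), Complex.ofReal_mul]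

theorem ofRealL2_covU (f : L2R) :
    ofRealL2 (covU ε q hε (ContinuousMap.toLp 2 dx ℝ v) f) = resInv hε q v (ofRealL2 f) := by
  have h1 : ContinuousLinearMap.adjoint (Lop ε q) = realOp (LcAdj hε q) := by
    rw [Lop_eq hε]
    exact adjoint_realOp (LcAdj_conjL2 hε q) (Lc_conjL2 hε q) (inner_Lc_left hε q)
  rw [covU, h1, Lop_eq hε]
  change ofRealL2 (realOp (Lc hε q) (mulL2 (lamFun ε hε (ContinuousMap.toLp 2 dx ℝ v))
    (realOp (LcAdj hε q) f))) = _
  rw [ofRealL2_realOp (Lc_conjL2 hε q), ofRealL2_mulL2_lamFun,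
    ofRealL2_realOp (LcAdj_conjL2 hε q), resInv_apply]

theorem Gam_Gam_toHm1 {δ : ℝ} (hδ : 0 < δ) (h : IsCoercivityConst ε q δ) (f : L2R) :
    Gam ε q δ v (Gam ε q δ v (toHm1 f)) =
      toHm1 (covU ε q hε (ContinuousMap.toLp 2 dx ℝ v) f) := by
  rw [← l2Hm1_ofRealL2, ← l2Hm1_ofRealL2, Gam_l2Hm1 hε q hδ h, Gam_l2Hm1 hε q hδ h, ofRealL2_covU,
    ← rootInv_rootInv]
  rfl

/-! ### The restriction of `Γ_v` to real Sobolev spaces -/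

/-- `Γ_v` as an operator from the real space `H^s(𝕋)` to the real space `L²(𝕋)`, `s ≥ -1`. -/
def realRoot (s : ℝ) (hs : -1 ≤ s) : RHs s →L[ℝ] L2R :=
  reL2 ∘L (rootExt hε q v ∘L incl s (-1) hs).restrictScalars ℝ ∘L (RHs s).subtypeL

theorem ofRealL2_realRoot (s : ℝ) (hs : -1 ≤ s) (f : RHs s) :
    ofRealL2 (realRoot hε q v s hs f) = rootExt hε q v (incl s (-1) hs f) := by
  refine ofRealL2_reL2 ?_
  change conjL2 (rootExt hε q v (incl s (-1) hs f)) = rootExt hε q v (incl s (-1) hs f)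
  rw [← rootExt_conjHs, ← incl_conjHs, (mem_RHs_iff _).mp f.2]

theorem toHm1_realRoot {δ : ℝ} (hδ : 0 < δ) (h : IsCoercivityConst ε q δ) (s : ℝ) (hs : -1 ≤ s)
    (f : RHs s) : toHm1 (realRoot hε q v s hs f) = Gam ε q δ v (incl s (-1) hs f) := by
  rw [← l2Hm1_ofRealL2, ofRealL2_realRoot, l2Hm1_rootExt hε q v hδ h]

/-- The constant does not depend on `v`. This makes `‖W‖²` a dominating function on the product
space. -/
theorem norm_realRoot_le (s : ℝ) (hs : -1 ≤ s) (f : RHs s) :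
    ‖realRoot hε q v s hs f‖ ≤ (ε⁻¹ * ‖DqAdjInv hε q‖) * ‖f‖ := by
  rw [← norm_ofRealL2, ofRealL2_realRoot]
  refine (norm_rootExt_le hε q v _).trans ?_
  gcongr
  exact norm_incl_le _ _ _ _

end

/-! ### Measurability -/

instance : SecondCountableTopology L2R :=
  haveI : Fact ((2 : ℝ≥0∞) ≠ ∞) := ⟨by norm_num⟩
  inferInstance

instance : SecondCountableTopology L2C :=
  haveI : Fact ((2 : ℝ≥0∞) ≠ ∞) := ⟨by norm_num⟩
  inferInstance

instance (s : ℝ) : SecondCountableTopology (Hs s) :=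
  ((fourierBasis (T := 1)).repr.trans (Hs.besselIso s).symm).symm.toHomeomorph.secondCountableTopology

theorem isClosed_RHs (s : ℝ) : IsClosed (RHs s : Set (Hs s)) := by
  have h : (RHs s : Set (Hs s)) = {φ | conjHs s φ = φ} := Set.ext fun φ => mem_RHs_iff φ
  rw [h]
  exact isClosed_eq (conjHs s).continuous continuous_id

instance (s : ℝ) : CompleteSpace (RHs s) := (isClosed_RHs s).completeSpace_coe

/-! ### Measurable dependence on the continuous representative. -/

theorem toLp_injective : Function.Injective (ContinuousMap.toLp (E := ℝ) 2 dx ℝ) :=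
  ContinuousMap.toLp_injective dx

theorem contRep_ae_eq {v : L2R} (h : ∃ f : C(Circ, ℝ), (f : Circ → ℝ) =ᵐ[dx] v) :
    (contRep v : Circ → ℝ) =ᵐ[dx] v := by
  rw [contRep, dif_pos h]
  exact h.choose_spec

theorem toLp_contRep {v : L2R} (h : (contRep v : Circ → ℝ) =ᵐ[dx] v) :
    ContinuousMap.toLp 2 dx ℝ (contRep v) = v :=
  Lp.ext ((ContinuousMap.coeFn_toLp dx (contRep v)).trans h)

theorem contRep_toLp (f : C(Circ, ℝ)) : contRep (ContinuousMap.toLp 2 dx ℝ f) = f :=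
  toLp_injective (toLp_contRep (contRep_ae_eq ⟨f, (ContinuousMap.coeFn_toLp dx f).symm⟩))

theorem contRep_of_notMem_range {v : L2R}
    (h : v ∉ range (ContinuousMap.toLp (E := ℝ) 2 dx ℝ)) : contRep v = 0 := by
  rw [contRep, dif_neg]
  rintro ⟨f, hf⟩
  exact h ⟨f, Lp.ext ((ContinuousMap.coeFn_toLp dx f).trans hf)⟩

/-- By the Lusin–Souslin theorem the continuous injection of `C(𝕋)` into `L²` is a measurable
embedding. The representative is its inverse on the range and the constant default `0` off it. -/
theorem measurable_comp_contRep {E : Type*} [TopologicalSpace E] [MeasurableSpace E]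
    [BorelSpace E] {F : C(Circ, ℝ) → E} (hF : Continuous F) :
    Measurable fun v : L2R => F (contRep v) := by
  let _ : MeasurableSpace C(Circ, ℝ) := borel _
  have : BorelSpace C(Circ, ℝ) := ⟨rfl⟩
  have he : MeasurableEmbedding (ContinuousMap.toLp (E := ℝ) 2 dx ℝ) :=
    (ContinuousMap.toLp (E := ℝ) 2 dx ℝ).continuous.measurableEmbedding toLp_injective
  have h : (fun v : L2R => contRep v) =
      Function.extend (ContinuousMap.toLp (E := ℝ) 2 dx ℝ) id fun _ => 0 := by
    funext v
    by_cases hv : v ∈ range (ContinuousMap.toLp (E := ℝ) 2 dx ℝ)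
    · obtain ⟨f, rfl⟩ := hv
      rw [contRep_toLp, toLp_injective.extend_apply, id]
    · rw [contRep_of_notMem_range hv, Function.extend_apply' _ _ _ hv]
  have hm : Measurable fun v : L2R => contRep v := by
    rw [h]
    exact he.measurable_extend measurable_id measurable_const
  exact hF.measurable.comp hm

section

variable {ε : ℝ} (hε : 0 < ε) (q : ℝ)

theorem continuous_simInv : Continuous (simInv hε q) := by
  have h : Continuous fun v => mulC (rootCoefInv hε v) :=
    continuous_mulC.comp (continuous_rootCoefInv hε)
  exact (h.clm_comp continuous_const).clm_comp (continuous_const.clm_comp h)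

theorem continuous_posSqrt_simInv : Continuous fun v => posSqrt (simInv hε q v) :=
  continuousOn_posSqrt.comp_continuous (continuous_simInv hε q) (simInv_nonneg hε q)

/-- The conjugation formula reduces this to norm continuity of the square root on positive
operators, and no limit is taken under the contour integral. -/
theorem continuous_Gam_apply {ε δ : ℝ} (hε : 0 < ε) (q : ℝ) (hδ : 0 < δ) (h : IsCoercivityConst ε q δ) (f : Hs (-1)) :
    Continuous fun v => Gam ε q δ v f := by
  simp only [Gam_eq hε q hδ h, conjugation_apply]
  have h1 : Continuous fun v => factorL ε q v :=
    continuous_const.clm_comp (continuous_mulC.comp (continuous_rootCoef ε))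
  have h2 : Continuous fun v => factorLInv hε q v :=
    (continuous_mulC.comp (continuous_rootCoefInv hε)).clm_comp continuous_const
  exact h1.clm_apply ((continuous_posSqrt_simInv hε q).clm_apply (h2.clm_apply continuous_const))

theorem measurableEmbedding_toHm1 : MeasurableEmbedding toHm1 :=
  toHm1.continuous.measurableEmbedding toHm1_injective

theorem measurable_realRoot_contRep (s : ℝ) (hs : -1 ≤ s) (f : RHs s) :
    Measurable fun v : L2R => realRoot hε q (contRep v) s hs f := by
  -- The operator `realRoot` does not involve `δ`, so any coercivity constant serves to identify it
  -- with `Γ_v`.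
  obtain ⟨δ, hδ, h⟩ := exists_isCoercivityConst hε q
  refine measurableEmbedding_toHm1.measurable_comp_iff.mp ?_
  have h1 : (toHm1 ∘ fun v : L2R => realRoot hε q (contRep v) s hs f) =
      fun v : L2R => Gam ε q δ (contRep v) (incl s (-1) hs f) := by
    funext v
    exact toHm1_realRoot hε q (contRep v) hδ h s hs f
  rw [h1]
  exact measurable_comp_contRep (continuous_Gam_apply hε q hδ h _)

/-- A Carathéodory function: continuous in the distribution, measurable in `v`. -/
theorem stronglyMeasurable_uncurry_realRoot (s : ℝ) (hs : -1 ≤ s) :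
    StronglyMeasurable fun p : RHs s × L2R => realRoot hε q (contRep p.2) s hs p.1 :=
  stronglyMeasurable_uncurry_of_continuous_of_stronglyMeasurable
    (u := fun (f : RHs s) (v : L2R) => realRoot hε q (contRep v) s hs f)
    (fun v => (realRoot hε q (contRep v) s hs).continuous)
    (fun f => (measurable_realRoot_contRep hε q s hs f).stronglyMeasurable)

theorem stronglyMeasurable_realRoot_comp {α : Type*} [MeasurableSpace α] (s : ℝ) (hs : -1 ≤ s)
    {f : α → RHs s} {g : α → L2R} (hf : Measurable f) (hg : Measurable g) :
    StronglyMeasurable fun a => realRoot hε q (contRep (g a)) s hs (f a) := by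
  have h : Measurable fun a => (f a, g a) := hf.prodMk hg
  have h' := (stronglyMeasurable_uncurry_realRoot hε q s hs).comp_measurable h
  exact h'

/-! ### The covariance -/

/-- `L² ⊆ H^s`, `s ≤ 0`. -/
def l2Hs (s : ℝ) (hs : s ≤ 0) : L2C →L[ℂ] Hs s := incl 0 s hs ∘L (l2H0 : L2C →L[ℂ] Hs 0)

theorem l2Hs_coeff (s : ℝ) (hs : s ≤ 0) (f : L2C) (k : ℤ) :
    (l2Hs s hs f).coeff k = fourierBasis.repr f k := by
  rw [← l2H0_coeff]
  exact incl_coeff 0 s hs _ k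

/-- `(I - Δ)^s : H^s(𝕋) → L²(𝕋)`, `s ≤ 0`. -/
def smoothing (s : ℝ) (hs : s ≤ 0) : Hs s →L[ℂ] L2C :=
  (l2H0.symm : Hs 0 →L[ℂ] L2C) ∘L
    fourierMul (fun k => ((wt k ^ s : ℝ) : ℂ)) s 0 1 (by
      intro k
      rw [Complex.norm_real, Real.norm_of_nonneg (Real.rpow_nonneg (wt_pos k).le s), wts_zero,
        mul_one, one_mul]
      exact Real.rpow_le_rpow_of_exponent_le (one_le_wt k) (by linarith))

theorem smoothing_repr (s : ℝ) (hs : s ≤ 0) (φ : Hs s) (k : ℤ) :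
    fourierBasis.repr (smoothing s hs φ) k = ((wt k ^ s : ℝ) : ℂ) * φ.coeff k :=
  repr_l2H0_symm _ k

theorem covW_eq (s : ℝ) (hs : s ≤ 0) (φ : Hs s) :
    covW s hs φ = l2Hs s hs (smoothing s hs φ) :=
  Hs.ext_coeff fun k => by
    rw [l2Hs_coeff, smoothing_repr]
    rfl

/-- The two Bessel weights of the `H^s` inner product multiply to the symbol of `(I - Δ)^s`, which
is moved to the second argument. -/
theorem inner_l2Hs (s : ℝ) (hs : s ≤ 0) (f : L2C) (φ : Hs s) :
    inner ℂ (l2Hs s hs f) φ = inner ℂ f (smoothing s hs φ) := by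
  have h : inner ℂ (l2Hs s hs f) φ =
    inner ℂ (Hs.bessel s (l2Hs s hs f)) (Hs.bessel s φ) := rfl
  rw [h, inner_eq_tsum_repr, lp.inner_eq_tsum]
  refine tsum_congr fun k => ?_
  have hw : (wts s k : ℂ) * (wts s k : ℂ) = ((wt k ^ s : ℝ) : ℂ) := by
    rw [← Complex.ofReal_mul, wts, ← Real.rpow_add (wt_pos k), add_halves]
  rw [RCLike.inner_apply, Hs.bessel_apply, Hs.bessel_apply, l2Hs_coeff, smoothing_repr, ← hw,
    map_mul, Complex.conj_ofReal]
  ring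

theorem smoothing_conjHs (s : ℝ) (hs : s ≤ 0) (φ : Hs s) :
    smoothing s hs (conjHs s φ) = conjL2 (smoothing s hs φ) :=
  L2C.ext_repr fun k => by
    have h : wt (-k) = wt k := by simp [wt]
    rw [smoothing_repr, repr_conjL2, smoothing_repr, conjHs_coeff, map_mul, Complex.conj_ofReal, h]

theorem l2Hs_ofRealL2_mem (s : ℝ) (hs : s ≤ 0) (f : L2R) : l2Hs s hs (ofRealL2 f) ∈ RHs s := by
  rw [mem_RHs_iff]
  refine Hs.ext_coeff fun k => ?_
  rw [conjHs_coeff, l2Hs_coeff, l2Hs_coeff, ← repr_conjL2, conjL2_ofRealL2]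

theorem incl_l2Hs (s : ℝ) (hs : s ≤ 0) (hs' : -1 ≤ s) (f : L2C) :
    incl s (-1) hs' (l2Hs s hs f) = l2Hm1 f :=
  Hs.ext_coeff fun k => by rw [incl_coeff, l2Hs_coeff, l2Hm1_coeff]

/-- Write `A` for `realRoot` and `R` for `rootInv`. Testing against real `g ∈ L²`, `⟨(I - Δ)^s A*φ,
g⟩_{L²} = ⟨A*φ, g⟩_{H^s} = ⟨φ, A g⟩ = ⟨φ, R g⟩`, and `R` is self-adjoint. The test determines real
parts only, so reality of both sides is checked separately. -/
theorem smoothing_adjoint_realRoot (v : C(Circ, ℝ)) (s : ℝ) (hs : s ≤ 0) (hs' : -1 ≤ s)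
    (φ : L2R) :
    smoothing s hs (ContinuousLinearMap.adjoint (realRoot hε q v s hs') φ : RHs s) =
      rootInv hε q v (ofRealL2 φ) := by
  set ξ := ContinuousLinearMap.adjoint (realRoot hε q v s hs') φ with hξ
  have h1 : reL2 (smoothing s hs (ξ : Hs s)) = reL2 (rootInv hε q v (ofRealL2 φ)) := by
    refine ext_inner_right ℝ fun g => ?_
    have h2 : inner ℝ (reL2 (smoothing s hs (ξ : Hs s))) g =
        inner ℝ ξ (⟨l2Hs s hs (ofRealL2 g), l2Hs_ofRealL2_mem s hs g⟩ : RHs s) := by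
      rw [inner_reL2, Submodule.coe_inner, real_inner_eq_re_inner ℂ, ← inner_conj_symm,
        ← inner_l2Hs, inner_conj_symm]
      rfl
    rw [h2, hξ, ContinuousLinearMap.adjoint_inner_left]
    apply Complex.ofReal_injective
    rw [← inner_ofRealL2, ofRealL2_realRoot, incl_l2Hs, rootExt_l2Hm1, ← inner_rootInv_left,
      ← inner_ofRealL2, ofRealL2_reL2]
    rw [← rootInv_conjL2, conjL2_ofRealL2]
  have h3 : conjL2 (smoothing s hs (ξ : Hs s)) = smoothing s hs (ξ : Hs s) := by
    rw [← smoothing_conjHs, (mem_RHs_iff _).mp ξ.2]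
  have h4 : conjL2 (rootInv hε q v (ofRealL2 φ)) = rootInv hε q v (ofRealL2 φ) := by
    rw [← rootInv_conjL2, conjL2_ofRealL2]
  rw [← ofRealL2_reL2 h3, h1, ofRealL2_reL2 h4]

/-- By the preceding identity the left side is the `L²` product of the two images under the root,
and the square of the root is `C_U(v)`. -/
theorem inner_covW_adjoint (v : C(Circ, ℝ)) (s : ℝ) (hs : s ≤ 0) (hs' : -1 ≤ s) (φ ψ : L2R) :
    inner ℝ (covW s hs (ContinuousLinearMap.adjoint (realRoot hε q v s hs') φ : RHs s))
      ((ContinuousLinearMap.adjoint (realRoot hε q v s hs') ψ : RHs s) : Hs s) =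
      inner ℝ (covU ε q hε (ContinuousMap.toLp 2 dx ℝ v) φ) ψ := by
  rw [real_inner_eq_re_inner ℂ, covW_eq, inner_l2Hs, smoothing_adjoint_realRoot,
    smoothing_adjoint_realRoot, ← inner_rootInv_left, rootInv_rootInv, ← ofRealL2_covU,
    inner_ofRealL2]
  rfl

/-! ### The Gaussian random variable `Γ_v W` -/

theorem memLp_realRoot_comp {Ω : Type*} [MeasurableSpace Ω] {P : Measure Ω} {s : ℝ} {hs : s ≤ 0}
    {W : Ω → RHs s} (hW : IsWhiteNoise s hs P W) (v : C(Circ, ℝ)) (hs' : -1 ≤ s) :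
    MemLp (fun ω => realRoot hε q v s hs' (W ω)) 2 P :=
  (realRoot hε q v s hs').comp_memLp' hW.gaussian.memLp_two

theorem integral_realRoot_comp {Ω : Type*} [MeasurableSpace Ω] {P : Measure Ω}
    [IsProbabilityMeasure P] {s : ℝ} {hs : s ≤ 0}
    {W : Ω → RHs s} (hW : IsWhiteNoise s hs P W) (v : C(Circ, ℝ)) (hs' : -1 ≤ s) :
    ∫ ω, realRoot hε q v s hs' (W ω) ∂P = 0 := by
  rw [(realRoot hε q v s hs').integral_comp_comm
    (hW.gaussian.memLp_two.integrable (by norm_num)), hW.mean, map_zero]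

theorem integral_inner_realRoot {Ω : Type*} [MeasurableSpace Ω] {P : Measure Ω}
    {s : ℝ} {hs : s ≤ 0} {W : Ω → RHs s} (hW : IsWhiteNoise s hs P W) (v : C(Circ, ℝ))
    (hs' : -1 ≤ s) (φ ψ : L2R) :
    ∫ ω, inner ℝ (realRoot hε q v s hs' (W ω)) φ * inner ℝ (realRoot hε q v s hs' (W ω)) ψ ∂P =
      inner ℝ (covU ε q hε (ContinuousMap.toLp 2 dx ℝ v) φ) ψ := by
  simp only [← ContinuousLinearMap.adjoint_inner_right (realRoot hε q v s hs')]
  rw [hW.cov, inner_covW_adjoint]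

theorem integrable_inner_realRoot_prod {Ω₁ Ω₂ : Type*} [MeasurableSpace Ω₁] [MeasurableSpace Ω₂]
    {P₁ : Measure Ω₁} {P₂ : Measure Ω₂} [IsProbabilityMeasure P₁] [IsProbabilityMeasure P₂]
    {s : ℝ} {hs : s ≤ 0} {W : Ω₁ → RHs s} (hW : IsWhiteNoise s hs P₁ W) {V : Ω₂ → L2R}
    (hV : Measurable V) (hs' : -1 ≤ s) (φ ψ : L2R) :
    Integrable (fun ω : Ω₁ × Ω₂ => inner ℝ (realRoot hε q (contRep (V ω.2)) s hs' (W ω.1)) φ *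
      inner ℝ (realRoot hε q (contRep (V ω.2)) s hs' (W ω.1)) ψ) (P₁.prod P₂) := by
  have hm : StronglyMeasurable fun ω : Ω₁ × Ω₂ =>
      realRoot hε q (contRep (V ω.2)) s hs' (W ω.1) :=
    stronglyMeasurable_realRoot_comp hε q s hs' (hW.measurable.comp measurable_fst)
      (hV.comp measurable_snd)
  set C := ε⁻¹ * ‖DqAdjInv hε q‖ with hC
  have hC0 : 0 ≤ C := by positivity
  have h2 : Integrable (fun ω₁ => ‖W ω₁‖ ^ 2) P₁ := hW.gaussian.memLp_two.integrable_norm_pow two_ne_zero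
  have h3 : Integrable (fun ω : Ω₁ × Ω₂ => (C ^ 2 * (‖φ‖ * ‖ψ‖)) * ‖W ω.1‖ ^ 2) (P₁.prod P₂) :=
    (h2.comp_fst P₂).const_mul _
  refine h3.mono' ((hm.inner stronglyMeasurable_const).mul
    (hm.inner stronglyMeasurable_const)).aestronglyMeasurable
    (Filter.Eventually.of_forall fun ω => ?_)
  have h4 := norm_realRoot_le hε q (contRep (V ω.2)) s hs' (W ω.1)
  rw [← hC] at h4
  rw [norm_mul]
  calc _ ≤ (‖realRoot hε q (contRep (V ω.2)) s hs' (W ω.1)‖ * ‖φ‖) *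
        (‖realRoot hε q (contRep (V ω.2)) s hs' (W ω.1)‖ * ‖ψ‖) := by
        gcongr <;> exact norm_inner_le_norm _ _
    _ ≤ (C * ‖W ω.1‖ * ‖φ‖) * (C * ‖W ω.1‖ * ‖ψ‖) := by gcongr
    _ = _ := by ring

/-- The sets of the σ-algebra of `V` are `Ω₁ × V⁻¹(B)`, over which one may integrate in `ω₁` first;
this inner integral is the covariance for fixed `ω₂`. -/
theorem condExp_inner_realRoot {Ω₁ Ω₂ : Type*} [MeasurableSpace Ω₁] [MeasurableSpace Ω₂]
    {P₁ : Measure Ω₁} {P₂ : Measure Ω₂} [IsProbabilityMeasure P₁] [IsProbabilityMeasure P₂]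
    {s : ℝ} {hs : s ≤ 0} {W : Ω₁ → RHs s} (hW : IsWhiteNoise s hs P₁ W) {V : Ω₂ → L2R}
    (hV : Measurable V) (hVc : ∀ ω, (contRep (V ω) : Circ → ℝ) =ᵐ[dx] V ω) (hs' : -1 ≤ s)
    (φ ψ : L2R) :
    (P₁.prod P₂)[fun ω => inner ℝ (realRoot hε q (contRep (V ω.2)) s hs' (W ω.1)) φ *
      inner ℝ (realRoot hε q (contRep (V ω.2)) s hs' (W ω.1)) ψ |
      MeasurableSpace.comap (fun ω : Ω₁ × Ω₂ => V ω.2) inferInstance]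
      =ᵐ[P₁.prod P₂] fun ω => inner ℝ (covU ε q hε (V ω.2) φ) ψ := by
  have hV2 : Measurable fun ω : Ω₁ × Ω₂ => V ω.2 := hV.comp measurable_snd
  set h : Ω₁ × Ω₂ → ℝ := fun ω => inner ℝ (realRoot hε q (contRep (V ω.2)) s hs' (W ω.1)) φ *
      inner ℝ (realRoot hε q (contRep (V ω.2)) s hs' (W ω.1)) ψ with hh
  have hint : Integrable h (P₁.prod P₂) := integrable_inner_realRoot_prod hε q hW hV hs' φ ψ
  have hfib : ∀ ω₂, ∫ ω₁, h (ω₁, ω₂) ∂P₁ = inner ℝ (covU ε q hε (V ω₂) φ) ψ := fun ω₂ => by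
    have := integral_inner_realRoot hε q hW (contRep (V ω₂)) hs' φ ψ
    rwa [toLp_contRep (hVc ω₂)] at this
  have hg : Integrable (fun ω : Ω₁ × Ω₂ => inner ℝ (covU ε q hε (V ω.2) φ) ψ) (P₁.prod P₂) := by
    have h1 := hint.integral_prod_right
    simp only [hfib] at h1
    exact h1.comp_snd P₁
  -- Measurability of `v ↦ ⟨C_U(v)φ, ψ⟩` comes from this parameter integral, which agrees with it at
  -- the values of `V`.
  set F : L2R → ℝ := fun v => ∫ ω₁, inner ℝ (realRoot hε q (contRep v) s hs' (W ω₁)) φ *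
      inner ℝ (realRoot hε q (contRep v) s hs' (W ω₁)) ψ ∂P₁ with hF
  have hFm : StronglyMeasurable F := by
    have hm : StronglyMeasurable fun p : L2R × Ω₁ =>
        realRoot hε q (contRep p.1) s hs' (W p.2) :=
      stronglyMeasurable_realRoot_comp hε q s hs' (hW.measurable.comp measurable_snd)
        measurable_fst
    exact ((hm.inner stronglyMeasurable_const).mul
      (hm.inner stronglyMeasurable_const)).integral_prod_right
  have hFeq : (fun ω : Ω₁ × Ω₂ => inner ℝ (covU ε q hε (V ω.2) φ) ψ) = fun ω => F (V ω.2) :=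
    funext fun ω => (hfib ω.2).symm
  symm
  refine ae_eq_condExp_of_forall_setIntegral_eq hV2.comap_le hint (fun _ _ _ => hg.integrableOn)
    ?_ ?_
  · rintro _ ⟨B, hB, rfl⟩ _
    have hset : (fun ω : Ω₁ × Ω₂ => V ω.2) ⁻¹' B = univ ×ˢ (V ⁻¹' B) := by
      ext ω
      simp
    have h1 := hint.integrableOn (s := univ ×ˢ (V ⁻¹' B))
    have h2 := hg.integrableOn (s := univ ×ˢ (V ⁻¹' B))
    rw [IntegrableOn, ← Measure.prod_restrict, Measure.restrict_univ] at h1 h2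
    rw [hset, ← Measure.prod_restrict, Measure.restrict_univ, integral_prod_symm _ h1,
      integral_prod_symm _ h2]
    simp [hfib]
  · rw [hFeq]
    exact (hFm.comp_measurable (comap_measurable _)).aestronglyMeasurable

end

/-! ### The heat kernel on the circle -/

open HurwitzZeta

/-- The symbol `e^{-πk²y}` of the heat semigroup. -/
def heatWt (y : ℝ) (k : ℤ) : ℝ := Real.exp (-Real.pi * (k : ℝ) ^ 2 * y)

theorem heatWt_pos (y : ℝ) (k : ℤ) : 0 < heatWt y k := Real.exp_pos _

theorem heatWt_anti {y y' : ℝ} (h : y ≤ y') (k : ℤ) : heatWt y' k ≤ heatWt y k := by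
  refine Real.exp_le_exp.mpr ?_
  have h1 : 0 ≤ Real.pi * (k : ℝ) ^ 2 := by positivity
  nlinarith

theorem hasSum_cosKernel (x : Circ) {y : ℝ} (hy : 0 < y) :
    HasSum (fun k : ℤ => fourier k x * (heatWt y k : ℂ)) (cosKernel x y : ℂ) := by
  induction x using QuotientAddGroup.induction_on with
  | H a =>
    refine (hasSum_int_cosKernel a hy).congr_fun fun k => ?_
    rw [fourier_coe_apply]
    congr 2
    push_cast
    ring

theorem hasSum_heatWt {y : ℝ} (hy : 0 < y) : HasSum (heatWt y) (cosKernel 0 y) := by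
  have h := hasSum_cosKernel 0 hy
  simp only [fourier_eval_zero, one_mul] at h
  exact_mod_cast h

theorem summable_heatWt {y : ℝ} (hy : 0 < y) : Summable (heatWt y) := (hasSum_heatWt hy).summable

/-- The sign is not visible in the cosine series. The functional equation of the theta function
turns it into a sum of Gaussians. -/
theorem cosKernel_nonneg (x : Circ) {y : ℝ} (hy : 0 < y) : 0 ≤ cosKernel x y := by
  have h1 := evenKernel_functional_equation x (1 / y)
  rw [one_div_one_div] at h1
  have h2 : 0 ≤ evenKernel x (1 / y) := by
    induction x using QuotientAddGroup.induction_on with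
    | H a => exact (hasSum_int_evenKernel a (by positivity)).nonneg fun _ => (Real.exp_pos _).le
  rw [h1] at h2
  exact nonneg_of_mul_nonneg_right h2 (by positivity)

theorem cosKernel_le (x : Circ) {y : ℝ} (hy : 0 < y) : cosKernel x y ≤ cosKernel 0 y := by
  have h1 := hasSum_cosKernel x hy
  have h2 : ‖(cosKernel x y : ℂ)‖ ≤ cosKernel 0 y := by
    rw [← h1.tsum_eq]
    refine tsum_of_norm_bounded (hasSum_heatWt hy) fun k => ?_
    rw [norm_mul, Complex.norm_real, Real.norm_of_nonneg (heatWt_pos y k).le]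
    refine mul_le_of_le_one_left (heatWt_pos y k).le ?_
    exact (ContinuousMap.norm_coe_le_norm _ x).trans (fourier_norm k).le
  rw [Complex.norm_real] at h2
  exact (Real.le_norm_self _).trans h2

theorem cosKernel_zero_anti {y y' : ℝ} (hy : 0 < y) (h : y ≤ y') :
    cosKernel 0 y' ≤ cosKernel 0 y :=
  hasSum_le (fun k => heatWt_anti h k) (hasSum_heatWt (hy.trans_le h)) (hasSum_heatWt hy)

/-- The functional equation exchanges `y` and `1/y` at the price of `y^{-1/2}`, the rate of blow-up
of the one-dimensional heat kernel. -/
theorem cosKernel_zero_le_of_le_one {y : ℝ} (hy : 0 < y) (h : y ≤ 1) :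
    cosKernel 0 y ≤ cosKernel 0 1 * y ^ (-(1 / 2) : ℝ) := by
  have h1 := evenKernel_functional_equation 0 y
  rw [evenKernel_eq_cosKernel_of_zero] at h1
  have h2 : cosKernel 0 (1 / y) ≤ cosKernel 0 1 :=
    cosKernel_zero_anti one_pos ((one_le_div hy).mpr h)
  rw [h1, Real.rpow_neg hy.le, one_div, mul_comm]
  gcongr

theorem cosKernel_zero_one_pos : 0 < cosKernel 0 1 := by
  have h := hasSum_heatWt one_pos
  rw [← h.tsum_eq]
  exact h.summable.tsum_pos (fun k => (heatWt_pos 1 k).le) 0 (heatWt_pos 1 0)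

theorem cosKernel_zero_rpow_le {y θ : ℝ} (hy : 0 < y) (hθ : 0 ≤ θ) :
    cosKernel 0 y ^ θ ≤ cosKernel 0 1 ^ θ * (1 + y ^ (-(θ / 2))) := by
  have hC := cosKernel_zero_one_pos
  have h0 : 0 ≤ cosKernel 0 y := cosKernel_nonneg 0 hy
  have h1 : 0 ≤ y ^ (-(θ / 2)) := by positivity
  rcases le_total y 1 with h | h
  · calc cosKernel 0 y ^ θ ≤ (cosKernel 0 1 * y ^ (-(1 / 2) : ℝ)) ^ θ := by
          gcongr
          exact cosKernel_zero_le_of_le_one hy h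
      _ = cosKernel 0 1 ^ θ * y ^ (-(θ / 2)) := by
          rw [Real.mul_rpow hC.le (by positivity), ← Real.rpow_mul hy.le]
          congr 2
          ring
      _ ≤ _ := by
          gcongr
          linarith
  · calc cosKernel 0 y ^ θ ≤ cosKernel 0 1 ^ θ := by
          gcongr
          exact cosKernel_zero_anti one_pos h
      _ ≤ _ := le_mul_of_one_le_right (by positivity) (by linarith)

/-- The heat kernel as a continuous function. -/
def heatKer (y : ℝ) : C(Circ, ℂ) := ∑' k : ℤ, (heatWt y k : ℂ) • fourier k

theorem summable_norm_smul_fourier {y C : ℝ} (hy : 0 < y) {a : ℤ → ℂ}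
    (h : ∀ k, ‖a k‖ ≤ C * heatWt y k) :
    Summable fun k => ‖a k • (fourier k : C(Circ, ℂ))‖ := by
  refine Summable.of_nonneg_of_le (fun _ => norm_nonneg _) (fun k => ?_)
    ((summable_heatWt hy).mul_left C)
  rw [norm_smul, fourier_norm, mul_one]
  exact h k

theorem heatKer_apply {y : ℝ} (hy : 0 < y) (x : Circ) : heatKer y x = (cosKernel x y : ℂ) := by
  have h1 : Summable fun k : ℤ => (heatWt y k : ℂ) • (fourier k : C(Circ, ℂ)) :=
    (summable_norm_smul_fourier (C := 1) hy fun k => by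
      rw [Complex.norm_real, Real.norm_of_nonneg (heatWt_pos y k).le, one_mul]).of_norm
  have h2 := h1.hasSum.mapL (ContinuousMap.evalCLM ℂ x)
  have h3 := hasSum_cosKernel x hy
  refine h2.unique (h3.congr_fun fun k => ?_)
  change (heatWt y k : ℂ) * fourier k x = _
  rw [mul_comm]

theorem continuous_cosKernel {y : ℝ} (hy : 0 < y) : Continuous fun x : Circ => cosKernel x y := by
  have h : (fun x : Circ => cosKernel x y) = fun x => (heatKer y x).re := by
    funext x
    rw [heatKer_apply hy, Complex.ofReal_re]
  rw [h]
  fun_prop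

/-- The Fourier coefficients of continuous functions. -/
def coeffL (k : ℤ) : C(Circ, ℂ) →L[ℂ] ℂ :=
  innerSL ℂ (fourierBasis k : L2C) ∘L ContinuousMap.toLp 2 dx ℂ

theorem coeffL_eq_repr (k : ℤ) (f : C(Circ, ℂ)) :
    coeffL k f = fourierBasis.repr (ContinuousMap.toLp 2 dx ℂ f) k :=
  by rw [HilbertBasis.repr_apply_apply]; rfl

theorem coeffL_apply (k : ℤ) (f : C(Circ, ℂ)) : coeffL k f = fourierCoeff f k := by
  rw [coeffL_eq_repr, fourierBasis_repr, fourierCoeff_toLp]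

theorem coeffL_tsum {y C : ℝ} (hy : 0 < y) {a : ℤ → ℂ} (h : ∀ k, ‖a k‖ ≤ C * heatWt y k) (k : ℤ) :
    coeffL k (∑' j : ℤ, a j • fourier j) = a k := by
  rw [(coeffL k).map_tsum (summable_norm_smul_fourier hy h).of_norm, tsum_eq_single k]
  · rw [map_smul, coeffL_apply, fourierCoeff_fourier, Pi.single_eq_same, smul_eq_mul, mul_one]
  · intro j hj
    rw [map_smul, coeffL_apply, fourierCoeff_fourier, Pi.single_eq_of_ne hj.symm, smul_zero]

theorem integral_cosKernel {y : ℝ} (hy : 0 < y) : ∫ x, cosKernel x y ∂dx = 1 := by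
  have h1 : coeffL 0 (heatKer y) = 1 := by
    rw [heatKer, coeffL_tsum (C := 1) hy fun k => by
      rw [Complex.norm_real, Real.norm_of_nonneg (heatWt_pos y k).le, one_mul]]
    simp [heatWt]
  rw [coeffL_apply, fourierCoeff] at h1
  simp only [neg_zero, fourier_zero, one_smul, heatKer_apply hy] at h1
  rw [integral_complex_ofReal] at h1
  exact_mod_cast h1

/-! ### The heat semigroup applied to an `L^p` function -/

theorem norm_fourierCoeff_le {g : Circ → ℂ} (k : ℤ) :
    ‖fourierCoeff g k‖ ≤ ∫ x, ‖g x‖ ∂dx := by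
  rw [fourierCoeff]
  refine (norm_integral_le_integral_norm _).trans_eq (integral_congr_ae ?_)
  refine Filter.Eventually.of_forall fun x => ?_
  simp only [norm_smul]
  rw [fourier_apply, Circle.norm_coe, one_mul]

/-- The convolution of the heat kernel with a function. -/
def heatConv (y : ℝ) (g : Circ → ℝ) : C(Circ, ℂ) :=
  ∑' k : ℤ, ((heatWt y k : ℂ) * fourierCoeff (fun x => (g x : ℂ)) k) • fourier k

theorem norm_heatWt_mul_fourierCoeff_le (y : ℝ) (g : Circ → ℝ) (k : ℤ) :
    ‖(heatWt y k : ℂ) * fourierCoeff (fun x => (g x : ℂ)) k‖ ≤ (∫ x, ‖(g x : ℂ)‖ ∂dx) * heatWt y k := by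
  rw [norm_mul, Complex.norm_real, Real.norm_of_nonneg (heatWt_pos y k).le, mul_comm]
  exact mul_le_mul_of_nonneg_right (norm_fourierCoeff_le k) (heatWt_pos y k).le

theorem coeffL_heatConv {y : ℝ} (hy : 0 < y) (g : Circ → ℝ) (k : ℤ) :
    coeffL k (heatConv y g) = (heatWt y k : ℂ) * fourierCoeff (fun x => (g x : ℂ)) k :=
  coeffL_tsum hy (norm_heatWt_mul_fourierCoeff_le y g) k

/-- The series gives the coefficients and continuity in `y`; this integral form, through positivity
of the kernel, gives the `L^p` bound. -/
theorem heatConv_apply {y : ℝ} (hy : 0 < y) {g : Circ → ℝ} (hg : Integrable g dx) (x : Circ) :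
    heatConv y g x = ((∫ z, cosKernel (x - z) y * g z ∂dx : ℝ) : ℂ) := by
  have h1 := (summable_norm_smul_fourier hy (norm_heatWt_mul_fourierCoeff_le y g)).of_norm.hasSum.mapL
    (ContinuousMap.evalCLM ℂ x)
  have hgc : Integrable (fun z => (g z : ℂ)) dx := hg.ofReal
  have h2 : HasSum (fun k : ℤ => ∫ z, (fourier k (x - z) * (heatWt y k : ℂ)) * (g z : ℂ) ∂dx)
      (∫ z, ∑' k : ℤ, (fourier k (x - z) * (heatWt y k : ℂ)) * (g z : ℂ) ∂dx) := by
    have hn : ∀ (k : ℤ) (z : Circ), ‖(fourier k (x - z) * (heatWt y k : ℂ)) * (g z : ℂ)‖ =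
        heatWt y k * ‖g z‖ := fun k z => by
      rw [norm_mul, norm_mul, fourier_apply, Circle.norm_coe, one_mul, Complex.norm_real,
        Complex.norm_real, Real.norm_of_nonneg (heatWt_pos y k).le]
    refine hasSum_integral_of_summable_integral_norm (fun k => ?_) ?_
    · refine (hg.norm.const_mul (heatWt y k)).mono' ?_ (Filter.Eventually.of_forall fun z =>
        (hn k z).le)
      refine AEStronglyMeasurable.mul ?_ hgc.aestronglyMeasurable
      have hc : Continuous fun z : Circ => fourier k (x - z) * (heatWt y k : ℂ) := by fun_prop
      exact hc.aestronglyMeasurable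
    · simp only [hn, integral_const_mul]
      exact (summable_heatWt hy).mul_right _
  have h3 : (∫ z, ∑' k : ℤ, (fourier k (x - z) * (heatWt y k : ℂ)) * (g z : ℂ) ∂dx) =
      ((∫ z, cosKernel (x - z) y * g z ∂dx : ℝ) : ℂ) := by
    rw [← integral_complex_ofReal]
    refine integral_congr_ae (Filter.Eventually.of_forall fun z => ?_)
    simp only
    rw [tsum_mul_right, (hasSum_cosKernel (x - z) hy).tsum_eq, Complex.ofReal_mul]
  rw [← h3]
  refine h1.unique (h2.congr_fun fun k => ?_)
  change ((heatWt y k : ℂ) * fourierCoeff (fun x => (g x : ℂ)) k) * fourier k x = _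
  rw [fourierCoeff, mul_assoc, mul_comm (∫ _, _ ∂_), ← integral_const_mul, ← integral_const_mul]
  refine integral_congr_ae (Filter.Eventually.of_forall fun z => ?_)
  have h4 : fourier k (x - z) = fourier k x * fourier (-k) z := by
    rw [fourier_apply, fourier_apply, fourier_apply, smul_sub, sub_eq_add_neg, AddCircle.toCircle_add,
      neg_smul, Circle.coe_mul]
  simp only [smul_eq_mul]
  rw [h4]
  ring

/-- Hölder's inequality with the conjugate exponent `r`: the kernel has integral one and maximum at
zero, so the integral of its `r`-th power is at most the `(r - 1)`-th power of the maximum, and `(r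
- 1)/r = 1/p`. -/
theorem norm_heatConv_le {y : ℝ} (hy : 0 < y) {p : ℝ} (hp : 1 < p) {g : Circ → ℝ}
    (hg : MemLp g (ENNReal.ofReal p) dx) :
    ‖heatConv y g‖ ≤ cosKernel 0 y ^ (1 / p) * (∫ z, ‖g z‖ ^ p ∂dx) ^ (1 / p) := by
  have hM := cosKernel_nonneg 0 hy
  have hI : 0 ≤ ∫ z, ‖g z‖ ^ p ∂dx := integral_nonneg fun z => by positivity
  have hg1 : Integrable g dx := hg.integrable (by
    rw [← ENNReal.ofReal_one]; exact ENNReal.ofReal_le_ofReal hp.le)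
  rw [ContinuousMap.norm_le _ (by positivity)]
  intro x
  have hpq := Real.HolderConjugate.conjExponent hp
  set r := p.conjExponent with hr
  have hc : Continuous fun z : Circ => cosKernel (x - z) y :=
    (continuous_cosKernel hy).comp (by fun_prop)
  have h0 : ∀ z, 0 ≤ cosKernel (x - z) y := fun z => cosKernel_nonneg _ hy
  have hmem : ∀ t : ℝ≥0∞, MemLp (fun z => cosKernel (x - z) y) t dx := fun t =>
    MemLp.of_bound hc.aestronglyMeasurable (cosKernel 0 y) (Filter.Eventually.of_forall fun z => by
      rw [Real.norm_of_nonneg (h0 z)]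
      exact cosKernel_le _ hy)
  rw [heatConv_apply hy hg1, Complex.norm_real]
  have h1 : ‖∫ z, cosKernel (x - z) y * g z ∂dx‖ ≤ ∫ z, ‖g z‖ * cosKernel (x - z) y ∂dx := by
    refine (norm_integral_le_integral_norm _).trans_eq (integral_congr_ae ?_)
    refine Filter.Eventually.of_forall fun z => ?_
    simp only [norm_mul]
    rw [Real.norm_of_nonneg (h0 z), mul_comm]
  have h2 := integral_mul_le_Lp_mul_Lq_of_nonneg hpq
    (f := fun z => ‖g z‖) (g := fun z => cosKernel (x - z) y)
    (Filter.Eventually.of_forall fun z => norm_nonneg _) (Filter.Eventually.of_forall h0)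
    hg.norm (hmem _)
  have h3 : ∫ z, cosKernel (x - z) y ^ r ∂dx ≤ cosKernel 0 y ^ (r - 1) := by
    have h4 : ∀ z, cosKernel (x - z) y ^ r ≤ cosKernel 0 y ^ (r - 1) * cosKernel (x - z) y := by
      intro z
      have h5 : cosKernel (x - z) y ^ r = cosKernel (x - z) y ^ (r - 1) * cosKernel (x - z) y := by
        have h7 := Real.rpow_add_of_nonneg (h0 z) (sub_pos.mpr hpq.symm.lt).le zero_le_one
        rwa [sub_add_cancel, Real.rpow_one] at h7
      rw [h5]
      have := h0 z
      have := sub_pos.mpr hpq.symm.lt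
      gcongr
      exact cosKernel_le _ hy
    calc ∫ z, cosKernel (x - z) y ^ r ∂dx
        ≤ ∫ z, cosKernel 0 y ^ (r - 1) * cosKernel (x - z) y ∂dx := by
          refine integral_mono_of_nonneg (Filter.Eventually.of_forall fun z => ?_)
            (((hmem 1).integrable le_rfl).const_mul _) (Filter.Eventually.of_forall h4)
          exact Real.rpow_nonneg (h0 z) _
      _ = cosKernel 0 y ^ (r - 1) := by
          rw [integral_const_mul, integral_sub_left_eq_self (fun z => cosKernel z y) dx x,
            integral_cosKernel hy, mul_one]
  refine (h1.trans h2).trans ?_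
  rw [mul_comm]
  gcongr
  have h8 : 0 ≤ ∫ z, cosKernel (x - z) y ^ r ∂dx :=
    integral_nonneg fun z => Real.rpow_nonneg (h0 z) _
  have hr0 : 0 < r := hpq.symm.pos
  calc (∫ z, cosKernel (x - z) y ^ r ∂dx) ^ (1 / r) ≤ (cosKernel 0 y ^ (r - 1)) ^ (1 / r) := by
        gcongr
    _ = cosKernel 0 y ^ (1 / p) := by
        rw [← Real.rpow_mul hM]
        congr 1
        have h9 := hpq.symm.inv_add_inv_eq_one
        field_simp
        field_simp at h9
        linarith

theorem continuousOn_heatConv (g : Circ → ℝ) : ContinuousOn (fun y => heatConv y g) (Ioi 0) := by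
  intro y hy
  have hy' : 0 < y / 2 := half_pos hy
  have h : ContinuousOn (fun y => heatConv y g) (Ioi (y / 2)) := by
    refine continuousOn_tsum (u := fun k => (∫ x, ‖(g x : ℂ)‖ ∂dx) * heatWt (y / 2) k) (fun k => ?_)
      ((summable_heatWt hy').mul_left _) fun k z hz => ?_
    · unfold heatWt
      fun_prop
    · rw [norm_smul, fourier_norm, mul_one]
      refine (norm_heatWt_mul_fourierCoeff_le z g k).trans ?_
      gcongr
      exact heatWt_anti (le_of_lt hz) k
  exact (h.continuousAt (Ioi_mem_nhds (by linarith [mem_Ioi.mp hy]))).continuousWithinAt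

/-! ### The Sobolev embedding -/

/-- The integrand in the subordination formula for `(I - Δ)^{-t/2}`. -/
def besselIntegrand (t : ℝ) (g : Circ → ℝ) (u : ℝ) : C(Circ, ℂ) :=
  ((u ^ (t / 2 - 1) * Real.exp (-u) : ℝ) : ℂ) • heatConv (4 * Real.pi * u) g

/-- Near zero the norm is of order at most `u^{t/2 - 1 - 1/(2p)}`, integrable because `tp > 1`; the
exponential controls infinity. The two terms of the majorant are Gamma integrands. -/
theorem integrableOn_besselIntegrand {t p : ℝ} (hp : 1 < p) (htp : 1 < t * p) {g : Circ → ℝ}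
    (hg : MemLp g (ENNReal.ofReal p) dx) : IntegrableOn (besselIntegrand t g) (Ioi 0) := by
  have hp0 : 0 < p := by linarith
  have ht : 1 / p < t := by rw [div_lt_iff₀ hp0]; exact htp
  have hθ : 0 ≤ 1 / p := by positivity
  set K := cosKernel 0 1 ^ (1 / p) * (∫ z, ‖g z‖ ^ p ∂dx) ^ (1 / p) with hK
  have hK0 : 0 ≤ K := by
    have := cosKernel_zero_one_pos
    have hI : 0 ≤ ∫ z, ‖g z‖ ^ p ∂dx := integral_nonneg fun z => by positivity
    positivity
  have i1 := Real.GammaIntegral_convergent (s := t / 2) (by linarith [hθ.trans_lt ht])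
  have i2 := Real.GammaIntegral_convergent (s := t / 2 - 1 / p / 2) (by linarith)
  have i3 : IntegrableOn (fun u => K * (Real.exp (-u) * u ^ (t / 2 - 1) +
      Real.exp (-u) * u ^ (t / 2 - 1 / p / 2 - 1))) (Ioi 0) := (i1.add i2).const_mul K
  refine Integrable.mono' i3 ?_ ?_
  · have hc1 : ContinuousOn (fun u : ℝ => ((u ^ (t / 2 - 1) * Real.exp (-u) : ℝ) : ℂ)) (Ioi 0) := by
      refine Complex.continuous_ofReal.comp_continuousOn (ContinuousOn.mul ?_ (by fun_prop))
      exact continuousOn_id.rpow_const fun u hu => Or.inl (ne_of_gt hu)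
    have hc2 : ContinuousOn (fun u : ℝ => heatConv (4 * Real.pi * u) g) (Ioi 0) := by
      refine (continuousOn_heatConv g).comp (by fun_prop) fun u hu => ?_
      have : (0 : ℝ) < u := hu
      exact mem_Ioi.mpr (by positivity)
    exact (hc1.smul hc2).aestronglyMeasurable measurableSet_Ioi
  · refine ae_restrict_of_forall_mem measurableSet_Ioi fun u hu => ?_
    have hu0 : (0 : ℝ) < u := hu
    have hy : 0 < 4 * Real.pi * u := by positivity
    have h1 := norm_heatConv_le hy hp hg
    have h2 := cosKernel_zero_rpow_le hy hθ
    have h3 : (4 * Real.pi * u) ^ (-(1 / p / 2)) ≤ u ^ (-(1 / p / 2)) := by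
      refine Real.rpow_le_rpow_of_nonpos hu0 ?_ (by linarith [div_nonneg hθ two_pos.le])
      nlinarith [Real.pi_gt_three]
    have hI : 0 ≤ (∫ z, ‖g z‖ ^ p ∂dx) ^ (1 / p) :=
      Real.rpow_nonneg (integral_nonneg fun z => by positivity) _
    have hC0 : 0 ≤ cosKernel 0 1 ^ (1 / p) := Real.rpow_nonneg cosKernel_zero_one_pos.le _
    have h4 : ‖heatConv (4 * Real.pi * u) g‖ ≤ K * (1 + u ^ (-(1 / p / 2))) := by
      calc _ ≤ (cosKernel 0 1 ^ (1 / p) * (1 + u ^ (-(1 / p / 2)))) *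
            (∫ z, ‖g z‖ ^ p ∂dx) ^ (1 / p) := by
            refine h1.trans (mul_le_mul_of_nonneg_right (h2.trans ?_) hI)
            gcongr
        _ = _ := by rw [hK]; ring
    rw [besselIntegrand, norm_smul, Complex.norm_real, Real.norm_of_nonneg (by positivity)]
    calc _ ≤ (u ^ (t / 2 - 1) * Real.exp (-u)) * (K * (1 + u ^ (-(1 / p / 2)))) := by gcongr
      _ = K * (Real.exp (-u) * u ^ (t / 2 - 1) +
          Real.exp (-u) * (u ^ (t / 2 - 1) * u ^ (-(1 / p / 2)))) := by ring
      _ = _ := by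
          rw [← Real.rpow_add hu0]
          congr 4
          ring

theorem coeffL_integral_besselIntegrand {t p : ℝ} (hp : 1 < p) (htp : 1 < t * p) {g : Circ → ℝ}
    (hg : MemLp g (ENNReal.ofReal p) dx) (k : ℤ) :
    coeffL k (∫ u in Ioi 0, besselIntegrand t g u) =
      (((1 / wt k) ^ (t / 2) * Real.Gamma (t / 2) : ℝ) : ℂ) *
        fourierCoeff (fun x => (g x : ℂ)) k := by
  have ht : 0 < t / 2 := by
    have : 0 < t := by
      by_contra h
      nlinarith
    linarith
  rw [← (coeffL k).integral_comp_comm (integrableOn_besselIntegrand hp htp hg),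
    ← Real.integral_rpow_mul_exp_neg_mul_Ioi ht (wt_pos k), ← integral_complex_ofReal,
    ← integral_mul_const]
  refine setIntegral_congr_fun measurableSet_Ioi fun u hu => ?_
  have hu0 : (0 : ℝ) < u := hu
  have hy : 0 < 4 * Real.pi * u := by positivity
  simp only [besselIntegrand, map_smul, coeffL_heatConv hy, smul_eq_mul]
  -- At time `4πu` the heat weight is `e^{-4π²k²u}`; with `e^{-u}` it combines to `e^{-u (1 +
  -- 4π²k²)}`.
  rw [← mul_assoc, ← Complex.ofReal_mul, heatWt, mul_assoc (u ^ _), ← Real.exp_add]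
  congr 5
  rw [wt]
  ring

/-- The subordination integral converges in `C(𝕋)`. Divided by `Γ(t/2)` it has the Fourier
coefficients of `v`, and these determine the class. -/
theorem exists_continuous_of_isBesselDeriv {t p : ℝ} (hp : 1 < p) (htp : 1 < t * p) {g : Circ → ℝ}
    (hg : MemLp g (ENNReal.ofReal p) dx) {v : L2R} (h : IsBesselDeriv t v g) :
    ∃ f : C(Circ, ℝ), (f : Circ → ℝ) =ᵐ[dx] v := by
  have ht : 0 < t / 2 := by
    have : 0 < t := by
      by_contra h
      nlinarith
    linarith
  set F : C(Circ, ℂ) := ((Real.Gamma (t / 2))⁻¹ : ℂ) • ∫ u in Ioi 0, besselIntegrand t g u with hF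
  have hΓ : (Real.Gamma (t / 2) : ℂ) ≠ 0 := by exact_mod_cast (Real.Gamma_pos_of_pos ht).ne'
  have h1 : ContinuousMap.toLp 2 dx ℂ F = ofRealL2 v := by
    refine L2C.ext_repr fun k => ?_
    have hw : (wts t k : ℂ) ≠ 0 := by exact_mod_cast (wts_pos t k).ne'
    rw [← coeffL_eq_repr, hF, map_smul, coeffL_integral_besselIntegrand hp htp hg, ← h k,
      fourierBasis_repr, fourierCoeff_congr_ae (coeFn_ofRealL2 v), smul_eq_mul, one_div,
      Real.inv_rpow (wt_pos k).le]
    change _ * (((((wts t k)⁻¹ * Real.Gamma (t / 2) : ℝ) : ℂ)) * _) = _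
    push_cast
    field_simp
  refine ⟨⟨fun x => (F x).re, by fun_prop⟩, ?_⟩
  have h2 := ContinuousMap.coeFn_toLp (p := 2) (𝕜 := ℂ) dx F
  rw [h1] at h2
  filter_upwards [h2, coeFn_ofRealL2 v] with x h3 h4
  rw [ContinuousMap.coe_mk, ← h3, h4, Complex.ofReal_re]

theorem contRep_ae_eq_of_isSobolevValued {t : ℝ} {p : ℝ≥0∞} [Fact (1 ≤ p)] (hp : 1 < p)
    (hp' : p ≠ ∞) (htp : 1 < t * p.toReal) {Ω : Type*} [MeasurableSpace Ω] {V : Ω → L2R}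
    (hV : IsSobolevValued t p V) (ω : Ω) : (contRep (V ω) : Circ → ℝ) =ᵐ[dx] V ω := by
  obtain ⟨g, -, hg⟩ := hV
  have h1 : 1 < p.toReal := by
    rw [← ENNReal.toReal_one]
    exact (ENNReal.toReal_lt_toReal ENNReal.one_ne_top hp').mpr hp
  refine contRep_ae_eq (exists_continuous_of_isBesselDeriv h1 htp ?_ (hg ω))
  rw [ENNReal.ofReal_toReal hp']
  exact Lp.memLp (g ω)

end

end HierPrior

/-! ### Assembly of the theorem. -/

open HierPrior in
theorem proposition3p5 {Ω₁ Ω₂ : Type*} [MeasurableSpace Ω₁] [MeasurableSpace Ω₂]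
    (P₁ : Measure Ω₁) [IsProbabilityMeasure P₁] (P₂ : Measure Ω₂) [IsProbabilityMeasure P₂]
    (ε q : ℝ) (hε : 0 < ε) (hq : 1 < q)
    (t₀ : ℝ) (p₀ : ℝ≥0∞) [Fact (1 ≤ p₀)] (ht₀ : t₀ < 1 / 2) (hp₀ : 1 < p₀) (hp₀' : p₀ ≠ ∞)
    (htp : 1 < t₀ * p₀.toReal)
    (V : Ω₂ → L2R) (hV : IsPriorV ε P₂ V) (hV' : IsSobolevValued t₀ p₀ V) :
    (∃ δ : ℝ, 0 < δ ∧ IsCoercivityConst ε q δ) ∧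
    (∀ ω₂, (contRep (V ω₂) : Circ → ℝ) =ᵐ[dx] V ω₂) ∧
    ∀ δ : ℝ, 0 < δ → IsCoercivityConst ε q δ →
      (∀ (v : C(Circ, ℝ)) (φ : L2R), Gam ε q δ v (Gam ε q δ v (toHm1 φ)) =
        toHm1 (covU ε q hε (ContinuousMap.toLp 2 dx ℝ v) φ)) ∧
      ∀ (s : ℝ) (hs : -1 < s) (hs' : s < -1 / 2),
        ∃ G : Ω₂ → RHs s →L[ℝ] L2R,
          (∀ (ω₂ : Ω₂) (f : RHs s), toHm1 (G ω₂ f) =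
            Gam ε q δ (contRep (V ω₂)) (incl s (-1) hs.le f)) ∧
          (∀ f : RHs s, StronglyMeasurable fun ω₂ => G ω₂ f) ∧
          ∀ W : Ω₁ → RHs s, IsWhiteNoise s (by linarith) P₁ W →
            StronglyMeasurable (fun ω : Ω₁ × Ω₂ => G ω.2 (W ω.1)) ∧
            (∀ ω₂, MemLp (fun ω₁ => G ω₂ (W ω₁)) 2 P₁ ∧
              ∫ ω₁, G ω₂ (W ω₁) ∂P₁ = 0 ∧
              ∀ φ ψ : L2R, ∫ ω₁, inner ℝ (G ω₂ (W ω₁)) φ * inner ℝ (G ω₂ (W ω₁)) ψ ∂P₁ =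
                inner ℝ (covU ε q hε (V ω₂) φ) ψ) ∧
            ∀ φ ψ : L2R,
              (P₁.prod P₂)[fun ω => inner ℝ (G ω.2 (W ω.1)) φ * inner ℝ (G ω.2 (W ω.1)) ψ |
                  MeasurableSpace.comap (fun ω : Ω₁ × Ω₂ => V ω.2) inferInstance]
                =ᵐ[P₁.prod P₂] fun ω => inner ℝ (covU ε q hε (V ω.2) φ) ψ := by
  have hVc := contRep_ae_eq_of_isSobolevValued hp₀ hp₀' htp hV'
  refine ⟨exists_isCoercivityConst hε q, hVc, fun δ hδ h =>
    ⟨fun v φ => Gam_Gam_toHm1 hε q v hδ h φ, fun s hs hs' => ?_⟩⟩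
  refine ⟨fun ω₂ => realRoot hε q (contRep (V ω₂)) s hs.le,
    fun ω₂ f => toHm1_realRoot hε q (contRep (V ω₂)) hδ h s hs.le f, fun f => ?_, fun W hW => ?_⟩
  · have h1 := (measurable_realRoot_contRep hε q s hs.le f).comp hV.measurable
    exact h1.stronglyMeasurable
  refine ⟨?_, fun ω₂ => ⟨?_, ?_, fun φ ψ => ?_⟩, fun φ ψ => ?_⟩
  · have h1 := stronglyMeasurable_realRoot_comp hε q s hs.le
      (hW.measurable.comp (measurable_fst (β := Ω₂))) (hV.measurable.comp (measurable_snd (α := Ω₁)))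
    exact h1
  · have h1 := memLp_realRoot_comp hε q hW (contRep (V ω₂)) hs.le
    exact h1
  · have h1 := integral_realRoot_comp hε q hW (contRep (V ω₂)) hs.le
    exact h1
  · have h1 := integral_inner_realRoot hε q hW (contRep (V ω₂)) hs.le φ ψ
    -- The covariance was computed for the class of the continuous representative, which is `V ω₂`
    -- itself.
    rw [toLp_contRep (hVc ω₂)] at h1
    exact h1
  · have h1 := condExp_inner_realRoot (P₂ := P₂) hε q hW hV.measurable hVc hs.le φ ψ
    exact h1
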